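/- Let $f,g$ be entire functions of genus $0$ such that $f(z)=0$ implies $z<0$ and $g(z)=0$ implies $z\ge 0$, that is, $$f(z)=f_0\prod_{\mu}\Bigl(1+\frac z{b_\mu}\Bigr),\qquad g(z)=g_0z^j\prod_{\nu}\Bigl(1-\frac z{a_\nu}\Bigr),$$ where $f_0,g_0\in\mathbb C\setminus\{0\}$, $j\ge 0$ is an integer, $a_\nu,b_\mu>0$, the products are finite (possibly empty) or countably infinite, and $\sum_\mu b_\mu^{-1}+\sum_\nu a_\nu^{-1}<\infty$. If $j\ge1$, assume that $f$ and $z^{-j}g(z)$ are not both constant. Put $$F(z)=f(z^2)+z\,g(z^2),\qquad c=-\frac{g_0|f_0|}{f_0|g_0|}.$$ Let $Q_1,Q_2,Q_3,Q_4$ be the open quadrants of $\mathbb C$, numbered counterclockwise from $Q_1=\{\operatorname{Re}z>0,\ \operatorname{Im}z>0\}$, and let $\operatorname{Arg}$ be the principal argument, with values in $(-\pi,\pi]$. Then $F$ has at least one zero, and its zeros, repeated according to multiplicity, can be numbered $\{z_k\}_{k=1}^{\omega}$, $1\le\omega\le\infty$, so that the following holds (each assertion being made for those indices $k\ge1$ for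 which all terms in it exist). 1. If $\operatorname{Im}c^2>0$, then all zeros are simple, $0<|z_1|<|z_2|<\cdots$, and $\operatorname{Im}z_k^2\neq0$ for all $k$; if $z_k\in Q_l$ with $l\in\{1,2,3\}$, then $z_{k+1}\in Q_{l+1}$, and if $z_k\in Q_4$, then $z_{k+1}\in Q_1$. Moreover, $(-1)^j\operatorname{Re}c\,\operatorname{Re}z_1>0$ and $\operatorname{Re}z_1\operatorname{Im}z_1<0$. 2. If $\operatorname{Im}c^2<0$, then all zeros are simple, $0<|z_1|<|z_2|<\cdots$, and $\operatorname{Im}z_k^2\neq0$ for all $k$; if $z_k\in Q_l$ with $l\in\{2,3,4\}$, then $z_{k+1}\in Q_{l-1}$, and if $z_k\in Q_1$, then $z_{k+1}\in Q_4$. Moreover, $(-1)^j\operatorname{Im}c\,\operatorname{Im}z_1<0$ and $\operatorname{Re}z_1\operatorname{Im}z_1>0$. 3. If $\operatorname{Im}c=0$, then $0<|z_1|\le|z_2|<|z_3|\le|z_4|<|z_5|\le\cdots$, there are no purely imaginary zeros, every real zero is simple or double, and all other zeros are simple. Moreover, for every $k$: $|z_{2k-1}|=|z_{2k}|$ implies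 $z_{2k-1}=\overline{z_{2k}}$; $|z_{2k-1}|<|z_{2k}|$ implies $\operatorname{Arg}z_{2k-1}=\operatorname{Arg}z_{2k}\in\{0,\pi\}$; and $\operatorname{sign}\operatorname{Re}z_{2k}=-\operatorname{sign}\operatorname{Re}z_{2k+1}$. Finally, $(-1)^jc\operatorname{Re}z_1>0$ and $\operatorname{Re}z_1\operatorname{Im}z_1\le0$. 4. If $\operatorname{Re}c=0$, then $0<|z_1|<|z_2|\le|z_3|<|z_4|\le|z_5|<\cdots$, there are no real zeros, every purely imaginary zero is simple or double, and all other zeros are simple. Moreover, for every $k$: $|z_{2k}|=|z_{2k+1}|$ implies $z_{2k}=-\overline{z_{2k+1}}$; $|z_{2k}|<|z_{2k+1}|$ implies $\operatorname{Arg}z_{2k}=\operatorname{Arg}z_{2k+1}\in\{-\frac\pi2,\frac\pi2\}$; and $\operatorname{sign}\operatorname{Im}z_{2k-1}=-\operatorname{sign}\operatorname{Im}z_{2k}$. Finally, $(-1)^j\operatorname{Im}c\,\operatorname{Im}z_1<0$ and $\operatorname{Re}z_1=0$. -/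

import Mathlib

open Filter Topology

/-- `f` is an entire function of genus `0` (not identically zero): by Hadamard's factorization,
`f(z) = C z ^ m ∏ (1 - z / wᵢ)`, a finite or infinite product over the nonzero zeros `wᵢ` of `f`
(repeated by multiplicity), with `∑ 1 / |wᵢ| < ∞`. The index type may be empty. -/
def IsGenusZero (f : ℂ → ℂ) : Prop :=
  ∃ (ι : Type) (C : ℂ) (m : ℕ) (w : ι → ℂ),
    C ≠ 0 ∧ (∀ i, w i ≠ 0) ∧ Summable (fun i => ‖w i‖⁻¹) ∧
      ∀ z, f z = C * z ^ m * ∏' i, (1 - z / w i)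

/-- The open first quadrant. -/
def Q₁ : Set ℂ := {z | 0 < z.re ∧ 0 < z.im}

/-- The open second quadrant. -/
def Q₂ : Set ℂ := {z | z.re < 0 ∧ 0 < z.im}

/-- The open third quadrant. -/
def Q₃ : Set ℂ := {z | z.re < 0 ∧ z.im < 0}

/-- The open fourth quadrant. -/
def Q₄ : Set ℂ := {z | 0 < z.re ∧ z.im < 0}

/-- `z 1, z 2, …` (the terms `z k` with `1 ≤ k ≤ ω`, where `ω` may be infinite) is a list of all
zeros of `F`, in which every zero occurs as many times as its multiplicity. -/
def IsZeroEnumeration (F : ℂ → ℂ) (ω : ℕ∞) (z : ℕ → ℂ) : Prop :=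
  ∀ w : ℂ, {k : ℕ | 1 ≤ k ∧ (k : ℕ∞) ≤ ω ∧ z k = w}.encard = analyticOrderAt F w

/-! With `f(w) = f₀ ∏ (1 + w exp (-vᵢ))`, `g(w) = g₀ w ^ j ∏ (1 - w exp (-uᵢ))` and `m = 2j + 1`,
the equation F(z) = 0 reads c R(z) = 1, where R(z) = (|g₀|/|f₀|) z ^ m ∏ (1 - z² exp (-uᵢ)) / ∏ (1 +
z² exp (-vᵢ)). Since R is odd and commutes with conjugation, it suffices to know it on the closed
first quadrant, written as z = exp ((x + iψ)/2) with 0 ≤ ψ ≤ π.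

Modulus. On each circle |R| strictly increases with ψ, so |R| = 1 holds for at most one angle `psi
x`; if there is none, `psi x` is the end point 0 or π, and `psi` is continuous.

Phase. Let `alpha x` be the continuous argument of R at the angle `psi x`. The derivative 1 - 1/(1 +
exp η) of log (1 + exp η) has positive imaginary part inside the strip, so this function is monotone
in the sense of `stripFactor_monotone_strict`. Summing over all factors, `phase_monotone` bounds
Δ(arg R) Δx by Δ(log |R|) Δψ, and the latter is nonpositive along `psi` (`logRatio_psi_mul_le`).
Hence `alpha` is nonincreasing, and strictly so unless `psi` is at the same end point of [0, π] at
both abscissas; a plateau of `alpha` thus belongs to the real or the imaginary axis.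

Counting. Near x = -∞ one has `alpha` = jπ + π/2. If c = ±exp (iγ) with 0 ≤ γ ≤ π/2, the zeros are
the points of |R| = 1 at which `alpha` takes the values jπ + γ, jπ - γ, (j-1)π + γ, …, and the
parity of the position in this list together with a sign determines the quadrant. Monotonicity
orders the moduli. For γ = 0 or γ = π/2 neighbouring levels merge in pairs: a merged level is either
attained at one point, which carries a symmetric pair or a double zero, or on a plateau whose ends
carry simple zeros on an axis. The remaining case Re c Im c < 0 follows by conjugation. There is a
first zero because `alpha` descends to jπ (`exists_alpha_le`).

Multiplicity. |F| dominates a multiple of the real function `gap`, so a zero of order n makes `gap`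
vanish to order n along lines (`gap_pow_bound_of_le_order`). Monotonicity in the angle excludes
order 2 off the axes; strict concavity of log |R| along the real axis, and its mirror image on the
imaginary one, excludes order 3 there and decides between 1 and 2 (`order_eq_of_boundary`). -/

/-! ### The single factor 1 + exp η on the closed strip 0 ≤ Im η ≤ π -/

/-- The basic factor `1 + exp (x + iψ)`. -/
noncomputable def stripFactor (x ψ : ℝ) : ℂ := 1 + Complex.exp (x + ψ * Complex.I)

lemma stripFactor_re (x ψ : ℝ) : (stripFactor x ψ).re = 1 + Real.exp x * Real.cos ψ := by
  simp [stripFactor, Complex.exp_re]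

lemma stripFactor_im (x ψ : ℝ) : (stripFactor x ψ).im = Real.exp x * Real.sin ψ := by
  simp [stripFactor, Complex.exp_im]

lemma norm_stripFactor_sq (x ψ : ℝ) :
    ‖stripFactor x ψ‖ ^ 2 = 1 + 2 * Real.exp x * Real.cos ψ + Real.exp x ^ 2 := by
  rw [← Complex.normSq_eq_norm_sq, Complex.normSq_apply, stripFactor_re, stripFactor_im]
  linear_combination Real.exp x ^ 2 * Real.sin_sq_add_cos_sq ψ

lemma stripFactor_zero (x : ℝ) : stripFactor x 0 = ((1 + Real.exp x : ℝ) : ℂ) := by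
  simp [stripFactor]

lemma stripFactor_pi (x : ℝ) : stripFactor x Real.pi = ((1 - Real.exp x : ℝ) : ℂ) := by
  simp [stripFactor, Complex.exp_add, sub_eq_add_neg]

lemma stripFactor_im_nonneg {x ψ : ℝ} (h : ψ ∈ Set.Icc 0 Real.pi) : 0 ≤ (stripFactor x ψ).im := by
  rw [stripFactor_im]
  exact mul_nonneg (Real.exp_pos x).le (Real.sin_nonneg_of_mem_Icc h)

lemma stripFactor_im_pos {x ψ : ℝ} (h : ψ ∈ Set.Ioo 0 Real.pi) : 0 < (stripFactor x ψ).im := by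
  rw [stripFactor_im]
  exact mul_pos (Real.exp_pos x) (Real.sin_pos_of_mem_Ioo h)

lemma stripFactor_ne_zero_of_lt {x ψ : ℝ} (h0 : 0 ≤ ψ) (h : ψ < Real.pi) :
    stripFactor x ψ ≠ 0 := by
  intro H
  rcases h0.eq_or_lt with rfl | h0
  · rw [stripFactor_zero] at H
    have := Real.exp_pos x
    norm_cast at H
    linarith
  · have := stripFactor_im_pos (x := x) ⟨h0, h⟩
    simp [H] at this

lemma stripFactor_pi_eq_zero_iff {x : ℝ} : stripFactor x Real.pi = 0 ↔ x = 0 := by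
  rw [stripFactor_pi]
  norm_cast
  rw [sub_eq_zero, eq_comm, Real.exp_eq_one_iff]

/-- The cut of the principal argument is harmless when approached only from above, and factors of
the strip reach it at ψ = π. -/
lemma continuousOn_arg_upper : ContinuousOn Complex.arg {z : ℂ | 0 ≤ z.im ∧ z ≠ 0} := by
  rintro z ⟨h1, h2⟩
  by_cases hz : z ∈ Complex.slitPlane
  · exact (Complex.continuousAt_arg hz).continuousWithinAt
  · rw [Complex.mem_slitPlane_iff] at hz
    push Not at hz
    have hre : z.re < 0 := lt_of_le_of_ne hz.1 fun h => h2 (Complex.ext h hz.2)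
    exact (Complex.continuousWithinAt_arg_of_re_neg_of_im_zero hre hz.2).mono fun w hw => hw.1

lemma continuous_stripFactor : Continuous fun p : ℝ × ℝ => stripFactor p.1 p.2 := by
  unfold stripFactor; fun_prop

lemma stripFactor_arg_mem {x ψ : ℝ} (h : ψ ∈ Set.Icc 0 Real.pi) :
    (stripFactor x ψ).arg ∈ Set.Icc 0 Real.pi :=
  ⟨Complex.arg_nonneg_iff.2 (stripFactor_im_nonneg h), Complex.arg_le_pi _⟩

lemma arg_stripFactor_zero (x : ℝ) : (stripFactor x 0).arg = 0 := by
  rw [stripFactor_zero]; exact Complex.arg_ofReal_of_nonneg (by positivity)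

/-- At x = 0 the factor vanishes and the convention arg 0 = 0 is used. -/
lemma arg_stripFactor_pi_of_le {x : ℝ} (h : x ≤ 0) : (stripFactor x Real.pi).arg = 0 := by
  rw [stripFactor_pi]
  exact Complex.arg_ofReal_of_nonneg (by simpa using h)

lemma arg_stripFactor_pi_of_pos {x : ℝ} (h : 0 < x) :
    (stripFactor x Real.pi).arg = Real.pi := by
  rw [stripFactor_pi]
  exact Complex.arg_ofReal_of_neg (by simpa using h)

/-- Strict monotonicity of `log (1 + exp η)` on the closed strip `0 ≤ Im η ≤ π`, in the sense that
`Im ((log (1 + exp η₂) - log (1 + exp η₁)) * conj (η₂ - η₁)) > 0`. -/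
lemma stripFactor_monotone_strict {x₁ x₂ ψ₁ ψ₂ : ℝ} (h₁ : ψ₁ ∈ Set.Icc 0 Real.pi)
    (h₂ : ψ₂ ∈ Set.Icc 0 Real.pi) (n₁ : stripFactor x₁ ψ₁ ≠ 0) (n₂ : stripFactor x₂ ψ₂ ≠ 0)
    (hne : x₁ ≠ x₂ ∨ ψ₁ ≠ ψ₂) (h0 : ¬ (ψ₁ = 0 ∧ ψ₂ = 0)) (hπ : ¬ (ψ₁ = Real.pi ∧ ψ₂ = Real.pi)) :
    (Real.log ‖stripFactor x₂ ψ₂‖ - Real.log ‖stripFactor x₁ ψ₁‖) * (ψ₂ - ψ₁) <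
      ((stripFactor x₂ ψ₂).arg - (stripFactor x₁ ψ₁).arg) * (x₂ - x₁) := by
  set X : ℝ → ℝ := fun t => x₁ + t * (x₂ - x₁) with hX
  set Y : ℝ → ℝ := fun t => ψ₁ + t * (ψ₂ - ψ₁) with hY
  -- Since the end points do not lie on one common boundary line, the open segment runs in the open
  -- strip, away from the zeros of the factor.
  have hYin : ∀ t ∈ Set.Ioo (0 : ℝ) 1, Y t ∈ Set.Ioo 0 Real.pi := by
    rintro t ⟨ht0, ht1⟩
    have e : Y t = (1 - t) * ψ₁ + t * ψ₂ := by simp only [hY]; ring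
    constructor
    · rw [e]
      rcases h₁.1.eq_or_lt with h | h
      · have : 0 < ψ₂ := lt_of_le_of_ne h₂.1 fun h' => h0 ⟨h.symm, h'.symm⟩
        rw [← h]; simpa using mul_pos ht0 this
      · have := mul_pos (sub_pos.2 ht1) h
        have := mul_nonneg ht0.le h₂.1
        linarith
    · rw [e]
      rcases h₁.2.eq_or_lt with h | h
      · have : ψ₂ < Real.pi := lt_of_le_of_ne h₂.2 fun h' => hπ ⟨h, h'⟩
        have := mul_lt_mul_of_pos_left this ht0
        rw [h]; linarith
      · have := mul_lt_mul_of_pos_left h (sub_pos.2 ht1)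
        have := mul_le_mul_of_nonneg_left h₂.2 ht0.le
        linarith
  have hYcl : ∀ t ∈ Set.Icc (0 : ℝ) 1, Y t ∈ Set.Icc 0 Real.pi ∧ stripFactor (X t) (Y t) ≠ 0 := by
    rintro t ⟨ht0, ht1⟩
    rcases ht0.eq_or_lt with rfl | ht0
    · simpa [hX, hY] using ⟨h₁, n₁⟩
    rcases ht1.eq_or_lt with rfl | ht1
    · simpa [hX, hY] using ⟨h₂, n₂⟩
    have := hYin t ⟨ht0, ht1⟩
    exact ⟨⟨this.1.le, this.2.le⟩, stripFactor_ne_zero_of_lt this.1.le this.2⟩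
  set E : ℝ → ℂ := fun t => stripFactor (X t) (Y t) with hE
  have hEc : Continuous E :=
    continuous_stripFactor.comp (f := fun t => (X t, Y t)) (by simp only [hX, hY]; fun_prop)
  -- This is Im (log E · conj Δ) along the segment; its derivative is |Δ|² Im (1 - 1/E), which is
  -- positive because Im E is.
  set H : ℝ → ℝ := fun t => (E t).arg * (x₂ - x₁) - Real.log ‖E t‖ * (ψ₂ - ψ₁) with hH
  have hHc : ContinuousOn H (Set.Icc 0 1) := by
    refine ContinuousOn.sub (ContinuousOn.mul ?_ continuousOn_const)
      (ContinuousOn.mul ?_ continuousOn_const)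
    · exact continuousOn_arg_upper.comp hEc.continuousOn
        fun t ht => ⟨stripFactor_im_nonneg (hYcl t ht).1, (hYcl t ht).2⟩
    · exact hEc.norm.continuousOn.log fun t ht => norm_ne_zero_iff.2 (hYcl t ht).2
  set Δ : ℂ := (x₂ - x₁ : ℝ) + (ψ₂ - ψ₁ : ℝ) * Complex.I with hΔ
  have hΔ0 : 0 < Complex.normSq Δ := by
    rw [Complex.normSq_pos]
    intro h
    have hr := congrArg Complex.re h
    have hi := congrArg Complex.im h
    simp [hΔ] at hr hi
    rcases hne with h | h
    · exact h (by linarith)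
    · exact h (by linarith)
  have hder : ∀ t ∈ interior (Set.Icc (0 : ℝ) 1), 0 < deriv H t := by
    intro t ht
    rw [interior_Icc] at ht
    have hy := hYin t ht
    have him : 0 < (E t).im := stripFactor_im_pos hy
    have hsl : E t ∈ Complex.slitPlane := Or.inr him.ne'
    have hη : HasDerivAt (fun t : ℝ => ((X t : ℂ) + Y t * Complex.I)) Δ t := by
      have h1 : HasDerivAt X (x₂ - x₁) t := by
        simpa [hX] using ((hasDerivAt_id t).mul_const (x₂ - x₁)).const_add x₁
      have h2 : HasDerivAt Y (ψ₂ - ψ₁) t := by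
        simpa [hY] using ((hasDerivAt_id t).mul_const (ψ₂ - ψ₁)).const_add ψ₁
      exact h1.ofReal_comp.add (h2.ofReal_comp.mul_const Complex.I)
    have hEd : HasDerivAt E (Complex.exp ((X t : ℂ) + Y t * Complex.I) * Δ) t := by
      simpa [hE, stripFactor] using hη.cexp.const_add 1
    have hL := hEd.clog_real hsl
    have hLc := hL.mul_const ((starRingEnd ℂ) Δ)
    have hI : HasDerivAt (fun t => (Complex.log (E t) * (starRingEnd ℂ) Δ).im)
        (Complex.exp ((X t : ℂ) + Y t * Complex.I) * Δ / E t * (starRingEnd ℂ) Δ).im t := by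
      exact Complex.imCLM.hasFDerivAt.comp_hasDerivAt t hLc
    have heq : (fun t => (Complex.log (E t) * (starRingEnd ℂ) Δ).im) = H := by
      funext s
      simp [hH, hΔ, Complex.log_im, Complex.log_re]
      ring
    rw [heq] at hI
    rw [hI.deriv]
    have e1 : Complex.exp ((X t : ℂ) + Y t * Complex.I) = E t - 1 := by simp [hE, stripFactor]
    have e2 : Complex.exp ((X t : ℂ) + Y t * Complex.I) * Δ / E t * (starRingEnd ℂ) Δ
        = (1 - (E t)⁻¹) * (Complex.normSq Δ : ℂ) := by
      have hE0 : E t ≠ 0 := fun h => by simp [h] at him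
      rw [e1, ← Complex.mul_conj]
      field_simp
    rw [e2, Complex.im_mul_ofReal]
    refine mul_pos ?_ hΔ0
    simp only [Complex.sub_im, Complex.one_im, Complex.inv_im, zero_sub]
    have : 0 < Complex.normSq (E t) := Complex.normSq_pos.2 fun h => by simp [h] at him
    rw [neg_div, neg_neg]
    positivity
  have := strictMonoOn_of_deriv_pos (convex_Icc 0 1) hHc hder (Set.left_mem_Icc.2 zero_le_one)
    (Set.right_mem_Icc.2 zero_le_one) zero_lt_one
  simp only [hH, hE, hX, hY] at this
  simp only [zero_mul, add_zero, one_mul, add_sub_cancel] at this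
  linarith

/-- The cases left out of the strict version are direct: the argument is 0 on the lower line, and on
the upper line it is the step function with values 0 and π, which is nondecreasing even across the
zero of the factor. -/
lemma stripFactor_monotone {x₁ x₂ ψ₁ ψ₂ : ℝ} (h₁ : ψ₁ ∈ Set.Icc 0 Real.pi)
    (h₂ : ψ₂ ∈ Set.Icc 0 Real.pi) (n₁ : stripFactor x₁ ψ₁ ≠ 0) (n₂ : stripFactor x₂ ψ₂ ≠ 0) :
    (Real.log ‖stripFactor x₂ ψ₂‖ - Real.log ‖stripFactor x₁ ψ₁‖) * (ψ₂ - ψ₁) ≤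
      ((stripFactor x₂ ψ₂).arg - (stripFactor x₁ ψ₁).arg) * (x₂ - x₁) := by
  by_cases h0 : ψ₁ = 0 ∧ ψ₂ = 0
  · simp [h0.1, h0.2, arg_stripFactor_zero]
  by_cases hπ : ψ₁ = Real.pi ∧ ψ₂ = Real.pi
  · rw [hπ.1, hπ.2, sub_self, mul_zero]
    rcases le_or_gt x₁ 0 with h1 | h1 <;> rcases le_or_gt x₂ 0 with h2 | h2
    · simp [arg_stripFactor_pi_of_le, h1, h2]
    · rw [arg_stripFactor_pi_of_le h1, arg_stripFactor_pi_of_pos h2]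
      exact mul_nonneg (by linarith [Real.pi_pos]) (by linarith)
    · rw [arg_stripFactor_pi_of_le h2, arg_stripFactor_pi_of_pos h1]
      exact mul_nonneg_of_nonpos_of_nonpos (by linarith [Real.pi_pos]) (by linarith)
    · simp [arg_stripFactor_pi_of_pos, h1, h2]
  by_cases hne : x₁ ≠ x₂ ∨ ψ₁ ≠ ψ₂
  · exact (stripFactor_monotone_strict h₁ h₂ n₁ n₂ hne h0 hπ).le
  · push Not at hne
    simp [hne.1, hne.2]

lemma norm_stripFactor_anti {x ψ₁ ψ₂ : ℝ} (h0 : 0 ≤ ψ₁) (h : ψ₁ < ψ₂) (hπ : ψ₂ ≤ Real.pi) :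
    ‖stripFactor x ψ₂‖ < ‖stripFactor x ψ₁‖ := by
  refine lt_of_pow_lt_pow_left₀ 2 (norm_nonneg _) ?_
  rw [norm_stripFactor_sq, norm_stripFactor_sq]
  have := Real.cos_lt_cos_of_nonneg_of_le_pi h0 hπ h
  have := mul_lt_mul_of_pos_left this (Real.exp_pos x)
  linarith

lemma one_le_norm_stripFactor {x ψ : ℝ} (h0 : 0 ≤ ψ) (h : ψ ≤ Real.pi / 2) :
    1 ≤ ‖stripFactor x ψ‖ := by
  refine le_of_sq_le_sq ?_ (norm_nonneg _)
  rw [norm_stripFactor_sq]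
  have := Real.cos_nonneg_of_neg_pi_div_two_le_of_le (by linarith) h
  have := mul_nonneg (Real.exp_pos x).le this
  nlinarith [Real.exp_pos x]

/-- A summable majorant for the arguments: |log (1 + z)| ≤ (3/2)|z| for |z| ≤ 1/2, and |arg| ≤ π
otherwise. -/
lemma abs_arg_stripFactor_le (x ψ : ℝ) :
    |(stripFactor x ψ).arg| ≤ 2 * Real.pi * Real.exp x := by
  have hn : ‖Complex.exp (x + ψ * Complex.I)‖ = Real.exp x := by simp [Complex.norm_exp]
  rcases le_or_gt (Real.exp x) (1 / 2) with h | h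
  · have := Complex.norm_log_one_add_half_le_self (hn.trans_le h)
    rw [hn] at this
    have h2 := (Complex.abs_im_le_norm _).trans this
    rw [Complex.log_im] at h2
    refine h2.trans ?_
    nlinarith [Real.exp_pos x, Real.pi_gt_three]
  · refine (Complex.abs_arg_le_pi _).trans ?_
    nlinarith [Real.pi_pos]

/-- Equality holds at x = 0, where 1 + exp (iψ) = 2 cos (ψ/2) exp (iψ/2); for fixed ψ the argument
is nondecreasing in x by `stripFactor_monotone`. -/
lemma half_le_arg_stripFactor {x ψ : ℝ} (hx : 0 ≤ x) (h : ψ ∈ Set.Icc 0 Real.pi)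
    (hne : stripFactor x ψ ≠ 0) : ψ / 2 ≤ (stripFactor x ψ).arg := by
  rcases h.2.eq_or_lt with rfl | hlt
  · have : x ≠ 0 := fun h => hne (stripFactor_pi_eq_zero_iff.2 h)
    rw [arg_stripFactor_pi_of_pos (lt_of_le_of_ne hx this.symm)]
    linarith [Real.pi_pos]
  have h0 : (stripFactor 0 ψ).arg = ψ / 2 := by
    have : stripFactor 0 ψ = ((2 * Real.cos (ψ / 2) : ℝ) : ℂ) *
        (Complex.cos ((ψ / 2 : ℝ) : ℂ) + Complex.sin ((ψ / 2 : ℝ) : ℂ) * Complex.I) := by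
      rw [← Complex.exp_mul_I]
      have hc : ((2 * Real.cos (ψ / 2) : ℝ) : ℂ) = Complex.exp (((ψ / 2 : ℝ) : ℂ) * Complex.I)
          + Complex.exp (-(((ψ / 2 : ℝ) : ℂ) * Complex.I)) := by
        rw [Complex.ofReal_mul, Complex.ofReal_cos, Complex.cos]; push_cast; ring_nf
      rw [hc, add_mul, ← Complex.exp_add, ← Complex.exp_add, stripFactor]
      rw [neg_add_cancel, Complex.exp_zero, add_comm]
      congr 2
      push_cast; ring
    rw [this]
    refine Complex.arg_mul_cos_add_sin_mul_I ?_ ⟨by linarith [h.1, Real.pi_pos], by linarith [h.1]⟩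
    have := Real.cos_pos_of_mem_Ioo (x := ψ / 2) ⟨by linarith [h.1, Real.pi_pos], by linarith⟩
    positivity
  rcases hx.eq_or_lt with rfl | hx
  · exact h0.ge
  have := stripFactor_monotone (x₁ := 0) (x₂ := x) h h (stripFactor_ne_zero_of_lt h.1 hlt) hne
  rw [sub_self, mul_zero, sub_zero, h0] at this
  by_contra hcon
  push Not at hcon
  nlinarith

/-! ### Behaviour of the factor on the two boundary lines -/

lemma log_norm_stripFactor_zero (x : ℝ) :
    Real.log ‖stripFactor x 0‖ = Real.log (1 + Real.exp x) := by
  rw [stripFactor_zero, Complex.norm_real, Real.norm_eq_abs, Real.log_abs]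

lemma log_norm_stripFactor_pi (x : ℝ) :
    Real.log ‖stripFactor x Real.pi‖ = Real.log (1 - Real.exp x) := by
  rw [stripFactor_pi, Complex.norm_real, Real.norm_eq_abs, Real.log_abs]

lemma strictConvexOn_log_norm_stripFactor_zero (D : Set ℝ) (hD : Convex ℝ D) :
    StrictConvexOn ℝ D fun x => Real.log ‖stripFactor x 0‖ := by
  simp_rw [log_norm_stripFactor_zero]
  have hd : ∀ x, HasDerivAt (fun x => Real.log (1 + Real.exp x))
      (Real.exp x / (1 + Real.exp x)) x := fun x =>
    ((Real.hasDerivAt_exp x).const_add 1).log (by positivity)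
  refine (StrictMono.strictConvexOn_univ_of_deriv ?_ ?_).subset (Set.subset_univ _) hD
  · exact continuous_iff_continuousAt.2 fun x => (hd x).continuousAt
  · intro x y hxy
    rw [(hd x).deriv, (hd y).deriv, div_lt_div_iff₀ (by positivity) (by positivity)]
    have := Real.exp_lt_exp.2 hxy
    nlinarith

lemma strictConcaveOn_log_norm_stripFactor_pi (D : Set ℝ) (hD : Convex ℝ D) (h0 : (0 : ℝ) ∉ D) :
    StrictConcaveOn ℝ D fun x => Real.log ‖stripFactor x Real.pi‖ := by
  simp_rw [log_norm_stripFactor_pi]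
  have hne : ∀ x, x ≠ 0 → 1 - Real.exp x ≠ 0 := fun x hx h =>
    hx ((Real.exp_eq_one_iff x).1 (by linarith))
  have hd : ∀ x, x ≠ 0 → HasDerivAt (fun x => Real.log (1 - Real.exp x))
      (-Real.exp x / (1 - Real.exp x)) x := fun x hx =>
    ((Real.hasDerivAt_exp x).const_sub 1).log (hne x hx)
  have hD0 : ∀ x ∈ D, x ≠ 0 := fun x hx h => h0 (h ▸ hx)
  refine StrictAntiOn.strictConcaveOn_of_deriv hD
    (fun x hx => (hd x (hD0 x hx)).continuousAt.continuousWithinAt) ?_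
  intro x hx y hy hxy
  have hx' := interior_subset hx
  have hy' := interior_subset hy
  rw [(hd x (hD0 x hx')).deriv, (hd y (hD0 y hy')).deriv]
  have hlt := Real.exp_lt_exp.2 hxy
  rcases lt_or_gt_of_ne (hD0 y hy') with hy0 | hy0
  · have h1 : Real.exp y < 1 := by simpa using hy0
    rw [div_lt_div_iff₀ (by linarith) (by linarith)]
    nlinarith
  · have hx0 : 0 < x := by
      by_contra hcon
      exact h0 (hD.ordConnected.out hx' hy' ⟨not_lt.1 hcon, hy0.le⟩)
    have h1 : 1 < Real.exp x := Real.one_lt_exp_iff.2 hx0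
    rw [← neg_div_neg_eq (-Real.exp y), ← neg_div_neg_eq (-Real.exp x),
      div_lt_div_iff₀ (by linarith) (by linarith)]
    nlinarith

/-- This is cosh d ≥ 1 + d²/2, obtained from cosh d = 1 + 2 sinh² (d/2). -/
lemma exp_add_add_exp_sub (y d : ℝ) :
    Real.exp y * (2 + d ^ 2) ≤ Real.exp (y + d) + Real.exp (y - d) := by
  have h : 1 + d ^ 2 / 2 ≤ Real.cosh d := by
    have h1 : Real.cosh d = 1 + 2 * Real.sinh (d / 2) ^ 2 := by
      have := Real.cosh_two_mul (d / 2)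
      rw [mul_div_cancel₀ d two_ne_zero] at this
      have h2 := Real.cosh_sq (d / 2)
      linarith
    have h2 : (d / 2) ^ 2 ≤ Real.sinh (d / 2) ^ 2 := by
      rw [sq_le_sq, Real.abs_sinh]
      exact Real.self_le_sinh_iff.2 (abs_nonneg _)
    nlinarith
  rw [Real.cosh_eq] at h
  rw [sub_eq_add_neg, Real.exp_add, Real.exp_add]
  nlinarith [Real.exp_pos y]

/-- Quantitative convexity, later used to bound orders of vanishing. The two outer factors multiply
to at least the square of the middle one plus exp y · d²; the logarithm of the quotient is then
estimated by 1 - 1/t ≤ log t, with |d| ≤ 1 bounding the denominator. -/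
lemma second_difference_stripFactor_zero {y d : ℝ} (hd : |d| ≤ 1) :
    Real.exp y / (1 + Real.exp (y + 1)) ^ 2 * d ^ 2 ≤
      Real.log ‖stripFactor (y + d) 0‖ + Real.log ‖stripFactor (y - d) 0‖
        - 2 * Real.log ‖stripFactor y 0‖ := by
  simp_rw [log_norm_stripFactor_zero]
  have p1 := Real.exp_pos (y + d)
  have p2 := Real.exp_pos (y - d)
  have p3 := Real.exp_pos y
  set R := (1 + Real.exp (y + d)) * (1 + Real.exp (y - d)) with hR
  have hR0 : 0 < R := by positivity
  have hee : Real.exp (y + d) * Real.exp (y - d) = Real.exp y ^ 2 := by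
    rw [← Real.exp_add, ← Real.exp_nat_mul]; congr 1; push_cast; ring
  have hlog : Real.log (1 + Real.exp (y + d)) + Real.log (1 + Real.exp (y - d))
      - 2 * Real.log (1 + Real.exp y) = Real.log (R / (1 + Real.exp y) ^ 2) := by
    rw [Real.log_div hR0.ne' (by positivity), hR, Real.log_mul (by positivity) (by positivity),
      Real.log_pow]
    push_cast; ring
  have hdiff : Real.exp y * d ^ 2 ≤ R - (1 + Real.exp y) ^ 2 := by
    have := exp_add_add_exp_sub y d
    rw [hR]; nlinarith
  have hRle : R ≤ (1 + Real.exp (y + 1)) ^ 2 := by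
    rw [hR, sq]
    have := abs_le.1 hd
    gcongr <;> linarith
  rw [hlog]
  refine le_trans ?_ (Real.one_sub_inv_le_log_of_pos (by positivity))
  rw [inv_div, one_sub_div hR0.ne', div_mul_eq_mul_div]
  exact div_le_div₀ (le_trans (by positivity) hdiff) hdiff hR0 hRle

/-- The same computation with the opposite sign and log t ≤ t - 1; |d| < |y| keeps y ± d on one side
of the zero of 1 - exp. -/
lemma second_difference_stripFactor_pi {y d : ℝ} (hd : |d| < |y|) :
    Real.log ‖stripFactor (y + d) Real.pi‖ + Real.log ‖stripFactor (y - d) Real.pi‖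
      - 2 * Real.log ‖stripFactor y Real.pi‖ ≤ -(Real.exp y / (1 - Real.exp y) ^ 2 * d ^ 2) := by
  simp_rw [log_norm_stripFactor_pi]
  have hee : Real.exp (y + d) * Real.exp (y - d) = Real.exp y ^ 2 := by
    rw [← Real.exp_add, ← Real.exp_nat_mul]; congr 1; push_cast; ring
  set R := (1 - Real.exp (y + d)) * (1 - Real.exp (y - d)) with hR
  have hy : 1 - Real.exp y ≠ 0 := by
    intro h
    have : y = 0 := (Real.exp_eq_one_iff y).1 (by linarith)
    rw [this, abs_zero] at hd
    exact absurd hd (not_lt.2 (abs_nonneg _))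
  have hR0 : 0 < R := by
    rcases le_total 0 y with h | h
    · rw [abs_of_nonneg h, abs_lt] at hd
      exact mul_pos_of_neg_of_neg (by simpa using by linarith) (by simpa using by linarith)
    · rw [abs_of_nonpos h, abs_lt] at hd
      exact mul_pos (by simpa using by linarith) (by simpa using by linarith)
  have h1 : 1 - Real.exp (y + d) ≠ 0 := left_ne_zero_of_mul hR0.ne'
  have h2 : 1 - Real.exp (y - d) ≠ 0 := right_ne_zero_of_mul hR0.ne'
  have hq : 0 < (1 - Real.exp y) ^ 2 := by positivity
  have hlog : Real.log (1 - Real.exp (y + d)) + Real.log (1 - Real.exp (y - d))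
      - 2 * Real.log (1 - Real.exp y) = Real.log (R / (1 - Real.exp y) ^ 2) := by
    rw [Real.log_div hR0.ne' hq.ne', hR, Real.log_mul h1 h2, Real.log_pow]
    push_cast; ring
  have hdiff : R - (1 - Real.exp y) ^ 2 ≤ -(Real.exp y * d ^ 2) := by
    have := exp_add_add_exp_sub y d
    rw [hR]; nlinarith
  rw [hlog]
  refine (Real.log_le_sub_one_of_pos (by positivity)).trans ?_
  rw [div_sub_one hq.ne', div_mul_eq_mul_div, ← neg_div]
  gcongr

/-! ### Products over a family -/

/-- `w ↦ ∏ (1 + w exp (-uᵢ))`. -/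
noncomputable def genusProd {ι : Type} (u : ι → ℝ) (w : ℂ) : ℂ :=
  ∏' i, (1 + w * Complex.exp (-(u i : ℂ)))

noncomputable def stripProd {ι : Type} (u : ι → ℝ) (x ψ : ℝ) : ℂ :=
  ∏' i, stripFactor (x - u i) ψ

noncomputable def stripLog {ι : Type} (u : ι → ℝ) (x ψ : ℝ) : ℝ :=
  ∑' i, Real.log ‖stripFactor (x - u i) ψ‖

noncomputable def stripArg {ι : Type} (u : ι → ℝ) (x ψ : ℝ) : ℝ :=
  ∑' i, (stripFactor (x - u i) ψ).arg

section family
variable {ι : Type} {u : ι → ℝ}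

lemma stripProd_eq (x ψ : ℝ) :
    stripProd u x ψ = genusProd u (Complex.exp (x + ψ * Complex.I)) := by
  unfold stripProd genusProd stripFactor
  congr 1; funext i
  rw [← Complex.exp_add]; congr 2; push_cast; ring

lemma genusProd_conj (w : ℂ) :
    genusProd u ((starRingEnd ℂ) w) = (starRingEnd ℂ) (genusProd u w) := by
  unfold genusProd
  rw [Function.LeftInverse.map_tprod _ Complex.continuous_conj Complex.continuous_conj
    Complex.conj_conj]
  congr 1; funext i
  simp [← Complex.exp_conj]

lemma norm_exp_neg_ofReal (t : ℝ) : ‖Complex.exp (-(t : ℂ))‖ = Real.exp (-t) := by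
  simp [Complex.norm_exp]

lemma differentiable_genusProd (hu : Summable fun i => Real.exp (-u i)) :
    Differentiable ℂ (genusProd u) := by
  intro w
  have hdiff : DifferentiableOn ℂ (genusProd u) (Metric.ball 0 (‖w‖ + 1)) := by
    refine (Summable.hasProdLocallyUniformlyOn_one_add (f := fun i w => w * Complex.exp (-(u i : ℂ)))
      Metric.isOpen_ball (hu.mul_left (‖w‖ + 1)) (.of_forall fun i x hx => ?_)
      (fun i => by fun_prop)).differentiableOn (.of_forall fun s => ?_) Metric.isOpen_ball
    · rw [norm_mul, norm_exp_neg_ofReal]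
      rw [mem_ball_zero_iff] at hx
      gcongr
    · simpa [Finset.prod_fn] using DifferentiableOn.finsetProd (fun _ _ => by fun_prop)
  exact hdiff.differentiableAt (Metric.isOpen_ball.mem_nhds (by simp))

lemma continuous_stripProd (hu : Summable fun i => Real.exp (-u i)) :
    Continuous fun p : ℝ × ℝ => stripProd u p.1 p.2 := by
  simp_rw [stripProd_eq]
  exact (differentiable_genusProd hu).continuous.comp (by fun_prop)

lemma summable_norm_stripFactor (hu : Summable fun i => Real.exp (-u i)) (x ψ : ℝ) :
    Summable fun i => ‖Complex.exp ((x - u i : ℝ) + ψ * Complex.I)‖ := by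
  refine (hu.mul_left (Real.exp x)).congr fun i => ?_
  rw [Complex.norm_exp, ← Real.exp_add]; simp [sub_eq_add_neg]

lemma multipliable_stripProd (hu : Summable fun i => Real.exp (-u i)) (x ψ : ℝ) :
    Multipliable fun i => stripFactor (x - u i) ψ :=
  multipliable_one_add_of_summable (summable_norm_stripFactor hu x ψ)

lemma summable_stripLog (hu : Summable fun i => Real.exp (-u i)) (x ψ : ℝ) :
    Summable fun i => Real.log ‖stripFactor (x - u i) ψ‖ :=
  (summable_norm_stripFactor hu x ψ).summable_log_norm_one_add

lemma abs_arg_stripFactor_sub_le (x t ψ : ℝ) :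
    |(stripFactor (x - t) ψ).arg| ≤ 2 * Real.pi * Real.exp x * Real.exp (-t) := by
  refine (abs_arg_stripFactor_le _ _).trans_eq ?_
  rw [sub_eq_add_neg, Real.exp_add]; ring

lemma summable_stripArg (hu : Summable fun i => Real.exp (-u i)) (x ψ : ℝ) :
    Summable fun i => (stripFactor (x - u i) ψ).arg :=
  .of_norm_bounded (hu.mul_left _) fun i => abs_arg_stripFactor_sub_le x (u i) ψ

lemma norm_stripProd (hu : Summable fun i => Real.exp (-u i)) (x ψ : ℝ) :
    ‖stripProd u x ψ‖ = ∏' i, ‖stripFactor (x - u i) ψ‖ :=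
  (multipliable_stripProd hu x ψ).norm_tprod

lemma norm_stripProd_eq_exp (hu : Summable fun i => Real.exp (-u i)) {x ψ : ℝ}
    (h : ∀ i, stripFactor (x - u i) ψ ≠ 0) : ‖stripProd u x ψ‖ = Real.exp (stripLog u x ψ) := by
  rw [norm_stripProd hu, stripLog,
    Real.rexp_tsum_eq_tprod (fun i => norm_pos_iff.2 (h i)) (summable_stripLog hu x ψ)]

lemma stripProd_ne_zero_iff (hu : Summable fun i => Real.exp (-u i)) {x ψ : ℝ} :
    stripProd u x ψ ≠ 0 ↔ ∀ i, stripFactor (x - u i) ψ ≠ 0 := by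
  constructor
  · intro h i hi
    exact h (tprod_of_exists_eq_zero ⟨i, hi⟩)
  · intro h
    rw [← norm_ne_zero_iff, norm_stripProd_eq_exp hu h]
    exact Real.exp_ne_zero _

lemma stripProd_ne_zero_of_lt (hu : Summable fun i => Real.exp (-u i)) {x ψ : ℝ} (h0 : 0 ≤ ψ)
    (h : ψ < Real.pi) : stripProd u x ψ ≠ 0 :=
  (stripProd_ne_zero_iff hu).2 fun _ => stripFactor_ne_zero_of_lt h0 h

/-- The principal arguments of the factors are added without reduction modulo 2π, so `stripArg` is a
branch of the argument of the product that can exceed π. -/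
lemma stripProd_eq_norm_mul_exp (hu : Summable fun i => Real.exp (-u i)) (x ψ : ℝ) :
    stripProd u x ψ = ‖stripProd u x ψ‖ * Complex.exp (stripArg u x ψ * Complex.I) := by
  have h1 : HasProd (fun i => ((‖stripFactor (x - u i) ψ‖ : ℝ) : ℂ)) (‖stripProd u x ψ‖ : ℝ) :=
    (multipliable_stripProd hu x ψ).hasProd.norm.map Complex.ofRealHom Complex.continuous_ofReal
  have h2 : HasSum (fun i => ((stripFactor (x - u i) ψ).arg : ℂ) * Complex.I)
      (stripArg u x ψ * Complex.I) :=
    (Complex.hasSum_ofReal.2 (summable_stripArg hu x ψ).hasSum).mul_right _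
  refine HasProd.unique ?_ (h1.mul h2.cexp)
  refine (multipliable_stripProd hu x ψ).hasProd.congr_fun fun i => ?_
  exact Complex.norm_mul_exp_arg_mul_I _

lemma norm_stripProd_lt [Nonempty ι] (hu : Summable fun i => Real.exp (-u i)) {x ψ₁ ψ₂ : ℝ}
    (h0 : 0 ≤ ψ₁) (h : ψ₁ < ψ₂) (hπ : ψ₂ ≤ Real.pi) :
    ‖stripProd u x ψ₂‖ < ‖stripProd u x ψ₁‖ := by
  have h1 : stripProd u x ψ₁ ≠ 0 := stripProd_ne_zero_of_lt hu h0 (h.trans_le hπ)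
  by_cases h2 : stripProd u x ψ₂ = 0
  · simpa [h2] using h1
  rw [norm_stripProd_eq_exp hu ((stripProd_ne_zero_iff hu).1 h1),
    norm_stripProd_eq_exp hu ((stripProd_ne_zero_iff hu).1 h2), Real.exp_lt_exp]
  have key : ∀ i, Real.log ‖stripFactor (x - u i) ψ₂‖ < Real.log ‖stripFactor (x - u i) ψ₁‖ :=
    fun i => Real.log_lt_log (norm_pos_iff.2 ((stripProd_ne_zero_iff hu).1 h2 i))
      (norm_stripFactor_anti h0 h hπ)
  exact Summable.tsum_lt_tsum (fun i => (key i).le) (key (Classical.arbitrary ι))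
    (summable_stripLog hu _ _) (summable_stripLog hu _ _)

lemma norm_stripProd_le (hu : Summable fun i => Real.exp (-u i)) {x ψ₁ ψ₂ : ℝ}
    (h0 : 0 ≤ ψ₁) (h : ψ₁ ≤ ψ₂) (hπ : ψ₂ ≤ Real.pi) :
    ‖stripProd u x ψ₂‖ ≤ ‖stripProd u x ψ₁‖ := by
  rcases h.eq_or_lt with rfl | h
  · rfl
  cases isEmpty_or_nonempty ι
  · simp [stripProd]
  · exact (norm_stripProd_lt hu h0 h hπ).le

lemma stripProd_monotone (hu : Summable fun i => Real.exp (-u i)) {x₁ x₂ ψ₁ ψ₂ : ℝ}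
    (h₁ : ψ₁ ∈ Set.Icc 0 Real.pi) (h₂ : ψ₂ ∈ Set.Icc 0 Real.pi)
    (n₁ : stripProd u x₁ ψ₁ ≠ 0) (n₂ : stripProd u x₂ ψ₂ ≠ 0) :
    (stripLog u x₂ ψ₂ - stripLog u x₁ ψ₁) * (ψ₂ - ψ₁) ≤
      (stripArg u x₂ ψ₂ - stripArg u x₁ ψ₁) * (x₂ - x₁) := by
  rw [stripProd_ne_zero_iff hu] at n₁ n₂
  unfold stripLog stripArg
  rw [← (summable_stripLog hu _ _).tsum_sub (summable_stripLog hu _ _), ← tsum_mul_right,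
    ← (summable_stripArg hu _ _).tsum_sub (summable_stripArg hu _ _), ← tsum_mul_right]
  refine Summable.tsum_le_tsum (fun i => ?_)
    (((summable_stripLog hu _ _).sub (summable_stripLog hu _ _)).mul_right _)
    (((summable_stripArg hu _ _).sub (summable_stripArg hu _ _)).mul_right _)
  have := stripFactor_monotone h₁ h₂ (n₁ i) (n₂ i)
  rwa [sub_sub_sub_cancel_right] at this

lemma stripProd_monotone_strict [Nonempty ι] (hu : Summable fun i => Real.exp (-u i))
    {x₁ x₂ ψ₁ ψ₂ : ℝ} (h₁ : ψ₁ ∈ Set.Icc 0 Real.pi) (h₂ : ψ₂ ∈ Set.Icc 0 Real.pi)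
    (n₁ : stripProd u x₁ ψ₁ ≠ 0) (n₂ : stripProd u x₂ ψ₂ ≠ 0) (hne : x₁ ≠ x₂ ∨ ψ₁ ≠ ψ₂)
    (h0 : ¬ (ψ₁ = 0 ∧ ψ₂ = 0)) (hπ : ¬ (ψ₁ = Real.pi ∧ ψ₂ = Real.pi)) :
    (stripLog u x₂ ψ₂ - stripLog u x₁ ψ₁) * (ψ₂ - ψ₁) <
      (stripArg u x₂ ψ₂ - stripArg u x₁ ψ₁) * (x₂ - x₁) := by
  rw [stripProd_ne_zero_iff hu] at n₁ n₂
  unfold stripLog stripArg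
  rw [← (summable_stripLog hu _ _).tsum_sub (summable_stripLog hu _ _), ← tsum_mul_right,
    ← (summable_stripArg hu _ _).tsum_sub (summable_stripArg hu _ _), ← tsum_mul_right]
  have key : ∀ i, (Real.log ‖stripFactor (x₂ - u i) ψ₂‖ - Real.log ‖stripFactor (x₁ - u i) ψ₁‖)
      * (ψ₂ - ψ₁) <
      ((stripFactor (x₂ - u i) ψ₂).arg - (stripFactor (x₁ - u i) ψ₁).arg) * (x₂ - x₁) := by
    intro i
    have := stripFactor_monotone_strict (x₁ := x₁ - u i) (x₂ := x₂ - u i) h₁ h₂ (n₁ i) (n₂ i)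
      (hne.imp_left fun h h' => h (by linarith)) h0 hπ
    rwa [sub_sub_sub_cancel_right] at this
  exact Summable.tsum_lt_tsum (fun i => (key i).le) (key (Classical.arbitrary ι))
    (((summable_stripLog hu _ _).sub (summable_stripLog hu _ _)).mul_right _)
    (((summable_stripArg hu _ _).sub (summable_stripArg hu _ _)).mul_right _)

lemma continuousOn_stripArg (hu : Summable fun i => Real.exp (-u i)) :
    ContinuousOn (fun p : ℝ × ℝ => stripArg u p.1 p.2)
      {p | p.2 ∈ Set.Icc 0 Real.pi ∧ stripProd u p.1 p.2 ≠ 0} := by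
  rintro p hp
  -- The majorant of the series of arguments is uniform only for x bounded above, so continuity is
  -- proved on a left half plane around the point.
  have hloc : ContinuousOn (fun p : ℝ × ℝ => stripArg u p.1 p.2)
      ({p | p.2 ∈ Set.Icc 0 Real.pi ∧ stripProd u p.1 p.2 ≠ 0} ∩ {q | q.1 < p.1 + 1}) := by
    refine continuousOn_tsum (u := fun i => 2 * Real.pi * Real.exp (p.1 + 1) * Real.exp (-u i))
      (fun i => ?_) (hu.mul_left _) ?_
    · refine continuousOn_arg_upper.comp (continuous_stripFactor.comp
        (f := fun q : ℝ × ℝ => (q.1 - u i, q.2)) (by fun_prop)).continuousOn ?_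
      rintro q ⟨⟨hq1, hq2⟩, -⟩
      exact ⟨stripFactor_im_nonneg hq1, (stripProd_ne_zero_iff hu).1 hq2 i⟩
    · rintro i q ⟨-, hq⟩
      refine (abs_arg_stripFactor_sub_le _ _ _).trans ?_
      have hq' : q.1 < p.1 + 1 := hq
      have := Real.pi_pos
      gcongr
  refine (hloc p ⟨hp, by simp⟩).mono_of_mem_nhdsWithin ?_
  refine inter_mem self_mem_nhdsWithin (mem_nhdsWithin_of_mem_nhds ?_)
  exact (isOpen_lt continuous_fst continuous_const).mem_nhds (by simp)

lemma stripArg_zero (x : ℝ) : stripArg u x 0 = 0 := by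
  simp [stripArg, arg_stripFactor_zero]

lemma stripArg_nonneg {x ψ : ℝ} (h : ψ ∈ Set.Icc 0 Real.pi) : 0 ≤ stripArg u x ψ :=
  tsum_nonneg fun _ => (stripFactor_arg_mem h).1

lemma arg_le_stripArg (hu : Summable fun i => Real.exp (-u i)) {x ψ : ℝ}
    (h : ψ ∈ Set.Icc 0 Real.pi) (i : ι) : (stripFactor (x - u i) ψ).arg ≤ stripArg u x ψ :=
  (summable_stripArg hu x ψ).le_tsum i fun _ _ => (stripFactor_arg_mem h).1

/-- At ψ = π every factor is real and contributes π if uᵢ < x and 0 otherwise; by summability only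
finitely many uᵢ lie below x. -/
lemma exists_stripArg_pi_eq (hu : Summable fun i => Real.exp (-u i)) (x : ℝ) :
    ∃ n : ℤ, stripArg u x Real.pi = n * Real.pi := by
  have hval : ∀ i, (stripFactor (x - u i) Real.pi).arg = if 0 < x - u i then Real.pi else 0 := by
    intro i
    split_ifs with h
    · exact arg_stripFactor_pi_of_pos h
    · exact arg_stripFactor_pi_of_le (not_lt.1 h)
  have hfin : {i | 0 < x - u i}.Finite := by
    have := (hu.tendsto_cofinite_zero).eventually (gt_mem_nhds (Real.exp_pos (-x)))
    refine (Filter.eventually_cofinite.1 this).subset fun i hi => ?_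
    have hi' : 0 < x - u i := hi
    simpa using (sub_pos.1 hi').le
  refine ⟨hfin.toFinset.card, ?_⟩
  unfold stripArg
  rw [tsum_eq_sum (s := hfin.toFinset)]
  · rw [Finset.sum_congr rfl (g := fun _ => Real.pi)]
    · simp
    · intro i hi
      rw [hval, if_pos]
      simpa using hi
  · intro i hi
    rw [hval, if_neg]
    simpa using hi

/-- On the upper line `stripArg` is π times the number of uᵢ < x, so equal values leave no uᵢ in
between; nonvanishing excludes the end points. -/
lemma notMem_Icc_of_stripArg_pi_eq (hu : Summable fun i => Real.exp (-u i)) {x₁ x₂ : ℝ}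
    (n₁ : stripProd u x₁ Real.pi ≠ 0) (n₂ : stripProd u x₂ Real.pi ≠ 0)
    (heq : stripArg u x₁ Real.pi = stripArg u x₂ Real.pi) (i : ι) : u i ∉ Set.Icc x₁ x₂ := by
  rw [stripProd_ne_zero_iff hu] at n₁ n₂
  rintro ⟨h1, h2⟩
  have h1' : x₁ - u i < 0 := by
    refine lt_of_le_of_ne (by linarith) fun h => n₁ i (stripFactor_pi_eq_zero_iff.2 h)
  have h2' : 0 < x₂ - u i := by
    refine lt_of_le_of_ne (by linarith) fun h => n₂ i (stripFactor_pi_eq_zero_iff.2 h.symm)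
  refine absurd heq (ne_of_lt ?_)
  refine Summable.tsum_lt_tsum (i := i) (fun l => ?_) ?_ (summable_stripArg hu _ _)
    (summable_stripArg hu _ _)
  · rcases le_or_gt (x₁ - u l) 0 with h | h'
    · rw [arg_stripFactor_pi_of_le h]
      exact (stripFactor_arg_mem ⟨Real.pi_pos.le, le_rfl⟩).1
    · rw [arg_stripFactor_pi_of_pos h', arg_stripFactor_pi_of_pos (by linarith)]
  · rw [arg_stripFactor_pi_of_le h1'.le, arg_stripFactor_pi_of_pos h2']
    exact Real.pi_pos

end family

/-! ### Infinite sums of concave functions, and discreteness of the multiples of π -/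

lemma concaveOn_tsum {ι : Type} {D : Set ℝ} (hD : Convex ℝ D) {f : ι → ℝ → ℝ}
    (hf : ∀ i, ConcaveOn ℝ D (f i)) (hs : ∀ x, Summable fun i => f i x) :
    ConcaveOn ℝ D fun x => ∑' i, f i x := by
  refine ⟨hD, fun x hx y hy a b ha hb hab => ?_⟩
  simp only [smul_eq_mul]
  rw [← tsum_mul_left, ← tsum_mul_left, ← ((hs x).mul_left a).tsum_add ((hs y).mul_left b)]
  exact Summable.tsum_le_tsum (fun i => (hf i).2 hx hy ha hb hab)
    (((hs x).mul_left a).add ((hs y).mul_left b)) (hs _)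

lemma strictConcaveOn_tsum {ι : Type} [Nonempty ι] {D : Set ℝ} (hD : Convex ℝ D) {f : ι → ℝ → ℝ}
    (hf : ∀ i, StrictConcaveOn ℝ D (f i)) (hs : ∀ x, Summable fun i => f i x) :
    StrictConcaveOn ℝ D fun x => ∑' i, f i x := by
  refine ⟨hD, fun x hx y hy hxy a b ha hb hab => ?_⟩
  simp only [smul_eq_mul]
  rw [← tsum_mul_left, ← tsum_mul_left, ← ((hs x).mul_left a).tsum_add ((hs y).mul_left b)]
  have key := fun i => (hf i).2 hx hy hxy ha hb hab
  exact Summable.tsum_lt_tsum (fun i => (key i).le) (key (Classical.arbitrary ι))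
    (((hs x).mul_left a).add ((hs y).mul_left b)) (hs _)

lemma eq_of_dist_lt_pi {a b : ℝ} (ha : ∃ n : ℤ, a = n * Real.pi) (hb : ∃ n : ℤ, b = n * Real.pi)
    (h : dist a b < Real.pi) : a = b := by
  obtain ⟨n, rfl⟩ := ha
  obtain ⟨l, rfl⟩ := hb
  rw [Real.dist_eq, ← sub_mul, abs_mul, abs_of_pos Real.pi_pos] at h
  have h1 : |(n : ℝ) - l| < 1 := by
    by_contra hcon
    nlinarith [Real.pi_pos]
  have h2 : |n - l| < 1 := by exact_mod_cast h1
  rw [sub_eq_zero.1 (Int.abs_lt_one_iff.1 h2)]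

/-- The data of two families of positive numbers `exp uᵢ`, `exp vᵢ`, of an exponent `m` and of a
level `k`, which describe the level set `‖z ^ m ∏ (1 - z² exp (-uᵢ)) / ∏ (1 + z² exp (-vᵢ))‖ = exp k`
in the coordinates `z = exp ((x + iψ) / 2)`. -/
structure StripData where
  ι : Type
  κ : Type
  u : ι → ℝ
  v : κ → ℝ
  m : ℝ
  k : ℝ
  hu : Summable fun i => Real.exp (-u i)
  hv : Summable fun i => Real.exp (-v i)
  ne : Nonempty ι ∨ Nonempty κ

/-! ### The level curve `psi` and the phase `alpha` along it -/

namespace StripData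

variable (D : StripData)

/-- The modulus equation cleared of denominators and logarithms: it remains continuous where a
product vanishes. At regular points its sign is opposite to that of `logRatio`. -/
noncomputable def gap (x t : ℝ) : ℝ :=
  Real.exp D.k * ‖stripProd D.v x t‖ - Real.exp (D.m / 2 * x) * ‖stripProd D.u x (Real.pi - t)‖

/-- The angle at which the level set meets the circle `‖z‖ = exp (x / 2)`, or an end point of
`[0, π]` if there is none. -/
noncomputable def psi (x : ℝ) : ℝ :=
  sSup {t | t ∈ Set.Icc 0 Real.pi ∧ (t = 0 ∨ 0 ≤ D.gap x t)}

noncomputable def logRatio (x t : ℝ) : ℝ :=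
  D.m / 2 * x + stripLog D.u x (Real.pi - t) - stripLog D.v x t - D.k

/-- The `u`-product enters with a minus sign because 1 - exp (x - uᵢ + it) is the conjugate of
`stripFactor (x - u i) (π - t)`. -/
noncomputable def phase (x t : ℝ) : ℝ :=
  D.m / 2 * t - stripArg D.u x (Real.pi - t) - stripArg D.v x t

noncomputable def alpha (x : ℝ) : ℝ := D.phase x (D.psi x)

/-- The data obtained by exchanging the two boundary lines of the strip. -/
def reflect : StripData := ⟨D.κ, D.ι, D.v, D.u, -D.m, -D.k, D.hv, D.hu, D.ne.symm⟩

def Regular (x t : ℝ) : Prop := stripProd D.v x t ≠ 0 ∧ stripProd D.u x (Real.pi - t) ≠ 0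

variable {D}

lemma continuous_gap : Continuous fun p : ℝ × ℝ => D.gap p.1 p.2 := by
  unfold gap
  have h1 := (continuous_stripProd D.hv).norm
  have h2 := ((continuous_stripProd D.hu).comp
    (g := fun p : ℝ × ℝ => stripProd D.u p.1 p.2) (f := fun p : ℝ × ℝ => (p.1, Real.pi - p.2))
    (by fun_prop)).norm
  exact (continuous_const.mul h1).sub ((by fun_prop : Continuous fun p : ℝ × ℝ =>
    Real.exp (D.m / 2 * p.1)).mul h2)

lemma continuous_gap_left (t : ℝ) : Continuous fun x => D.gap x t :=
  continuous_gap.comp (g := fun p : ℝ × ℝ => D.gap p.1 p.2) (f := fun x => (x, t)) (by fun_prop)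

lemma continuous_gap_right (x : ℝ) : Continuous fun t => D.gap x t :=
  continuous_gap.comp (g := fun p : ℝ × ℝ => D.gap p.1 p.2) (f := fun t => (x, t)) (by fun_prop)

/-- Both terms of `gap` are monotone in the angle, and the one that belongs to a nonempty family is
strictly so. This makes `psi` well determined by the sign of `gap`. -/
lemma gap_neg_of_lt {x t₁ t₂ : ℝ} (h0 : 0 ≤ t₁) (h : t₁ < t₂) (hπ : t₂ ≤ Real.pi)
    (hg : D.gap x t₁ ≤ 0) : D.gap x t₂ < 0 := by
  unfold gap at hg ⊢
  have hk := Real.exp_pos D.k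
  have hm := Real.exp_pos (D.m / 2 * x)
  rcases D.ne with hne | hne
  · have h1 := norm_stripProd_lt (x := x) D.hu (ψ₁ := Real.pi - t₂) (ψ₂ := Real.pi - t₁)
      (by linarith) (by linarith) (by linarith)
    have h2 := norm_stripProd_le (x := x) D.hv h0 h.le hπ
    have := mul_lt_mul_of_pos_left h1 hm
    have := mul_le_mul_of_nonneg_left h2 hk.le
    linarith
  · have h1 := norm_stripProd_le (x := x) D.hu (ψ₁ := Real.pi - t₂) (ψ₂ := Real.pi - t₁)
      (by linarith) (by linarith) (by linarith)
    have h2 := norm_stripProd_lt (x := x) D.hv h0 h hπ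
    have := mul_le_mul_of_nonneg_left h1 hm.le
    have := mul_lt_mul_of_pos_left h2 hk
    linarith

lemma psi_bddAbove (x : ℝ) : BddAbove {t | t ∈ Set.Icc 0 Real.pi ∧ (t = 0 ∨ 0 ≤ D.gap x t)} :=
  ⟨Real.pi, fun _ ht => ht.1.2⟩

lemma psi_nonempty (x : ℝ) :
    {t | t ∈ Set.Icc 0 Real.pi ∧ (t = 0 ∨ 0 ≤ D.gap x t)}.Nonempty :=
  ⟨0, ⟨⟨le_rfl, Real.pi_pos.le⟩, Or.inl rfl⟩⟩

lemma psi_nonneg (x : ℝ) : 0 ≤ D.psi x :=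
  le_csSup (psi_bddAbove x) ⟨⟨le_rfl, Real.pi_pos.le⟩, Or.inl rfl⟩

lemma psi_le_pi (x : ℝ) : D.psi x ≤ Real.pi :=
  csSup_le (psi_nonempty x) fun _ ht => ht.1.2

lemma psi_mem (x : ℝ) : D.psi x ∈ Set.Icc 0 Real.pi := ⟨psi_nonneg x, psi_le_pi x⟩

lemma pi_sub_psi_mem (x : ℝ) : Real.pi - D.psi x ∈ Set.Icc 0 Real.pi :=
  ⟨by linarith [psi_le_pi (D := D) x], by linarith [psi_nonneg (D := D) x]⟩

lemma gap_pos_of_lt_psi {x t : ℝ} (h0 : 0 ≤ t) (h : t < D.psi x) : 0 < D.gap x t := by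
  obtain ⟨s, ⟨hs, hs'⟩, hts⟩ := exists_lt_of_lt_csSup (psi_nonempty x) h
  by_contra hcon
  have := gap_neg_of_lt h0 hts hs.2 (not_lt.1 hcon)
  rcases hs' with rfl | hs'
  · linarith
  · linarith

lemma gap_neg_of_psi_lt {x t : ℝ} (h : D.psi x < t) (hπ : t ≤ Real.pi) : D.gap x t < 0 := by
  by_contra hcon
  have hmem : t ∈ {t | t ∈ Set.Icc 0 Real.pi ∧ (t = 0 ∨ 0 ≤ D.gap x t)} :=
    ⟨⟨(psi_nonneg x).trans h.le, hπ⟩, Or.inr (not_lt.1 hcon)⟩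
  exact absurd (le_csSup (psi_bddAbove x) hmem) (not_le.2 h)

lemma le_psi_of_gap_nonneg {x t : ℝ} (hπ : t ≤ Real.pi) (h : 0 ≤ D.gap x t) : t ≤ D.psi x :=
  not_lt.1 fun h' => absurd (gap_neg_of_psi_lt h' hπ) (not_lt.2 h)

lemma psi_le_of_gap_nonpos {x t : ℝ} (h0 : 0 ≤ t) (h : D.gap x t ≤ 0) : D.psi x ≤ t :=
  not_lt.1 fun h' => absurd (gap_pos_of_lt_psi h0 h') (not_lt.2 h)

lemma gap_psi_nonneg {x : ℝ} (h : 0 < D.psi x) : 0 ≤ D.gap x (D.psi x) := by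
  have : (𝓝[<] D.psi x).NeBot := nhdsLT_neBot _
  refine ge_of_tendsto (((continuous_gap_right (D := D) x).tendsto (D.psi x)).mono_left
    (nhdsWithin_le_nhds (s := Set.Iio (D.psi x)))) ?_
  filter_upwards [Ioo_mem_nhdsLT h] with t ht
  exact (gap_pos_of_lt_psi ht.1.le ht.2).le

lemma gap_psi_nonpos {x : ℝ} (h : D.psi x < Real.pi) : D.gap x (D.psi x) ≤ 0 := by
  refine le_of_tendsto (((continuous_gap_right (D := D) x).tendsto (D.psi x)).mono_left
    (nhdsWithin_le_nhds (s := Set.Ioi (D.psi x)))) ?_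
  filter_upwards [Ioo_mem_nhdsGT h] with t ht
  exact (gap_neg_of_psi_lt ht.1 ht.2.le).le

lemma psi_eq_of_gap_eq_zero {x t : ℝ} (ht : t ∈ Set.Icc 0 Real.pi) (h : D.gap x t = 0) :
    D.psi x = t :=
  le_antisymm (psi_le_of_gap_nonpos ht.1 h.le) (le_psi_of_gap_nonneg ht.2 h.ge)

/-- The strict sign of `gap` at an angle slightly below or above `psi x₀` persists for nearby x. -/
lemma continuous_psi : Continuous D.psi := by
  refine continuous_iff_continuousAt.2 fun x₀ => tendsto_order.2 ⟨fun a ha => ?_, fun a ha => ?_⟩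
  · rcases lt_or_ge a 0 with h | h
    · exact .of_forall fun x => h.trans_le (psi_nonneg x)
    obtain ⟨b, hab, hb⟩ := exists_between ha
    have := (continuous_gap_left (D := D) b).continuousAt.eventually
      (lt_mem_nhds (gap_pos_of_lt_psi (h.trans hab.le) hb))
    filter_upwards [this] with x hx
    exact hab.trans_le (le_psi_of_gap_nonneg (hb.le.trans (psi_le_pi _)) hx.le)
  · rcases lt_or_ge Real.pi a with h | h
    · exact .of_forall fun x => (psi_le_pi x).trans_lt h
    obtain ⟨b, hb, hab⟩ := exists_between ha
    have := (continuous_gap_left (D := D) b).continuousAt.eventually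
      (gt_mem_nhds (gap_neg_of_psi_lt hb (hab.le.trans h)))
    filter_upwards [this] with x hx
    exact (psi_le_of_gap_nonpos ((psi_nonneg x₀).trans hb.le) hx.le).trans_lt hab

/-- The substitution t ↦ π - t exchanges the two families and replaces R by its inverse, so whatever
is proved on the line ψ = 0 (the real axis) carries over to ψ = π (the imaginary axis). -/
lemma gap_reflect (x t : ℝ) :
    D.reflect.gap x (Real.pi - t) = -(Real.exp (-D.k - D.m / 2 * x) * D.gap x t) := by
  have e1 : Real.exp (-D.k - D.m / 2 * x) * Real.exp D.k = Real.exp (-D.m / 2 * x) := by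
    rw [← Real.exp_add]; congr 1; ring
  have e2 : Real.exp (-D.k - D.m / 2 * x) * Real.exp (D.m / 2 * x) = Real.exp (-D.k) := by
    rw [← Real.exp_add]; congr 1; ring
  simp only [gap, reflect, sub_sub_cancel]
  rw [← e1, ← e2]; ring

lemma psi_reflect (x : ℝ) : D.reflect.psi x = Real.pi - D.psi x := by
  have hpos := Real.exp_pos (-D.k - D.m / 2 * x)
  apply le_antisymm
  · by_contra hcon
    obtain ⟨r, h1, h2⟩ := exists_between (not_le.1 hcon)
    have hr : 0 ≤ r := (pi_sub_psi_mem x).1.trans h1.le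
    have h3 := gap_pos_of_lt_psi hr h2
    have h4 := gap_reflect (D := D) x (Real.pi - r)
    rw [sub_sub_cancel] at h4
    have h5 := gap_pos_of_lt_psi (D := D) (x := x) (t := Real.pi - r)
      (by linarith [psi_le_pi (D := D.reflect) x]) (by linarith)
    nlinarith
  · by_contra hcon
    obtain ⟨r, h1, h2⟩ := exists_between (not_le.1 hcon)
    have hr : r ≤ Real.pi := h2.le.trans (pi_sub_psi_mem x).2
    have h3 := gap_neg_of_psi_lt h1 hr
    have h4 := gap_reflect (D := D) x (Real.pi - r)
    rw [sub_sub_cancel] at h4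
    have h5 := gap_neg_of_psi_lt (D := D) (x := x) (t := Real.pi - r)
      (by linarith) (by linarith [psi_nonneg (D := D.reflect) x])
    nlinarith

/-- The `v`-product can vanish only at ψ = π; there `gap` would then be negative, which is
incompatible with `psi x = π`. -/
lemma stripProd_v_psi_ne_zero (x : ℝ) : stripProd D.v x (D.psi x) ≠ 0 := by
  intro h
  rcases (psi_le_pi (D := D) x).lt_or_eq with hlt | heq
  · exact stripProd_ne_zero_of_lt D.hv (psi_nonneg x) hlt h
  have h1 := gap_psi_nonneg (D := D) (x := x) (heq ▸ Real.pi_pos)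
  unfold gap at h1
  rw [h, heq, sub_self, norm_zero, mul_zero, zero_sub] at h1
  have h2 := norm_pos_iff.2 (stripProd_ne_zero_of_lt D.hu (x := x) le_rfl Real.pi_pos)
  have := mul_pos (Real.exp_pos (D.m / 2 * x)) h2
  linarith

lemma regular_psi (x : ℝ) : D.Regular x (D.psi x) := by
  refine ⟨stripProd_v_psi_ne_zero x, ?_⟩
  have := stripProd_v_psi_ne_zero (D := D.reflect) x
  rwa [psi_reflect] at this

lemma gap_eq_of_regular {x t : ℝ} (h : D.Regular x t) :
    D.gap x t = Real.exp D.k * ‖stripProd D.v x t‖ * (1 - Real.exp (D.logRatio x t)) := by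
  unfold gap logRatio
  rw [norm_stripProd_eq_exp D.hu ((stripProd_ne_zero_iff D.hu).1 h.2),
    norm_stripProd_eq_exp D.hv ((stripProd_ne_zero_iff D.hv).1 h.1), mul_sub, mul_one]
  simp only [← Real.exp_add]
  congr 2
  ring

lemma gap_pos_iff_of_regular {x t : ℝ} (h : D.Regular x t) :
    0 < D.gap x t ↔ D.logRatio x t < 0 := by
  have := norm_pos_iff.2 h.1
  rw [gap_eq_of_regular h, mul_pos_iff_of_pos_left (by positivity), sub_pos, Real.exp_lt_one_iff]

lemma gap_nonneg_iff_of_regular {x t : ℝ} (h : D.Regular x t) :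
    0 ≤ D.gap x t ↔ D.logRatio x t ≤ 0 := by
  have := norm_pos_iff.2 h.1
  rw [gap_eq_of_regular h, mul_nonneg_iff_of_pos_left (by positivity), sub_nonneg,
    Real.exp_le_one_iff]

lemma gap_eq_zero_iff_of_regular {x t : ℝ} (h : D.Regular x t) :
    D.gap x t = 0 ↔ D.logRatio x t = 0 := by
  have := norm_pos_iff.2 h.1
  rw [gap_eq_of_regular h, mul_eq_zero_iff_left (by positivity), sub_eq_zero, eq_comm,
    Real.exp_eq_one_iff]

/-- The power of z contributes equally to both sides and cancels. The `u`-factors appear conjugated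
in the numerator and the `v`-factors unconjugated in the denominator, so the monotonicity of both
families acts in the same direction. -/
lemma phase_monotone {x₁ x₂ t₁ t₂ : ℝ} (h₁ : t₁ ∈ Set.Icc 0 Real.pi) (h₂ : t₂ ∈ Set.Icc 0 Real.pi)
    (n₁ : D.Regular x₁ t₁) (n₂ : D.Regular x₂ t₂) (hne : x₁ ≠ x₂ ∨ t₁ ≠ t₂)
    (h0 : ¬ (t₁ = 0 ∧ t₂ = 0)) (hπ : ¬ (t₁ = Real.pi ∧ t₂ = Real.pi)) :
    (D.phase x₂ t₂ - D.phase x₁ t₁) * (x₂ - x₁) <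
      (D.logRatio x₂ t₂ - D.logRatio x₁ t₁) * (t₂ - t₁) := by
  have h₁' : Real.pi - t₁ ∈ Set.Icc 0 Real.pi := ⟨by linarith [h₁.2], by linarith [h₁.1]⟩
  have h₂' : Real.pi - t₂ ∈ Set.Icc 0 Real.pi := ⟨by linarith [h₂.2], by linarith [h₂.1]⟩
  have a := stripProd_monotone D.hu h₁' h₂' n₁.2 n₂.2
  have b := stripProd_monotone D.hv h₁ h₂ n₁.1 n₂.1
  unfold phase logRatio
  rcases D.ne with hι | hι
  · have c := stripProd_monotone_strict D.hu h₁' h₂' n₁.2 n₂.2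
      (hne.imp_right fun h h' => h (by linarith)) (fun h => hπ ⟨by linarith, by linarith⟩)
      (fun h => h0 ⟨by linarith, by linarith⟩)
    nlinarith
  · have c := stripProd_monotone_strict D.hv h₁ h₂ n₁.1 n₂.1 hne h0 hπ
    nlinarith

lemma phase_zero (x : ℝ) : D.phase x 0 = -stripArg D.u x Real.pi := by
  simp [phase, stripArg_zero]

lemma phase_pi (x : ℝ) : D.phase x Real.pi = D.m / 2 * Real.pi - stripArg D.v x Real.pi := by
  simp [phase, stripArg_zero]

lemma exists_alpha_eq_of_psi_eq_zero {x : ℝ} (h : D.psi x = 0) :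
    ∃ n : ℤ, D.alpha x = n * Real.pi := by
  obtain ⟨n, hn⟩ := exists_stripArg_pi_eq D.hu x
  exact ⟨-n, by rw [alpha, h, phase_zero, hn]; push_cast; ring⟩

lemma alpha_reflect (x : ℝ) : D.reflect.alpha x = D.alpha x - D.m / 2 * Real.pi := by
  rw [alpha, alpha, psi_reflect]
  simp only [phase, reflect, sub_sub_cancel]
  ring

lemma exists_alpha_eq_of_psi_eq_pi {x : ℝ} (h : D.psi x = Real.pi) :
    ∃ n : ℤ, D.alpha x = D.m / 2 * Real.pi + n * Real.pi := by
  obtain ⟨n, hn⟩ := exists_alpha_eq_of_psi_eq_zero (D := D.reflect) (x := x)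
    (by rw [psi_reflect, h, sub_self])
  exact ⟨n, by rw [alpha_reflect] at hn; linarith⟩

lemma logRatio_psi_nonneg {x : ℝ} (h : D.psi x < Real.pi) : 0 ≤ D.logRatio x (D.psi x) := by
  have := gap_psi_nonpos h
  rw [← not_lt, gap_pos_iff_of_regular (regular_psi x)] at this
  exact not_lt.1 this

lemma logRatio_psi_nonpos {x : ℝ} (h : 0 < D.psi x) : D.logRatio x (D.psi x) ≤ 0 :=
  (gap_nonneg_iff_of_regular (regular_psi x)).1 (gap_psi_nonneg h)

/-- `logRatio` is 0 where `psi` is interior, nonnegative where `psi` is cut off at 0 and nonpositive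
where it is cut off at π. So between two abscissas with different values of `psi` it does not
increase with `psi`. -/
lemma logRatio_psi_mul_le (x₁ x₂ : ℝ) :
    (D.logRatio x₂ (D.psi x₂) - D.logRatio x₁ (D.psi x₁)) * (D.psi x₂ - D.psi x₁) ≤ 0 := by
  rcases lt_trichotomy (D.psi x₁) (D.psi x₂) with h | h | h
  · have h1 := logRatio_psi_nonneg (h.trans_le (psi_le_pi x₂))
    have h2 := logRatio_psi_nonpos ((psi_nonneg x₁).trans_lt h)
    nlinarith
  · rw [h, sub_self, mul_zero]
  · have h1 := logRatio_psi_nonneg (h.trans_le (psi_le_pi x₁))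
    have h2 := logRatio_psi_nonpos ((psi_nonneg x₂).trans_lt h)
    nlinarith

lemma alpha_lt_of_lt {x₁ x₂ : ℝ} (h : x₁ < x₂) (h0 : ¬ (D.psi x₁ = 0 ∧ D.psi x₂ = 0))
    (hπ : ¬ (D.psi x₁ = Real.pi ∧ D.psi x₂ = Real.pi)) : D.alpha x₂ < D.alpha x₁ := by
  have h1 := phase_monotone (psi_mem x₁) (psi_mem x₂) (regular_psi x₁) (regular_psi x₂)
    (Or.inl h.ne) h0 hπ
  have h2 := logRatio_psi_mul_le (D := D) x₁ x₂
  unfold alpha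
  by_contra hcon
  have := mul_nonneg (sub_nonneg.2 (not_lt.1 hcon)) (sub_pos.2 h).le
  linarith

lemma stripArg_pi_mono {ι : Type} {u : ι → ℝ} (hu : Summable fun i => Real.exp (-u i))
    {x₁ x₂ : ℝ} (h : x₁ ≤ x₂) : stripArg u x₁ Real.pi ≤ stripArg u x₂ Real.pi := by
  refine Summable.tsum_le_tsum (fun l => ?_) (summable_stripArg hu _ _) (summable_stripArg hu _ _)
  rcases le_or_gt (x₁ - u l) 0 with h | h'
  · rw [arg_stripFactor_pi_of_le h]
    exact (stripFactor_arg_mem ⟨Real.pi_pos.le, le_rfl⟩).1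
  · rw [arg_stripFactor_pi_of_pos h', arg_stripFactor_pi_of_pos (by linarith)]

lemma alpha_antitone : Antitone D.alpha := by
  intro x₁ x₂ h
  rcases h.eq_or_lt with rfl | h
  · rfl
  by_cases h0 : D.psi x₁ = 0 ∧ D.psi x₂ = 0
  · rw [alpha, alpha, h0.1, h0.2, phase_zero, phase_zero]
    exact neg_le_neg (stripArg_pi_mono D.hu h.le)
  by_cases hπ : D.psi x₁ = Real.pi ∧ D.psi x₂ = Real.pi
  · rw [alpha, alpha, hπ.1, hπ.2, phase_pi, phase_pi]
    exact sub_le_sub_left (stripArg_pi_mono D.hv h.le) _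
  exact (alpha_lt_of_lt h h0 hπ).le

lemma psi_of_alpha_eq {x₁ x₂ : ℝ} (hne : x₁ ≠ x₂) (h : D.alpha x₁ = D.alpha x₂) :
    (D.psi x₁ = 0 ∧ D.psi x₂ = 0) ∨ (D.psi x₁ = Real.pi ∧ D.psi x₂ = Real.pi) := by
  by_contra hcon
  push Not at hcon
  rcases lt_or_gt_of_ne hne with hlt | hlt
  · exact absurd h.symm (alpha_lt_of_lt hlt (fun h => hcon.1 h.1 h.2) fun h => hcon.2 h.1 h.2).ne
  · exact absurd h (alpha_lt_of_lt hlt (fun h => hcon.1 h.2 h.1) fun h => hcon.2 h.2 h.1).ne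

lemma continuous_alpha : Continuous D.alpha := by
  have h1 : Continuous fun x => stripArg D.v x (D.psi x) := by
    have := (continuousOn_stripArg D.hv).comp_continuous (f := fun x => (x, D.psi x))
      (by have := continuous_psi (D := D); fun_prop) fun x => ⟨psi_mem x, (regular_psi x).1⟩
    exact this
  have h2 : Continuous fun x => stripArg D.u x (Real.pi - D.psi x) := by
    have := (continuousOn_stripArg D.hu).comp_continuous (f := fun x => (x, Real.pi - D.psi x))
      (by have := continuous_psi (D := D); fun_prop) fun x => ⟨pi_sub_psi_mem x, (regular_psi x).2⟩
    exact this
  have := continuous_psi (D := D)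
  unfold alpha phase
  exact ((continuous_const.mul this).sub h2).sub h1

lemma eventually_psi_eq_zero {x : ℝ} (h : D.gap x 0 < 0) : ∀ᶠ y in 𝓝 x, D.psi y = 0 := by
  filter_upwards [(continuous_gap_left (D := D) 0).continuousAt.eventually (gt_mem_nhds h)] with y hy
  exact le_antisymm (psi_le_of_gap_nonpos le_rfl hy.le) (psi_nonneg y)

/-- There `alpha` is continuous with values in the discrete set πℤ. -/
lemma eventually_alpha_eq_of_psi_eventuallyEq_zero {x : ℝ} (h : ∀ᶠ y in 𝓝 x, D.psi y = 0) :
    ∀ᶠ y in 𝓝 x, D.alpha y = D.alpha x := by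
  filter_upwards [h, (continuous_alpha (D := D)).continuousAt.eventually
    (Metric.ball_mem_nhds (D.alpha x) Real.pi_pos)] with y hy hy'
  exact eq_of_dist_lt_pi (exists_alpha_eq_of_psi_eq_zero hy)
    (exists_alpha_eq_of_psi_eq_zero h.self_of_nhds) hy'

lemma eventually_alpha_eq_of_gap_neg {x : ℝ} (h : D.gap x (D.psi x) < 0) :
    ∀ᶠ y in 𝓝 x, D.alpha y = D.alpha x := by
  have h0 : D.psi x = 0 := by
    by_contra hcon
    exact absurd (gap_psi_nonneg (lt_of_le_of_ne (psi_nonneg x) (Ne.symm hcon))) (not_le.2 h)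
  exact eventually_alpha_eq_of_psi_eventuallyEq_zero (eventually_psi_eq_zero (h0 ▸ h))

/-- Where the level set is not met, `alpha` is locally constant. -/
lemma eventually_alpha_eq {x : ℝ} (h : D.gap x (D.psi x) ≠ 0) :
    ∀ᶠ y in 𝓝 x, D.alpha y = D.alpha x := by
  rcases lt_or_gt_of_ne h with h | h
  · exact eventually_alpha_eq_of_gap_neg h
  have h1 := gap_reflect (D := D) x (D.psi x)
  rw [← psi_reflect] at h1
  have h2 := eventually_alpha_eq_of_gap_neg (D := D.reflect) (x := x) (by
    rw [h1]; exact neg_neg_of_pos (mul_pos (Real.exp_pos _) h))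
  filter_upwards [h2] with y hy
  simpa [alpha_reflect] using hy

/-- Existence of a first zero rests on this, and here at least one factor is needed. Otherwise the
arguments would always sum to less than `psi x / 2`. A `v`-factor at x = vᵢ already contributes half
of `psi`, so there is none. A `u`-factor at large x then forces `psi x > π/2`, hence all `u`-factors
have modulus at least 1 and |R| > 1, contrary to `psi x > 0`. -/
lemma exists_alpha_le (hm : 1 ≤ D.m) : ∃ x, D.alpha x ≤ (D.m - 1) / 2 * Real.pi := by
  by_contra hcon
  push Not at hcon
  have hsum : ∀ x, stripArg D.u x (Real.pi - D.psi x) + stripArg D.v x (D.psi x) < D.psi x / 2 := by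
    intro x
    have h1 := hcon x
    have h2 := (pi_sub_psi_mem (D := D) x).1
    unfold alpha phase at h1
    nlinarith
  have hv : IsEmpty D.κ := by
    by_contra hne
    rw [not_isEmpty_iff] at hne
    obtain ⟨i⟩ := hne
    have h1 := half_le_arg_stripFactor (x := D.v i - D.v i) (by simp) (psi_mem (D := D) (D.v i))
      ((stripProd_ne_zero_iff D.hv).1 (regular_psi _).1 i)
    have h2 := arg_le_stripArg D.hv (x := D.v i) (psi_mem (D := D) (D.v i)) i
    have h3 := stripArg_nonneg (u := D.u) (x := D.v i) (pi_sub_psi_mem (D := D) (D.v i))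
    linarith [hsum (D.v i)]
  obtain ⟨i⟩ : Nonempty D.ι := D.ne.resolve_right (not_nonempty_iff.2 hv)
  -- x ≥ uᵢ gives the half-angle bound, and x ≥ 0 with x ≥ 2k + 1 and m ≥ 1 gives m x / 2 - k > 0.
  set x := max (D.u i) (max 0 (2 * D.k + 1)) with hx
  have hxi : D.u i ≤ x := le_max_left _ _
  have hx0 : 0 ≤ x := (le_max_left _ _).trans (le_max_right _ _)
  have hxk : 2 * D.k + 1 ≤ x := (le_max_right _ _).trans (le_max_right _ _)
  have h1 := half_le_arg_stripFactor (x := x - D.u i) (by linarith) (pi_sub_psi_mem (D := D) x)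
    ((stripProd_ne_zero_iff D.hu).1 (regular_psi _).2 i)
  have h2 := arg_le_stripArg D.hu (x := x) (pi_sub_psi_mem (D := D) x) i
  have h3 := stripArg_nonneg (u := D.v) (x := x) (psi_mem (D := D) x)
  have h4 := hsum x
  have hψ : Real.pi - D.psi x < Real.pi / 2 := by linarith
  have h5 := logRatio_psi_nonpos (D := D) (x := x) (by linarith [Real.pi_pos])
  have h6 : 0 ≤ stripLog D.u x (Real.pi - D.psi x) :=
    tsum_nonneg fun l => Real.log_nonneg
      (one_le_norm_stripFactor (pi_sub_psi_mem (D := D) x).1 hψ.le)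
  have h7 : stripLog D.v x (D.psi x) = 0 := by simp [stripLog]
  unfold logRatio at h5
  nlinarith

lemma exists_lt_of_summable {ι : Type} {u : ι → ℝ} (hu : Summable fun i => Real.exp (-u i)) :
    ∃ x, ∀ i, x < u i := by
  refine ⟨-Real.log (∑' i, Real.exp (-u i) + 1), fun i => ?_⟩
  have h0 : 0 ≤ ∑' i, Real.exp (-u i) := tsum_nonneg fun i => (Real.exp_pos _).le
  have h1 : Real.exp (-u i) < ∑' i, Real.exp (-u i) + 1 :=
    (hu.le_tsum i fun _ _ => (Real.exp_pos _).le).trans_lt (lt_add_one _)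
  have := (Real.lt_log_iff_exp_lt (by linarith)).2 h1
  linarith

/-- As x tends to -∞ the products stay bounded and bounded away from 0 while exp (m x / 2) tends to
0, so |R| ≤ 1 up to the angle π. Below all vᵢ the `v`-arguments at π vanish, which gives the initial
value of `alpha`. -/
lemma eventually_psi_eq_pi (hm : 0 < D.m) :
    ∀ᶠ x in atBot, D.psi x = Real.pi ∧ D.alpha x = D.m / 2 * Real.pi := by
  obtain ⟨x₀, hx₀⟩ := exists_lt_of_summable D.hv
  set C := Real.log (Real.exp D.k * ‖stripProd D.v x₀ Real.pi‖) with hC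
  have hmono : ∀ {y z : ℝ}, y ≤ z → ‖stripFactor y 0‖ ≤ ‖stripFactor z 0‖ := by
    intro y z hyz
    rw [stripFactor_zero, stripFactor_zero, Complex.norm_real, Complex.norm_real,
      Real.norm_of_nonneg (by positivity), Real.norm_of_nonneg (by positivity)]
    gcongr
  filter_upwards [eventually_le_atBot x₀,
    eventually_le_atBot (2 / D.m * (D.k + stripLog D.v x₀ Real.pi - stripLog D.u x₀ 0))]
    with x hx hx'
  have hne : ∀ y ≤ x₀, ∀ i, stripFactor (y - D.v i) Real.pi ≠ 0 := fun y hy i h => by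
    have := stripFactor_pi_eq_zero_iff.1 h
    linarith [hx₀ i]
  have hreg : D.Regular x Real.pi := by
    refine ⟨(stripProd_ne_zero_iff D.hv).2 (hne x hx), ?_⟩
    rw [sub_self]
    exact stripProd_ne_zero_of_lt D.hu le_rfl Real.pi_pos
  have h1 : stripLog D.u x 0 ≤ stripLog D.u x₀ 0 :=
    Summable.tsum_le_tsum (fun i => Real.log_le_log
      (norm_pos_iff.2 (stripFactor_ne_zero_of_lt le_rfl Real.pi_pos)) (hmono (by linarith)))
      (summable_stripLog D.hu _ _) (summable_stripLog D.hu _ _)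
  have h2 : stripLog D.v x₀ Real.pi ≤ stripLog D.v x Real.pi := by
    refine Summable.tsum_le_tsum (fun i => Real.log_le_log (norm_pos_iff.2 (hne x₀ le_rfl i)) ?_)
      (summable_stripLog D.hv _ _) (summable_stripLog D.hv _ _)
    have a1 : Real.exp (x - D.v i) ≤ Real.exp (x₀ - D.v i) := by gcongr
    have a2 : Real.exp (x₀ - D.v i) ≤ 1 := by simpa using (hx₀ i).le
    rw [stripFactor_pi, stripFactor_pi, Complex.norm_real, Complex.norm_real,
      Real.norm_of_nonneg (by linarith), Real.norm_of_nonneg (by linarith)]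
    linarith
  have hlr : D.logRatio x Real.pi ≤ 0 := by
    unfold logRatio
    rw [sub_self]
    have : D.m / 2 * x ≤ D.k + stripLog D.v x₀ Real.pi - stripLog D.u x₀ 0 := by
      have := mul_le_mul_of_nonneg_left hx' (half_pos hm).le
      rwa [← mul_assoc, div_mul_div_comm, mul_comm D.m 2, div_self (by positivity), one_mul] at this
    linarith
  have hψ : D.psi x = Real.pi := le_antisymm (psi_le_pi x)
    (le_psi_of_gap_nonneg le_rfl ((gap_nonneg_iff_of_regular hreg).2 hlr))
  refine ⟨hψ, ?_⟩
  rw [alpha, hψ, phase_pi]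
  have : stripArg D.v x Real.pi = 0 := by
    unfold stripArg
    rw [← tsum_zero (α := ℝ)]
    congr 1; funext i
    exact arg_stripFactor_pi_of_le (by linarith [hx₀ i])
  rw [this, sub_zero]

lemma alpha_le (hm : 0 < D.m) (x : ℝ) : D.alpha x ≤ D.m / 2 * Real.pi := by
  obtain ⟨y, hy, hyx⟩ := ((eventually_psi_eq_pi hm).and (eventually_le_atBot x)).exists
  exact hy.2 ▸ alpha_antitone hyx

end StripData

/-! ### Order of vanishing of `gap` -/

lemma half_min_abs_le_abs_one_sub_exp (y : ℝ) : min |y| 1 / 2 ≤ |1 - Real.exp y| := by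
  rcases le_total 0 y with h | h
  · have := Real.add_one_le_exp y
    rw [abs_of_nonneg h, abs_of_nonpos (by linarith)]
    linarith [min_le_left y 1]
  · have h1 := Real.add_one_le_exp (-y)
    have h2 : Real.exp y * Real.exp (-y) = 1 := by rw [← Real.exp_add]; simp
    have h3 := Real.exp_pos y
    have h4 : Real.exp y ≤ 1 := Real.exp_le_one_iff.2 h
    rw [abs_of_nonpos h, abs_of_nonneg (by linarith)]
    rcases le_total (-y) 1 with h5 | h5
    · rw [min_eq_left h5]; nlinarith
    · rw [min_eq_right h5]; nlinarith

lemma eventually_le_of_hasDerivAt {g : ℝ → ℝ} {c : ℝ} (hg : HasDerivAt g c 0) (h0 : g 0 = 0)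
    (hc : 0 < c) : ∀ᶠ d in 𝓝[>] 0, c / 2 * d ≤ g d := by
  have h := (hasDerivAt_iff_tendsto_slope.1 hg).eventually (lt_mem_nhds (half_lt_self hc))
  have h' : ∀ᶠ d in 𝓝[>] (0 : ℝ), c / 2 < slope g 0 d :=
    h.filter_mono (nhdsWithin_mono _ fun x hx => ne_of_gt hx)
  filter_upwards [h', self_mem_nhdsWithin] with d hd hd0
  have hd0' : (0 : ℝ) < d := hd0
  rw [slope_def_field, h0, sub_zero, sub_zero, lt_div_iff₀ hd0'] at hd
  exact hd.le

/-- The contradiction behind every bound on a multiplicity: growth of exact order n from below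
against order n + 1 from above. -/
lemma not_pow_bound_of_pow_bound {G : ℝ → ℝ} {c C : ℝ} {n : ℕ} (hc : 0 < c)
    (h₁ : ∀ᶠ d in 𝓝[>] (0 : ℝ), c * d ^ n ≤ G d)
    (h₂ : ∀ᶠ d in 𝓝[>] (0 : ℝ), G d ≤ C * d ^ (n + 1)) : False := by
  have h3 : ∀ᶠ d in 𝓝[>] (0 : ℝ), C * d < c := by
    have : Tendsto (fun d : ℝ => C * d) (𝓝[>] 0) (𝓝 (C * 0)) :=
      ((continuous_const_mul C).tendsto 0).mono_left nhdsWithin_le_nhds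
    rw [mul_zero] at this
    exact this.eventually (gt_mem_nhds hc)
  obtain ⟨d, ⟨hd1, hd2⟩, hd3, hd0⟩ := ((h₁.and h₂).and (h3.and self_mem_nhdsWithin)).exists
  have hd0' : (0 : ℝ) < d := hd0
  have := mul_lt_mul_of_pos_right hd3 (pow_pos hd0' n)
  rw [pow_succ] at hd2
  nlinarith

lemma eventually_neg_nhdsGT {p : ℝ → Prop} (h : ∀ᶠ d in 𝓝 (0 : ℝ), p d) :
    ∀ᶠ d in 𝓝[>] (0 : ℝ), p (-d) := by
  have : Tendsto (fun d : ℝ => -d) (𝓝[>] 0) (𝓝 0) := by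
    have := (continuous_neg.tendsto (0 : ℝ)).mono_left (nhdsWithin_le_nhds (s := Set.Ioi 0))
    rwa [neg_zero] at this
  exact this.eventually h

lemma hasDerivAt_log_norm_stripFactor {y ψ : ℝ} (h : stripFactor y ψ ≠ 0) :
    HasDerivAt (fun t => Real.log ‖stripFactor y t‖)
      (-(Real.exp y * Real.sin ψ) / ‖stripFactor y ψ‖ ^ 2) ψ := by
  have heq : (fun t => Real.log ‖stripFactor y t‖) =
      fun t => Real.log (1 + 2 * Real.exp y * Real.cos t + Real.exp y ^ 2) / 2 := by
    funext t
    rw [← norm_stripFactor_sq, Real.log_pow]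
    push_cast; ring
  have h0 : 1 + 2 * Real.exp y * Real.cos ψ + Real.exp y ^ 2 ≠ 0 := by
    rw [← norm_stripFactor_sq]
    exact pow_ne_zero _ (norm_ne_zero_iff.2 h)
  rw [heq, norm_stripFactor_sq]
  have := (((((Real.hasDerivAt_cos ψ).const_mul (2 * Real.exp y)).const_add 1).add_const
    (Real.exp y ^ 2)).log h0).div_const 2
  exact this.congr_deriv (by ring)

namespace StripData

variable {D : StripData}

/-- Near a regular zero, `gap` is comparable with `logRatio`. -/
lemma eventually_min_logRatio_le {x t : ℝ} (h : D.Regular x t) :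
    ∃ c > 0, ∀ᶠ p in 𝓝 (x, t), D.Regular p.1 p.2 ∧
      c * min |D.logRatio p.1 p.2| 1 ≤ |D.gap p.1 p.2| := by
  have hv := continuous_stripProd D.hv
  have hu : Continuous fun p : ℝ × ℝ => stripProd D.u p.1 (Real.pi - p.2) :=
    (continuous_stripProd D.hu).comp
      (g := fun p : ℝ × ℝ => stripProd D.u p.1 p.2) (f := fun p : ℝ × ℝ => (p.1, Real.pi - p.2))
      (by fun_prop)
  have hpos : 0 < ‖stripProd D.v x t‖ := norm_pos_iff.2 h.1
  refine ⟨Real.exp D.k * ‖stripProd D.v x t‖ / 4, by positivity, ?_⟩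
  filter_upwards [hv.norm.continuousAt.eventually (lt_mem_nhds (half_lt_self hpos)),
    hv.continuousAt.eventually_ne h.1, hu.continuousAt.eventually_ne h.2] with p h1 h2 h3
  refine ⟨⟨h2, h3⟩, ?_⟩
  rw [gap_eq_of_regular ⟨h2, h3⟩, abs_mul,
    abs_of_nonneg (show 0 ≤ Real.exp D.k * ‖stripProd D.v p.1 p.2‖ by positivity)]
  calc _ = Real.exp D.k * (‖stripProd D.v x t‖ / 2) * (min |D.logRatio p.1 p.2| 1 / 2) := by ring
    _ ≤ _ := by
      gcongr
      exact half_min_abs_le_abs_one_sub_exp _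

/-- `gap` has nonvanishing angular derivative at an interior point of the level set. -/
lemma not_quadratic_bound_of_interior {x : ℝ} (h0 : 0 < D.psi x) (hπ : D.psi x < Real.pi) (C : ℝ) :
    ¬ ∀ᶠ d in 𝓝 0, |D.gap x (D.psi x + d)| ≤ C * |d| ^ 2 := by
  intro hC
  set t := D.psi x with ht
  have hreg : D.Regular x t := regular_psi x
  have hgap : D.gap x t = 0 := le_antisymm (gap_psi_nonpos hπ) (gap_psi_nonneg h0)
  have hlr : D.logRatio x t = 0 := (gap_eq_zero_iff_of_regular hreg).1 hgap
  have hsmall : ∀ᶠ d in 𝓝[>] (0 : ℝ), t + d < Real.pi ∧ 0 < d := by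
    filter_upwards [Ioo_mem_nhdsGT (show (0 : ℝ) < Real.pi - t by linarith)] with d hd
    exact ⟨by linarith [hd.2], hd.1⟩
  -- Every factor changes log |R| in the same direction when the angle grows, so the derivative of
  -- one factor bounds the growth from below and the series need not be differentiated.
  have hgrow : ∃ c > 0, ∀ᶠ d in 𝓝[>] (0 : ℝ), c * d ≤ D.logRatio x (t + d) := by
    have hmono : ∀ {ι : Type} (u : ι → ℝ), (Summable fun i => Real.exp (-u i)) → ∀ s₁ s₂ : ℝ,
        0 ≤ s₁ → s₁ < s₂ → s₂ < Real.pi → ∀ i, 0 ≤ Real.log ‖stripFactor (x - u i) s₁‖ -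
          Real.log ‖stripFactor (x - u i) s₂‖ ∧
          Real.log ‖stripFactor (x - u i) s₁‖ - Real.log ‖stripFactor (x - u i) s₂‖ ≤
            stripLog u x s₁ - stripLog u x s₂ := by
      intro ι u hu s₁ s₂ hs1 hs hs2 i
      have key : ∀ i, 0 ≤ Real.log ‖stripFactor (x - u i) s₁‖ -
          Real.log ‖stripFactor (x - u i) s₂‖ := fun i => sub_nonneg.2 <| Real.log_le_log
        (norm_pos_iff.2 (stripFactor_ne_zero_of_lt (by linarith) hs2))
        (norm_stripFactor_anti hs1 hs hs2.le).le
      refine ⟨key i, ?_⟩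
      unfold stripLog
      rw [← (summable_stripLog hu _ _).tsum_sub (summable_stripLog hu _ _)]
      exact ((summable_stripLog hu _ _).sub (summable_stripLog hu _ _)).le_tsum i fun l _ => key l
    have hnonneg : ∀ {ι : Type} (u : ι → ℝ), (Summable fun i => Real.exp (-u i)) → ∀ s₁ s₂ : ℝ,
        0 ≤ s₁ → s₁ < s₂ → s₂ < Real.pi → 0 ≤ stripLog u x s₁ - stripLog u x s₂ := by
      intro ι u hu s₁ s₂ hs1 hs hs2
      cases isEmpty_or_nonempty ι
      · simp [stripLog]
      · obtain ⟨i⟩ := ‹Nonempty ι›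
        exact (hmono u hu s₁ s₂ hs1 hs hs2 i).1.trans (hmono u hu s₁ s₂ hs1 hs hs2 i).2
    have hsin : 0 < Real.sin t := Real.sin_pos_of_mem_Ioo ⟨h0, hπ⟩
    rcases D.ne with ⟨⟨i⟩⟩ | ⟨⟨i⟩⟩
    · have hn := (stripProd_ne_zero_iff D.hu).1 hreg.2 i
      have hd := hasDerivAt_log_norm_stripFactor hn
      have hin : HasDerivAt (fun d => Real.pi - (t + d)) (-1) 0 :=
        ((hasDerivAt_id (0 : ℝ)).const_add t).const_sub Real.pi
      have hd' := (HasDerivAt.scomp (0 : ℝ) (by simpa using hd) hin).sub_const (Real.log ‖stripFactor (x - D.u i) (Real.pi - t)‖)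
      have hc : 0 < (-1 : ℝ) • (-(Real.exp (x - D.u i) * Real.sin t) /
          ‖stripFactor (x - D.u i) (Real.pi - t)‖ ^ 2) := by
        rw [smul_eq_mul, neg_one_mul, neg_div, neg_neg]
        have := norm_pos_iff.2 hn
        positivity
      refine ⟨_, half_pos hc, ?_⟩
      filter_upwards [eventually_le_of_hasDerivAt hd' (by simp) hc, hsmall] with d h1 h2
      have e1 := (hmono D.u D.hu (Real.pi - (t + d)) (Real.pi - t) (by linarith) (by linarith)
        (by linarith) i).2
      have e2 := hnonneg D.v D.hv t (t + d) h0.le (by linarith) h2.1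
      simp only [Function.comp] at h1
      unfold logRatio at hlr ⊢
      linarith
    · have hn := (stripProd_ne_zero_iff D.hv).1 hreg.1 i
      have hd := hasDerivAt_log_norm_stripFactor hn
      have hin : HasDerivAt (fun d => t + d) 1 0 := (hasDerivAt_id (0 : ℝ)).const_add t
      have hd' := ((HasDerivAt.scomp (0 : ℝ) (by simpa using hd) hin).const_sub
          (Real.log ‖stripFactor (x - D.v i) t‖))
      have hc : 0 < -((1 : ℝ) • (-(Real.exp (x - D.v i) * Real.sin t) /
          ‖stripFactor (x - D.v i) t‖ ^ 2)) := by
        rw [smul_eq_mul, one_mul, neg_div, neg_neg]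
        have := norm_pos_iff.2 hn
        positivity
      refine ⟨_, half_pos hc, ?_⟩
      filter_upwards [eventually_le_of_hasDerivAt hd' (by simp) hc, hsmall] with d h1 h2
      have e1 := (hmono D.v D.hv t (t + d) h0.le (by linarith) h2.1 i).2
      have e2 := hnonneg D.u D.hu (Real.pi - (t + d)) (Real.pi - t) (by linarith) (by linarith)
        (by linarith)
      simp only [Function.comp] at h1
      unfold logRatio at hlr ⊢
      linarith
  obtain ⟨c, hc, hgrow⟩ := hgrow
  obtain ⟨c', hc', hcmp⟩ := eventually_min_logRatio_le hreg
  have htend : Tendsto (fun d : ℝ => (x, t + d)) (𝓝[>] 0) (𝓝 (x, t)) := by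
    have : Continuous fun d : ℝ => (x, t + d) := by fun_prop
    simpa using (this.tendsto 0).mono_left (nhdsWithin_le_nhds (s := Set.Ioi 0))
  refine not_pow_bound_of_pow_bound (n := 1) (mul_pos hc' hc) (G := fun d => |D.gap x (t + d)|) ?_
    (C := C) ?_
  · have hd1 : ∀ᶠ d in 𝓝[>] (0 : ℝ), d < 1 / c := by
      filter_upwards [Ioo_mem_nhdsGT (show (0 : ℝ) < 1 / c by positivity)] with d hd using hd.2
    filter_upwards [hgrow, htend.eventually hcmp, hd1, self_mem_nhdsWithin] with d h1 h2 h3 h4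
    have h4' : (0 : ℝ) < d := h4
    refine le_trans ?_ h2.2
    rw [pow_one, mul_assoc]
    refine mul_le_mul_of_nonneg_left (le_min (h1.trans (le_abs_self _)) ?_) hc'.le
    rw [lt_div_iff₀ hc] at h3
    linarith
  · filter_upwards [hC.filter_mono nhdsWithin_le_nhds, self_mem_nhdsWithin] with d h1 h2
    have h2' : (0 : ℝ) < d := h2
    rwa [abs_of_pos h2'] at h1

/-- On the real boundary line, `gap` vanishes at most to second order. -/
lemma not_cubic_bound_of_psi_eq_zero {x : ℝ} (h : D.psi x = 0) (hg : D.gap x 0 = 0) (C : ℝ) :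
    ¬ ∀ᶠ d in 𝓝 0, |D.gap (x + d) 0| ≤ C * |d| ^ 3 := by
  intro hC
  have hreg : D.Regular x 0 := h ▸ regular_psi x
  have hlr : D.logRatio x 0 = 0 := (gap_eq_zero_iff_of_regular hreg).1 hg
  obtain ⟨c, hc, hcmp⟩ := eventually_min_logRatio_le hreg
  have htend : Tendsto (fun d : ℝ => (x + d, (0 : ℝ))) (𝓝 0) (𝓝 (x, 0)) := by
    have : Continuous fun d : ℝ => (x + d, (0 : ℝ)) := by fun_prop
    simpa using this.tendsto 0
  have hcmp' := htend.eventually hcmp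
  obtain ⟨δ, hδ, hball⟩ := Metric.eventually_nhds_iff_ball.1 hcmp'
  -- Regularity on the whole δ-window keeps every uᵢ at distance at least δ, so the
  -- second-difference bound is available for all factors with the same d.
  have hu : ∀ i, δ ≤ |x - D.u i| := by
    intro i
    by_contra hcon
    have h1 := (hball (D.u i - x) (by simpa [abs_sub_comm] using hcon)).1.2
    have h2 := (stripProd_ne_zero_iff D.hu).1 h1 i
    apply h2
    rw [sub_zero, stripFactor_pi_eq_zero_iff]
    ring
  -- Since `logRatio` vanishes at x, the sum of its values at x ± d is a second difference. The
  -- linear term drops out, all factors contribute with the same sign, and one of them provides the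
  -- constant.
  have hsecond : ∃ b > 0, ∀ d, |d| < δ → |d| ≤ 1 →
      D.logRatio (x + d) 0 + D.logRatio (x - d) 0 ≤ -(b * d ^ 2) := by
    have hA : ∀ d, |d| < δ → ∀ i, Real.log ‖stripFactor (x + d - D.u i) Real.pi‖ +
        Real.log ‖stripFactor (x - d - D.u i) Real.pi‖
        - 2 * Real.log ‖stripFactor (x - D.u i) Real.pi‖ ≤
        -(Real.exp (x - D.u i) / (1 - Real.exp (x - D.u i)) ^ 2 * d ^ 2) := by
      intro d hd i
      have := second_difference_stripFactor_pi (y := x - D.u i) (d := d) (hd.trans_le (hu i))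
      rwa [sub_add_eq_add_sub, sub_right_comm] at this
    have hB : ∀ d, |d| ≤ 1 → ∀ i, Real.exp (x - D.v i) / (1 + Real.exp (x - D.v i + 1)) ^ 2 * d ^ 2
        ≤ Real.log ‖stripFactor (x + d - D.v i) 0‖ + Real.log ‖stripFactor (x - d - D.v i) 0‖
        - 2 * Real.log ‖stripFactor (x - D.v i) 0‖ := by
      intro d hd i
      have := second_difference_stripFactor_zero (y := x - D.v i) (d := d) hd
      rwa [sub_add_eq_add_sub (x) (D.v i) d, sub_right_comm x (D.v i) d] at this
    have hSA : ∀ d, stripLog D.u (x + d) Real.pi + stripLog D.u (x - d) Real.pi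
        - 2 * stripLog D.u x Real.pi = ∑' i, (Real.log ‖stripFactor (x + d - D.u i) Real.pi‖ +
        Real.log ‖stripFactor (x - d - D.u i) Real.pi‖
        - 2 * Real.log ‖stripFactor (x - D.u i) Real.pi‖) := by
      intro d
      rw [((summable_stripLog D.hu _ _).add (summable_stripLog D.hu _ _)).tsum_sub
        ((summable_stripLog D.hu _ _).mul_left 2), tsum_mul_left,
        (summable_stripLog D.hu _ _).tsum_add (summable_stripLog D.hu _ _)]
      rfl
    have hSB : ∀ d, stripLog D.v (x + d) 0 + stripLog D.v (x - d) 0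
        - 2 * stripLog D.v x 0 = ∑' i, (Real.log ‖stripFactor (x + d - D.v i) 0‖ +
        Real.log ‖stripFactor (x - d - D.v i) 0‖
        - 2 * Real.log ‖stripFactor (x - D.v i) 0‖) := by
      intro d
      rw [((summable_stripLog D.hv _ _).add (summable_stripLog D.hv _ _)).tsum_sub
        ((summable_stripLog D.hv _ _).mul_left 2), tsum_mul_left,
        (summable_stripLog D.hv _ _).tsum_add (summable_stripLog D.hv _ _)]
      rfl
    have hlrd : ∀ d, D.logRatio (x + d) 0 + D.logRatio (x - d) 0 =
        (stripLog D.u (x + d) Real.pi + stripLog D.u (x - d) Real.pi - 2 * stripLog D.u x Real.pi)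
        - (stripLog D.v (x + d) 0 + stripLog D.v (x - d) 0 - 2 * stripLog D.v x 0) := by
      intro d
      unfold logRatio at hlr ⊢
      rw [sub_zero] at hlr ⊢
      linear_combination 2 * hlr
    have hneg : ∀ d, |d| < δ → ∀ i, Real.log ‖stripFactor (x + d - D.u i) Real.pi‖ +
        Real.log ‖stripFactor (x - d - D.u i) Real.pi‖
        - 2 * Real.log ‖stripFactor (x - D.u i) Real.pi‖ ≤ 0 := fun d hd i =>
      (hA d hd i).trans (neg_nonpos.2 (by positivity))
    have hpos : ∀ d, |d| ≤ 1 → ∀ i, 0 ≤ Real.log ‖stripFactor (x + d - D.v i) 0‖ +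
        Real.log ‖stripFactor (x - d - D.v i) 0‖
        - 2 * Real.log ‖stripFactor (x - D.v i) 0‖ := fun d hd i =>
      le_trans (by positivity) (hB d hd i)
    rcases D.ne with ⟨⟨i⟩⟩ | ⟨⟨i⟩⟩
    · have hne : 1 - Real.exp (x - D.u i) ≠ 0 := by
        intro h
        have h1 : x - D.u i = 0 := (Real.exp_eq_one_iff _).1 (by linarith)
        have := hu i
        rw [h1, abs_zero] at this
        linarith
      refine ⟨Real.exp (x - D.u i) / (1 - Real.exp (x - D.u i)) ^ 2, by positivity,
        fun d hd hd1 => ?_⟩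
      rw [hlrd, hSA, hSB]
      have e1 := Summable.sum_le_tsum {i} (f := fun l =>
        -(Real.log ‖stripFactor (x + d - D.u l) Real.pi‖ +
        Real.log ‖stripFactor (x - d - D.u l) Real.pi‖
        - 2 * Real.log ‖stripFactor (x - D.u l) Real.pi‖)) (fun l _ => neg_nonneg.2 (hneg d hd l))
        (((summable_stripLog D.hu _ _).add (summable_stripLog D.hu _ _)).sub
          ((summable_stripLog D.hu _ _).mul_left 2)).neg
      rw [tsum_neg, Finset.sum_singleton] at e1
      have e2 := tsum_nonneg (L := .unconditional _) (hpos d hd1)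
      have e3 := hA d hd i
      linarith
    · refine ⟨Real.exp (x - D.v i) / (1 + Real.exp (x - D.v i + 1)) ^ 2, by positivity,
        fun d hd hd1 => ?_⟩
      rw [hlrd, hSA, hSB]
      have e1 := (((summable_stripLog D.hv (x + d) 0).add (summable_stripLog D.hv (x - d) 0)).sub
          ((summable_stripLog D.hv x 0).mul_left 2)).le_tsum i fun l _ => hpos d hd1 l
      have e2 := tsum_nonpos (L := .unconditional _) (hneg d hd)
      have e3 := hB d hd1 i
      linarith
  obtain ⟨b, hb, hsec⟩ := hsecond
  refine not_pow_bound_of_pow_bound (n := 2) (mul_pos hc hb)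
    (G := fun d => |D.gap (x + d) 0| + |D.gap (x - d) 0|) ?_ (C := 2 * C) ?_
  · have hd1 : ∀ᶠ d in 𝓝[>] (0 : ℝ), d < min (min δ 1) (1 / b) := by
      filter_upwards [Ioo_mem_nhdsGT (show (0 : ℝ) < min (min δ 1) (1 / b) by positivity)]
        with d hd using hd.2
    filter_upwards [hd1, self_mem_nhdsWithin] with d h1 h2
    have h2' : (0 : ℝ) < d := h2
    have hdδ : d < δ := h1.trans_le ((min_le_left _ _).trans (min_le_left _ _))
    have hd1' : d < 1 := h1.trans_le ((min_le_left _ _).trans (min_le_right _ _))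
    have hdb : d * b < 1 := (lt_div_iff₀ hb).1 (h1.trans_le (min_le_right _ _))
    have g1 := (hball d (by simpa [abs_of_pos h2'] using hdδ)).2
    have g2 := (hball (-d) (by simpa [abs_of_pos h2'] using hdδ)).2
    rw [← sub_eq_add_neg] at g2
    have g3 := hsec d (by rwa [abs_of_pos h2']) (by rw [abs_of_pos h2']; exact hd1'.le)
    refine le_trans ?_ (add_le_add g1 g2)
    rw [← mul_add, mul_assoc]
    refine mul_le_mul_of_nonneg_left ?_ hc.le
    simp only
    have q1 := neg_abs_le (D.logRatio (x + d) 0)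
    have q2 := neg_abs_le (D.logRatio (x - d) 0)
    have q3 : b * d ^ 2 ≤ 1 := by nlinarith
    have q4 : 0 ≤ min |D.logRatio (x + d) 0| 1 := le_min (abs_nonneg _) zero_le_one
    have q5 : 0 ≤ min |D.logRatio (x - d) 0| 1 := le_min (abs_nonneg _) zero_le_one
    rcases min_cases |D.logRatio (x + d) 0| 1 with h | h <;>
    rcases min_cases |D.logRatio (x - d) 0| 1 with h' | h' <;> linarith
  · filter_upwards [hC.filter_mono nhdsWithin_le_nhds, eventually_neg_nhdsGT hC,
      self_mem_nhdsWithin] with d h1 h2 h3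
    have h3' : (0 : ℝ) < d := h3
    rw [abs_of_pos h3'] at h1
    rw [abs_neg, abs_of_pos h3', ← sub_eq_add_neg] at h2
    exact (add_le_add h1 h2).trans_eq (by ring)

lemma alpha_eq_of_psi_eq_zero {x : ℝ} (h : D.psi x = 0) : D.alpha x = -stripArg D.u x Real.pi := by
  rw [alpha, h, phase_zero]

lemma regular_of_alpha_eq {x₁ x₂ : ℝ} (h₁ : D.psi x₁ = 0) (h₂ : D.psi x₂ = 0)
    (h : D.alpha x₁ = D.alpha x₂) (i : D.ι) : D.u i ∉ Set.Icc x₁ x₂ := by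
  have n₁ := (regular_psi (D := D) x₁).2
  have n₂ := (regular_psi (D := D) x₂).2
  rw [h₁, sub_zero] at n₁
  rw [h₂, sub_zero] at n₂
  rw [alpha_eq_of_psi_eq_zero h₁, alpha_eq_of_psi_eq_zero h₂] at h
  exact notMem_Icc_of_stripArg_pi_eq D.hu n₁ n₂ (neg_injective h) i

/-- Equal values of `alpha` leave no uᵢ between x₁ and x₂, so each log |1 - exp (x - uᵢ)| is concave
there; -log (1 + exp (x - vᵢ)) is concave everywhere and the remaining terms are affine. -/
lemma strictConcaveOn_logRatio {x₁ x₂ : ℝ} (h₁ : D.psi x₁ = 0) (h₂ : D.psi x₂ = 0)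
    (h : D.alpha x₁ = D.alpha x₂) :
    StrictConcaveOn ℝ (Set.Icc x₁ x₂) fun x => D.logRatio x 0 := by
  have hcv : Convex ℝ (Set.Icc x₁ x₂) := convex_Icc x₁ x₂
  have hshift : ∀ (f : ℝ → ℝ) (a : ℝ), StrictConcaveOn ℝ (Set.Icc (x₁ - a) (x₂ - a)) f →
      StrictConcaveOn ℝ (Set.Icc x₁ x₂) fun x => f (x - a) := by
    intro f a hf
    refine ⟨hcv, fun y hy z hz hyz p q hp hq hpq => ?_⟩
    have hy' : y - a ∈ Set.Icc (x₁ - a) (x₂ - a) := ⟨by linarith [hy.1], by linarith [hy.2]⟩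
    have hz' : z - a ∈ Set.Icc (x₁ - a) (x₂ - a) := ⟨by linarith [hz.1], by linarith [hz.2]⟩
    have := hf.2 hy' hz' (fun h => hyz (by linarith)) hp hq hpq
    simp only [smul_eq_mul] at this ⊢
    rwa [show p * (y - a) + q * (z - a) = p * y + q * z - a by
      linear_combination (-a) * hpq] at this
  have hA : ∀ i, StrictConcaveOn ℝ (Set.Icc x₁ x₂)
      fun x => Real.log ‖stripFactor (x - D.u i) Real.pi‖ := fun i =>
    hshift (fun x => Real.log ‖stripFactor x Real.pi‖) (D.u i) <|
      strictConcaveOn_log_norm_stripFactor_pi _ (convex_Icc _ _) fun h0 =>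
        regular_of_alpha_eq h₁ h₂ h i ⟨by linarith [h0.1], by linarith [h0.2]⟩
  have hB : ∀ i, StrictConcaveOn ℝ (Set.Icc x₁ x₂)
      fun x => -Real.log ‖stripFactor (x - D.v i) 0‖ := fun i =>
    hshift (fun x => -Real.log ‖stripFactor x 0‖) (D.v i) <|
      (strictConvexOn_log_norm_stripFactor_zero _ (convex_Icc _ _)).neg
  have hlin : ConcaveOn ℝ (Set.Icc x₁ x₂) fun x => D.m / 2 * x - D.k := by
    refine ⟨hcv, fun y _ z _ p q _ _ hpq => le_of_eq ?_⟩
    simp only [smul_eq_mul]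
    linear_combination (-D.k) * hpq
  have heq : (fun x => D.logRatio x 0) = ((fun x => D.m / 2 * x - D.k) +
      fun x => ∑' i, Real.log ‖stripFactor (x - D.u i) Real.pi‖) +
      fun x => ∑' i, -Real.log ‖stripFactor (x - D.v i) 0‖ := by
    funext x
    simp only [logRatio, stripLog, Pi.add_apply, tsum_neg, sub_zero]
    ring
  rw [heq]
  have sA := fun x => summable_stripLog D.hu x Real.pi
  have sB := fun x => (summable_stripLog D.hv x 0).neg
  rcases D.ne with hne | hne
  · exact (hlin.add_strictConcaveOn (strictConcaveOn_tsum hcv hA sA)).add_concaveOn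
      (concaveOn_tsum hcv (fun i => (hB i).concaveOn) sB)
  · exact (hlin.add (concaveOn_tsum hcv (fun i => (hA i).concaveOn) sA)).add_strictConcaveOn
      (strictConcaveOn_tsum hcv hB sB)

lemma logRatio_lower_bound {x₁ x₂ x : ℝ} (h₁ : D.psi x₁ = 0) (h₂ : D.psi x₂ = 0)
    (h : D.alpha x₁ = D.alpha x₂) (hx : x ∈ Set.Ioo x₁ x₂) : 0 < D.logRatio x 0 := by
  have hlt := hx.1.trans hx.2
  have l1 := logRatio_psi_nonneg (D := D) (x := x₁) (h₁ ▸ Real.pi_pos)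
  have l2 := logRatio_psi_nonneg (D := D) (x := x₂) (h₂ ▸ Real.pi_pos)
  rw [h₁] at l1
  rw [h₂] at l2
  have := (strictConcaveOn_logRatio h₁ h₂ h).lt_on_openSegment (Set.left_mem_Icc.2 hlt.le)
    (Set.right_mem_Icc.2 hlt.le) hlt.ne (by rwa [openSegment_eq_Ioo hlt])
  exact (le_min l1 l2).trans_lt this

lemma gap_zero_ne_zero_of_mem_Ioo {x₁ x₂ x : ℝ} (h₁ : D.psi x₁ = 0) (h₂ : D.psi x₂ = 0)
    (h : D.alpha x₁ = D.alpha x₂) (hx : x ∈ Set.Ioo x₁ x₂) : D.gap x 0 ≠ 0 := by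
  have hreg : D.Regular x 0 := by
    refine ⟨stripProd_ne_zero_of_lt D.hv le_rfl Real.pi_pos, ?_⟩
    rw [sub_zero, stripProd_ne_zero_iff D.hu]
    intro i hi
    rw [stripFactor_pi_eq_zero_iff, sub_eq_zero] at hi
    exact regular_of_alpha_eq h₁ h₂ h i (hi ▸ ⟨hx.1.le, hx.2.le⟩)
  rw [Ne, gap_eq_zero_iff_of_regular hreg]
  exact (logRatio_lower_bound h₁ h₂ h hx).ne'

/-- If the level set stays on the real boundary line on one side of a zero of `gap`, then the zero
is simple. -/
lemma not_quadratic_bound_of_psi_eq_zero {x y : ℝ} (hx : D.psi x = 0) (hg : D.gap x 0 = 0)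
    (hy : D.psi y = 0) (hne : y ≠ x) (h : D.alpha y = D.alpha x) (C : ℝ) :
    ¬ ∀ᶠ d in 𝓝 0, |D.gap (x + d) 0| ≤ C * |d| ^ 2 := by
  intro hC
  have hreg : D.Regular x 0 := hx ▸ regular_psi x
  have hlr : D.logRatio x 0 = 0 := (gap_eq_zero_iff_of_regular hreg).1 hg
  obtain ⟨c, hc, hcmp⟩ := eventually_min_logRatio_le hreg
  set r := (y - x) / 2 with hr
  have hr0 : r ≠ 0 := by
    rw [hr]
    exact div_ne_zero (sub_ne_zero.2 hne) two_ne_zero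
  have hmid : x + r ∈ Set.Ioo (min x y) (max x y) := by
    rw [hr]
    rcases lt_or_gt_of_ne hne with h | h
    · rw [min_eq_right h.le, max_eq_left h.le]; constructor <;> linarith
    · rw [min_eq_left h.le, max_eq_right h.le]; constructor <;> linarith
  have hconc : StrictConcaveOn ℝ (Set.Icc (min x y) (max x y)) fun x => D.logRatio x 0 := by
    rcases le_total x y with hxy | hxy
    · rw [min_eq_left hxy, max_eq_right hxy]; exact strictConcaveOn_logRatio hx hy h.symm
    · rw [min_eq_right hxy, max_eq_left hxy]; exact strictConcaveOn_logRatio hy hx h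
  have hpos : 0 < D.logRatio (x + r) 0 := by
    rcases le_total x y with hxy | hxy
    · rw [min_eq_left hxy, max_eq_right hxy] at hmid
      exact logRatio_lower_bound hx hy h.symm hmid
    · rw [min_eq_right hxy, max_eq_left hxy] at hmid
      exact logRatio_lower_bound hy hx h hmid
  set L := D.logRatio (x + r) 0 with hL
  -- The graph lies above the chord from the value 0 at x to the value L at the midpoint, which
  -- gives linear growth on the side of y.
  have hlow : ∀ s ∈ Set.Icc (0 : ℝ) 1, s * L ≤ D.logRatio (x + s * r) 0 := by
    rintro s ⟨hs0, hs1⟩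
    have hx' : x ∈ Set.Icc (min x y) (max x y) := ⟨min_le_left _ _, le_max_left _ _⟩
    have := hconc.concaveOn.2 hx' (Set.Ioo_subset_Icc_self hmid) (sub_nonneg.2 hs1) hs0
      (sub_add_cancel 1 s)
    simp only [smul_eq_mul, hlr, mul_zero, zero_add] at this
    rwa [show (1 - s) * x + s * (x + r) = x + s * r by ring] at this
  have htend : Tendsto (fun s : ℝ => (x + s * r, (0 : ℝ))) (𝓝[>] 0) (𝓝 (x, 0)) := by
    have : Continuous fun s : ℝ => (x + s * r, (0 : ℝ)) := by fun_prop
    simpa using (this.tendsto 0).mono_left (nhdsWithin_le_nhds (s := Set.Ioi 0))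
  have htend' : Tendsto (fun s : ℝ => s * r) (𝓝[>] 0) (𝓝 0) := by
    have : Continuous fun s : ℝ => s * r := by fun_prop
    simpa using (this.tendsto 0).mono_left (nhdsWithin_le_nhds (s := Set.Ioi 0))
  refine not_pow_bound_of_pow_bound (n := 1) (mul_pos hc hpos)
    (G := fun s => |D.gap (x + s * r) 0|) ?_ (C := C * r ^ 2) ?_
  · have hd1 : ∀ᶠ d in 𝓝[>] (0 : ℝ), d < min 1 (1 / L) := by
      filter_upwards [Ioo_mem_nhdsGT (show (0 : ℝ) < min 1 (1 / L) by positivity)] with d hd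
        using hd.2
    filter_upwards [htend.eventually hcmp, hd1, self_mem_nhdsWithin] with s h1 h2 h3
    have h3' : (0 : ℝ) < s := h3
    have h4 := hlow s ⟨h3'.le, (h2.trans_le (min_le_left _ _)).le⟩
    have h5 := (lt_div_iff₀ hpos).1 (h2.trans_le (min_le_right _ _))
    refine le_trans ?_ h1.2
    rw [pow_one, mul_assoc, mul_comm L]
    exact mul_le_mul_of_nonneg_left (le_min (h4.trans (le_abs_self _)) h5.le) hc.le
  · filter_upwards [htend'.eventually hC] with s h1
    rw [sq_abs] at h1
    exact h1.trans_eq (by ring)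

/-- If the level set meets the real boundary line in an isolated point, then `gap` does not change
sign there. -/
lemma eventually_gap_zero_nonneg {x : ℝ} (hx : D.psi x = 0) (hg : D.gap x 0 = 0)
    (h : ∀ y, D.alpha y = D.alpha x → y = x) : ∀ᶠ y in 𝓝 x, 0 ≤ D.gap y 0 := by
  filter_upwards [(continuous_alpha (D := D)).continuousAt.eventually
    (Metric.ball_mem_nhds (D.alpha x) Real.pi_pos)] with y hy
  rcases (psi_nonneg (D := D) y).eq_or_lt with h0 | h0
  · rw [h y (eq_of_dist_lt_pi (exists_alpha_eq_of_psi_eq_zero h0.symm)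
      (exists_alpha_eq_of_psi_eq_zero hx) hy), hg]
  · exact (gap_pos_of_lt_psi le_rfl h0).le

end StripData

/-! ### Both boundary lines treated together by reflection -/

namespace StripData

variable {D : StripData}

lemma reflect_pow_bound {x C : ℝ} {n : ℕ}
    (h : ∀ᶠ d in 𝓝 0, |D.gap (x + d) Real.pi| ≤ C * |d| ^ n) :
    ∃ C', ∀ᶠ d in 𝓝 0, |D.reflect.gap (x + d) 0| ≤ C' * |d| ^ n := by
  set e : ℝ → ℝ := fun d => Real.exp (-D.k - D.m / 2 * (x + d)) with he
  have hec : Continuous e := by rw [he]; fun_prop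
  refine ⟨(e 0 + 1) * C, ?_⟩
  filter_upwards [h, hec.continuousAt.eventually (gt_mem_nhds (lt_add_one (e 0)))] with d h1 h2
  have h3 := gap_reflect (D := D) (x + d) Real.pi
  rw [sub_self] at h3
  rw [h3, abs_neg, abs_mul, abs_of_pos (Real.exp_pos _), mul_assoc]
  exact mul_le_mul h2.le h1 (abs_nonneg _) (by positivity)

lemma gap_reflect_zero (x : ℝ) :
    D.reflect.gap x 0 = -(Real.exp (-D.k - D.m / 2 * x) * D.gap x Real.pi) := by
  simpa using gap_reflect (D := D) x Real.pi

lemma psi_reflect_eq_zero {x : ℝ} (h : D.psi x = Real.pi) : D.reflect.psi x = 0 := by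
  rw [psi_reflect, h, sub_self]

lemma alpha_reflect_eq {x y : ℝ} : D.reflect.alpha y = D.reflect.alpha x ↔ D.alpha y = D.alpha x := by
  rw [alpha_reflect, alpha_reflect, sub_left_inj]

lemma not_cubic_bound_of_boundary {x t : ℝ} (ht : t = 0 ∨ t = Real.pi) (h : D.psi x = t)
    (hg : D.gap x t = 0) (C : ℝ) : ¬ ∀ᶠ d in 𝓝 0, |D.gap (x + d) t| ≤ C * |d| ^ 3 := by
  rcases ht with rfl | rfl
  · exact not_cubic_bound_of_psi_eq_zero h hg C
  · intro hC
    obtain ⟨C', hC'⟩ := reflect_pow_bound hC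
    exact not_cubic_bound_of_psi_eq_zero (psi_reflect_eq_zero h)
      (by rw [gap_reflect_zero, hg, mul_zero, neg_zero]) C' hC'

lemma not_quadratic_bound_of_boundary {x y t : ℝ} (ht : t = 0 ∨ t = Real.pi) (hx : D.psi x = t)
    (hg : D.gap x t = 0) (hne : y ≠ x) (h : D.alpha y = D.alpha x) (C : ℝ) :
    ¬ ∀ᶠ d in 𝓝 0, |D.gap (x + d) t| ≤ C * |d| ^ 2 := by
  have hy : D.psi y = t := by
    rcases psi_of_alpha_eq hne h with h' | h' <;> rw [h'.1, ← hx, h'.2]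
  rcases ht with rfl | rfl
  · exact not_quadratic_bound_of_psi_eq_zero hx hg hy hne h C
  · intro hC
    obtain ⟨C', hC'⟩ := reflect_pow_bound hC
    exact not_quadratic_bound_of_psi_eq_zero (psi_reflect_eq_zero hx)
      (by rw [gap_reflect_zero, hg, mul_zero, neg_zero]) (psi_reflect_eq_zero hy) hne
      (alpha_reflect_eq.2 h) C' hC'

/-- The level curve can touch a plateau of `alpha` only at its ends: `logRatio` on ψ = 0 is strictly
concave and nonnegative at the ends, hence positive inside; ψ = π follows by reflection. -/
lemma gap_ne_zero_of_mem_Ioo {x₁ x₂ x : ℝ} (h₁ : D.alpha x₁ = D.alpha x)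
    (h₂ : D.alpha x₂ = D.alpha x) (hx : x ∈ Set.Ioo x₁ x₂) : D.gap x (D.psi x) ≠ 0 := by
  rcases psi_of_alpha_eq hx.1.ne h₁ with h | h <;> rcases psi_of_alpha_eq hx.2.ne h₂.symm with h' | h'
  · rw [h.2]
    exact gap_zero_ne_zero_of_mem_Ioo h.1 h'.2 (h₁.trans h₂.symm) hx
  · exact absurd (h.2.symm.trans h'.1) Real.pi_pos.ne
  · exact absurd (h'.1.symm.trans h.2) Real.pi_pos.ne
  · have := gap_zero_ne_zero_of_mem_Ioo (D := D.reflect) (psi_reflect_eq_zero h.1)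
      (psi_reflect_eq_zero h'.2) (alpha_reflect_eq.2 (h₁.trans h₂.symm)) hx
    rw [h.2]
    intro h0
    rw [gap_reflect_zero, h0, mul_zero, neg_zero] at this
    exact this rfl

lemma gap_const_sign_of_boundary {x t : ℝ} (ht : t = 0 ∨ t = Real.pi) (hx : D.psi x = t)
    (hg : D.gap x t = 0) (h : ∀ y, D.alpha y = D.alpha x → y = x) :
    (∀ᶠ y in 𝓝 x, 0 ≤ D.gap y t) ∨ ∀ᶠ y in 𝓝 x, D.gap y t ≤ 0 := by
  rcases ht with rfl | rfl
  · exact Or.inl (eventually_gap_zero_nonneg hx hg h)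
  · right
    filter_upwards [eventually_gap_zero_nonneg (D := D.reflect) (psi_reflect_eq_zero hx)
      (by rw [gap_reflect_zero, hg, mul_zero, neg_zero]) fun y hy => h y (alpha_reflect_eq.1 hy)]
      with y hy
    rw [gap_reflect_zero] at hy
    by_contra hcon
    have := mul_pos (Real.exp_pos (-D.k - D.m / 2 * y)) (not_le.1 hcon)
    linarith

lemma eventually_stripArg_pi_eq {ι : Type} {u : ι → ℝ} (hu : Summable fun i => Real.exp (-u i))
    {x : ℝ} (h : stripProd u x Real.pi ≠ 0) :
    ∀ᶠ y in 𝓝 x, stripArg u y Real.pi = stripArg u x Real.pi := by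
  have hcont : Continuous fun y : ℝ => (y, Real.pi) := by fun_prop
  have hopen : IsOpen {y | stripProd u y Real.pi ≠ 0} :=
    isOpen_ne_fun ((continuous_stripProd hu).comp hcont) continuous_const
  have hmaps : Set.MapsTo (fun y : ℝ => (y, Real.pi)) {y | stripProd u y Real.pi ≠ 0}
      {p : ℝ × ℝ | p.2 ∈ Set.Icc 0 Real.pi ∧ stripProd u p.1 p.2 ≠ 0} :=
    fun y hy => ⟨Set.right_mem_Icc.2 Real.pi_pos.le, hy⟩
  have hon := (continuousOn_stripArg hu).comp hcont.continuousOn hmaps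
  have hat : ContinuousAt (fun y => stripArg u y Real.pi) x := hon.continuousAt (hopen.mem_nhds h)
  filter_upwards [hat.eventually (Metric.ball_mem_nhds _ Real.pi_pos)] with y hy
  exact eq_of_dist_lt_pi (exists_stripArg_pi_eq hu y) (exists_stripArg_pi_eq hu x) hy

lemma eventually_boundary_args_eq {x t : ℝ} (ht : t = 0 ∨ t = Real.pi) (h : D.Regular x t) :
    ∀ᶠ y in 𝓝 x, stripArg D.v y t = stripArg D.v x t ∧ D.phase y t = D.phase x t := by
  rcases ht with rfl | rfl
  · have h2 := h.2
    rw [sub_zero] at h2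
    filter_upwards [eventually_stripArg_pi_eq D.hu h2] with y hy
    exact ⟨by rw [stripArg_zero, stripArg_zero], by rw [phase_zero, phase_zero, hy]⟩
  · filter_upwards [eventually_stripArg_pi_eq D.hv h.1] with y hy
    exact ⟨hy, by rw [phase_pi, phase_pi, hy]⟩

/-! ### The function F in the coordinates of the four quadrants -/

/-- The point with coordinates `(x, ψ)` in the copy of the closed first quadrant that is given by
the signs `δ` and `τ`. -/
noncomputable def quadPoint (δ τ x ψ : ℝ) : ℂ := δ * Complex.exp ((x + τ * ψ * Complex.I) / 2)

/-- The function `f (w²) + w g (w²)`, for `f = f₀ ∏ (1 + w exp (-vᵢ))` and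
`g = -f₀ c exp (-k) w ^ j ∏ (1 - w exp (-uᵢ))`. -/
noncomputable def zeroFun (D : StripData) (j : ℕ) (f₀ c : ℂ) (w : ℂ) : ℂ :=
  f₀ * (genusProd D.v (w ^ 2) -
    c * Real.exp (-D.k) * (w * (w ^ 2) ^ j * genusProd D.u (-w ^ 2)))

lemma norm_quadPoint {δ : ℝ} (hδ : |δ| = 1) (τ x ψ : ℝ) :
    ‖quadPoint δ τ x ψ‖ = Real.exp (x / 2) := by
  rw [quadPoint, norm_mul, Complex.norm_real, Real.norm_eq_abs, hδ, one_mul, Complex.norm_exp]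
  simp

lemma quadPoint_sq {δ : ℝ} (hδ : |δ| = 1) (τ x ψ : ℝ) :
    quadPoint δ τ x ψ ^ 2 = Complex.exp (x + τ * ψ * Complex.I) := by
  rw [quadPoint, mul_pow, ← Complex.exp_nat_mul, ← Complex.ofReal_pow, ← sq_abs, hδ]
  simp only [one_pow, Complex.ofReal_one, one_mul]
  congr 1; push_cast; ring

lemma quadPoint_re {δ τ x ψ : ℝ} (hτ : τ = 1 ∨ τ = -1) :
    (quadPoint δ τ x ψ).re = δ * (Real.exp (x / 2) * Real.cos (ψ / 2)) := by
  rw [quadPoint, Complex.re_ofReal_mul, Complex.exp_re]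
  have h1 : ((x + τ * ψ * Complex.I) / 2).re = x / 2 := by simp
  have h2 : ((x + τ * ψ * Complex.I) / 2).im = τ * ψ / 2 := by simp
  rw [h1, h2]
  rcases hτ with rfl | rfl
  · rw [one_mul]
  · rw [neg_one_mul, neg_div, Real.cos_neg]

lemma quadPoint_im {δ τ x ψ : ℝ} (hτ : τ = 1 ∨ τ = -1) :
    (quadPoint δ τ x ψ).im = δ * τ * (Real.exp (x / 2) * Real.sin (ψ / 2)) := by
  rw [quadPoint, Complex.im_ofReal_mul, Complex.exp_im]
  have h1 : ((x + τ * ψ * Complex.I) / 2).re = x / 2 := by simp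
  have h2 : ((x + τ * ψ * Complex.I) / 2).im = τ * ψ / 2 := by simp
  rw [h1, h2]
  rcases hτ with rfl | rfl
  · rw [one_mul, mul_one]
  · rw [neg_one_mul, neg_div, Real.sin_neg]; ring

lemma exists_quadPoint {w : ℂ} (hw : w ≠ 0) : ∃ δ τ ψ : ℝ, (δ = 1 ∨ δ = -1) ∧ (τ = 1 ∨ τ = -1) ∧
    ψ ∈ Set.Icc 0 Real.pi ∧ w = quadPoint δ τ (2 * Real.log ‖w‖) ψ := by
  set w' : ℂ := ⟨|w.re|, |w.im|⟩ with hw'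
  have hnorm : ‖w'‖ = ‖w‖ := by
    rw [Complex.norm_def, Complex.norm_def, Complex.normSq_apply, Complex.normSq_apply]
    simp [hw', abs_mul_abs_self]
  have h1 : 0 ≤ w'.arg := Complex.arg_nonneg_iff.2 (abs_nonneg _)
  have h2 : w'.arg ≤ Real.pi / 2 := Complex.arg_le_pi_div_two_iff.2 (Or.inl (abs_nonneg _))
  have hn : 0 < ‖w‖ := norm_pos_iff.2 hw
  have hexp : Real.exp (2 * Real.log ‖w‖ / 2) = ‖w'‖ := by
    rw [mul_div_cancel_left₀ _ two_ne_zero, Real.exp_log hn, hnorm]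
  have hre : Real.exp (2 * Real.log ‖w‖ / 2) * Real.cos (2 * w'.arg / 2) = |w.re| := by
    rw [hexp, mul_div_cancel_left₀ _ two_ne_zero, Complex.norm_mul_cos_arg]
  have him : Real.exp (2 * Real.log ‖w‖ / 2) * Real.sin (2 * w'.arg / 2) = |w.im| := by
    rw [hexp, mul_div_cancel_left₀ _ two_ne_zero, Complex.norm_mul_sin_arg]
  have hψ : 2 * w'.arg ∈ Set.Icc 0 Real.pi := ⟨by linarith, by linarith⟩
  rcases le_total 0 w.re with hr | hr <;> rcases le_total 0 w.im with hi | hi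
  · refine ⟨1, 1, _, by simp, by simp, hψ, Complex.ext ?_ ?_⟩
    · rw [quadPoint_re (by simp), hre, abs_of_nonneg hr, one_mul]
    · rw [quadPoint_im (by simp), him, abs_of_nonneg hi, one_mul, one_mul]
  · refine ⟨1, -1, _, by simp, by simp, hψ, Complex.ext ?_ ?_⟩
    · rw [quadPoint_re (by simp), hre, abs_of_nonneg hr, one_mul]
    · rw [quadPoint_im (by simp), him, abs_of_nonpos hi]; ring
  · refine ⟨-1, -1, _, by simp, by simp, hψ, Complex.ext ?_ ?_⟩
    · rw [quadPoint_re (by simp), hre, abs_of_nonpos hr]; ring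
    · rw [quadPoint_im (by simp), him, abs_of_nonneg hi]; ring
  · refine ⟨-1, 1, _, by simp, by simp, hψ, Complex.ext ?_ ?_⟩
    · rw [quadPoint_re (by simp), hre, abs_of_nonpos hr]; ring
    · rw [quadPoint_im (by simp), him, abs_of_nonpos hi]; ring

lemma differentiable_zeroFun (D : StripData) (j : ℕ) (f₀ c : ℂ) :
    Differentiable ℂ (D.zeroFun j f₀ c) := by
  have h1 : Differentiable ℂ fun w : ℂ => genusProd D.v (w ^ 2) :=
    (differentiable_genusProd D.hv).comp (by fun_prop)
  have h2 : Differentiable ℂ fun w : ℂ => genusProd D.u (-w ^ 2) :=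
    (differentiable_genusProd D.hu).comp (by fun_prop)
  unfold zeroFun
  fun_prop

lemma conj_quadPoint (δ x ψ : ℝ) :
    quadPoint δ (-1) x ψ = (starRingEnd ℂ) (quadPoint δ 1 x ψ) := by
  rw [quadPoint, quadPoint, map_mul, Complex.conj_ofReal, ← Complex.exp_conj]
  simp [Complex.conj_ofNat]

lemma genusProd_v_quadPoint {δ τ : ℝ} (hδ : |δ| = 1) (hτ : τ = 1 ∨ τ = -1) (x ψ : ℝ) :
    genusProd D.v (quadPoint δ τ x ψ ^ 2) =
      ‖stripProd D.v x ψ‖ * Complex.exp (τ * stripArg D.v x ψ * Complex.I) := by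
  have h1 : genusProd D.v (quadPoint δ 1 x ψ ^ 2) = stripProd D.v x ψ := by
    rw [quadPoint_sq hδ, stripProd_eq]; simp
  rcases hτ with rfl | rfl
  · rw [h1]; simpa using stripProd_eq_norm_mul_exp D.hv x ψ
  · rw [conj_quadPoint, ← map_pow, genusProd_conj, h1]
    conv_lhs => rw [stripProd_eq_norm_mul_exp D.hv x ψ]
    rw [map_mul, Complex.conj_ofReal, ← Complex.exp_conj]
    simp

lemma genusProd_u_quadPoint {δ τ : ℝ} (hδ : |δ| = 1) (hτ : τ = 1 ∨ τ = -1) (x ψ : ℝ) :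
    genusProd D.u (-quadPoint δ τ x ψ ^ 2) = ‖stripProd D.u x (Real.pi - ψ)‖ *
      Complex.exp (-(τ * stripArg D.u x (Real.pi - ψ) * Complex.I)) := by
  have h1 : genusProd D.u (-quadPoint δ 1 x ψ ^ 2) =
      (starRingEnd ℂ) (stripProd D.u x (Real.pi - ψ)) := by
    rw [quadPoint_sq hδ, stripProd_eq, ← genusProd_conj, ← Complex.exp_conj]
    congr 1
    simp only [map_add, map_mul, Complex.conj_ofReal, Complex.conj_I, Complex.ofReal_sub,
      Complex.ofReal_one, map_sub]
    rw [show (x : ℂ) + (Real.pi - ψ) * -Complex.I = (x + 1 * ψ * Complex.I) - Real.pi * Complex.I by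
      ring, Complex.exp_sub, Complex.exp_pi_mul_I, div_neg, div_one]
  have h2 : (starRingEnd ℂ) (stripProd D.u x (Real.pi - ψ)) = ‖stripProd D.u x (Real.pi - ψ)‖ *
      Complex.exp (-(stripArg D.u x (Real.pi - ψ) * Complex.I)) := by
    conv_lhs => rw [stripProd_eq_norm_mul_exp D.hu x (Real.pi - ψ)]
    rw [map_mul, Complex.conj_ofReal, ← Complex.exp_conj]
    simp
  rcases hτ with rfl | rfl
  · rw [h1, h2]; simp
  · rw [conj_quadPoint, ← map_pow, ← map_neg, genusProd_conj, h1, h2, map_mul,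
      Complex.conj_ofReal, ← Complex.exp_conj]
    simp

lemma quadPoint_mul_pow {δ : ℝ} (hδ : |δ| = 1) (τ x ψ : ℝ) {j : ℕ} (hm : D.m = 2 * j + 1) :
    quadPoint δ τ x ψ * (quadPoint δ τ x ψ ^ 2) ^ j = δ * Real.exp (D.m / 2 * x) *
      Complex.exp (τ * (D.m / 2 * ψ) * Complex.I) := by
  rw [quadPoint_sq hδ, quadPoint, ← Complex.exp_nat_mul, mul_assoc (δ : ℂ), ← Complex.exp_add,
    mul_assoc (δ : ℂ), Complex.ofReal_exp, ← Complex.exp_add, hm]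
  congr 2; push_cast; ring

/-- Up to a nonvanishing factor, F is a nonnegative number minus c δ times a unimodular number times
another nonnegative number; modulus and phase conditions thus separate. -/
lemma zeroFun_quadPoint {δ τ : ℝ} (hδ : |δ| = 1) (hτ : τ = 1 ∨ τ = -1) (x ψ : ℝ) {j : ℕ}
    (hm : D.m = 2 * j + 1) (f₀ c : ℂ) :
    D.zeroFun j f₀ c (quadPoint δ τ x ψ) =
      f₀ * Real.exp (-D.k) * Complex.exp (τ * stripArg D.v x ψ * Complex.I) *
        ((Real.exp D.k * ‖stripProd D.v x ψ‖ : ℝ) -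
          c * δ * Complex.exp (τ * D.phase x ψ * Complex.I) *
          (Real.exp (D.m / 2 * x) * ‖stripProd D.u x (Real.pi - ψ)‖ : ℝ)) := by
  rw [zeroFun, genusProd_v_quadPoint hδ hτ, genusProd_u_quadPoint hδ hτ, quadPoint_mul_pow hδ _ _ _ hm]
  have e1 : Complex.exp (τ * D.phase x ψ * Complex.I) =
      Complex.exp (τ * (D.m / 2 * ψ) * Complex.I) *
      Complex.exp (-(τ * stripArg D.u x (Real.pi - ψ) * Complex.I)) *
      (Complex.exp (τ * stripArg D.v x ψ * Complex.I))⁻¹ := by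
    rw [← Complex.exp_neg, ← Complex.exp_add, ← Complex.exp_add, phase]
    congr 1; push_cast; ring
  have e2 : (Real.exp (-D.k) : ℂ) * Real.exp D.k = 1 := by
    rw [← Complex.ofReal_mul, ← Real.exp_add]; simp
  rw [e1]
  have e3 := Complex.exp_ne_zero (τ * stripArg D.v x ψ * Complex.I)
  push_cast at e2 ⊢
  field_simp
  linear_combination (-f₀ * (‖stripProd D.v x ψ‖ : ℂ) *
    Complex.exp (τ * stripArg D.v x ψ * Complex.I)) * e2

/-! ### Zeros of F and their multiplicities -/

section zeros

variable {j : ℕ} {f₀ c : ℂ}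

/-- The reverse triangle inequality discards the phase; this transfers orders of vanishing from F to
the real function `gap`. -/
lemma gap_le_norm_zeroFun {δ τ : ℝ} (hδ : |δ| = 1) (hτ : τ = 1 ∨ τ = -1) (x ψ : ℝ)
    (hm : D.m = 2 * j + 1) (hc : ‖c‖ = 1) :
    ‖f₀‖ * Real.exp (-D.k) * |D.gap x ψ| ≤ ‖D.zeroFun j f₀ c (quadPoint δ τ x ψ)‖ := by
  have hphase : ∀ s : ℝ, ‖Complex.exp (τ * s * Complex.I)‖ = 1 := fun s => by
    rw [← Complex.ofReal_mul, Complex.norm_exp_ofReal_mul_I]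
  rw [zeroFun_quadPoint hδ hτ x ψ hm, norm_mul, norm_mul, norm_mul, hphase, mul_one,
    Complex.norm_real, Real.norm_of_nonneg (Real.exp_pos _).le]
  refine mul_le_mul_of_nonneg_left ?_ (by positivity)
  refine le_trans (le_of_eq ?_) (abs_norm_sub_norm_le _ _)
  rw [norm_mul, norm_mul, norm_mul, hphase, hc, Complex.norm_real, Complex.norm_real,
    Complex.norm_real, Real.norm_eq_abs δ, hδ, Real.norm_of_nonneg (by positivity),
    Real.norm_of_nonneg (by positivity)]
  simp [gap]

lemma zeroFun_quadPoint_eq_zero_iff {δ τ : ℝ} (hδ : |δ| = 1) (hτ : τ = 1 ∨ τ = -1) {x ψ : ℝ}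
    (hψ : ψ ∈ Set.Icc 0 Real.pi) (hm : D.m = 2 * j + 1) (hf₀ : f₀ ≠ 0) (hc : ‖c‖ = 1) :
    D.zeroFun j f₀ c (quadPoint δ τ x ψ) = 0 ↔
      D.gap x ψ = 0 ∧ c * δ * Complex.exp (τ * D.phase x ψ * Complex.I) = 1 := by
  have hval := zeroFun_quadPoint (D := D) hδ hτ x ψ hm f₀ c
  constructor
  · intro h
    have hgap : D.gap x ψ = 0 := by
      have h1 := gap_le_norm_zeroFun (D := D) (f₀ := f₀) hδ hτ x ψ hm hc
      rw [h, norm_zero] at h1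
      have h2 : 0 < ‖f₀‖ * Real.exp (-D.k) := mul_pos (norm_pos_iff.2 hf₀) (Real.exp_pos _)
      have h3 : |D.gap x ψ| ≤ 0 := nonpos_of_mul_nonpos_right h1 h2
      exact abs_nonpos_iff.1 h3
    refine ⟨hgap, ?_⟩
    have hψ' := psi_eq_of_gap_eq_zero hψ hgap
    have hreg : D.Regular x ψ := hψ' ▸ regular_psi x
    rw [h] at hval
    have h0 := (mul_eq_zero.1 hval.symm).resolve_left
      (mul_ne_zero (mul_ne_zero hf₀ (by exact_mod_cast (Real.exp_pos _).ne')) (Complex.exp_ne_zero _))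
    rw [gap, sub_eq_zero] at hgap
    rw [← hgap] at h0
    have ha : ((Real.exp D.k * ‖stripProd D.v x ψ‖ : ℝ) : ℂ) ≠ 0 := by
      have := norm_pos_iff.2 hreg.1
      exact_mod_cast (by positivity : Real.exp D.k * ‖stripProd D.v x ψ‖ ≠ 0)
    exact mul_right_cancel₀ ha (by rw [one_mul]; exact (sub_eq_zero.1 h0).symm)
  · rintro ⟨h1, h2⟩
    rw [hval, h2, one_mul, ← Complex.ofReal_sub]
    change _ * ((D.gap x ψ : ℝ) : ℂ) = 0
    rw [h1, Complex.ofReal_zero, mul_zero]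

lemma zeroFun_zero : D.zeroFun j f₀ c 0 = f₀ := by
  simp [zeroFun, genusProd]

lemma exists_quadPoint_of_zeroFun_eq_zero (hm : D.m = 2 * j + 1) (hf₀ : f₀ ≠ 0) (hc : ‖c‖ = 1)
    {w : ℂ} (hw : D.zeroFun j f₀ c w = 0) : ∃ δ τ x : ℝ, (δ = 1 ∨ δ = -1) ∧ (τ = 1 ∨ τ = -1) ∧
      w = quadPoint δ τ x (D.psi x) ∧ D.gap x (D.psi x) = 0 ∧
      c * δ * Complex.exp (τ * D.alpha x * Complex.I) = 1 := by
  have hw0 : w ≠ 0 := by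
    rintro rfl
    rw [zeroFun_zero] at hw
    exact hf₀ hw
  obtain ⟨δ, τ, ψ, hδ, hτ, hψ, h⟩ := exists_quadPoint hw0
  have hδ' : |δ| = 1 := by rcases hδ with rfl | rfl <;> simp
  rw [h] at hw
  obtain ⟨h1, h2⟩ := (zeroFun_quadPoint_eq_zero_iff hδ' hτ hψ hm hf₀ hc).1 hw
  have hψ' := psi_eq_of_gap_eq_zero hψ h1
  refine ⟨δ, τ, 2 * Real.log ‖w‖, hδ, hτ, ?_, ?_, ?_⟩
  · rw [hψ', ← h]
  · rw [hψ', h1]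
  · rw [alpha, hψ', h2]

lemma analyticAt_zeroFun (w : ℂ) : AnalyticAt ℂ (D.zeroFun j f₀ c) w :=
  (differentiable_zeroFun D j f₀ c).analyticAt w

/-- A zero of order at least `n` forces `gap` to vanish to order `n` along lines. -/
lemma gap_pow_bound_of_le_order {δ τ : ℝ} (hδ : |δ| = 1) (hτ : τ = 1 ∨ τ = -1) (x ψ a b : ℝ)
    (hm : D.m = 2 * j + 1) (hf₀ : f₀ ≠ 0) (hc : ‖c‖ = 1) {n : ℕ}
    (hn : (n : ℕ∞) ≤ analyticOrderAt (D.zeroFun j f₀ c) (quadPoint δ τ x ψ)) :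
    ∃ C, ∀ᶠ d in 𝓝 (0 : ℝ), |D.gap (x + a * d) (ψ + b * d)| ≤ C * |d| ^ n := by
  obtain ⟨g, hg, hgF⟩ := (natCast_le_analyticOrderAt (analyticAt_zeroFun _)).1 hn
  set γ : ℝ → ℂ := fun d => quadPoint δ τ (x + a * d) (ψ + b * d) with hγ
  have hγd : DifferentiableAt ℝ γ 0 := by
    rw [hγ]; unfold quadPoint
    have : DifferentiableAt ℝ (fun d : ℝ => ((x + a * d : ℝ) : ℂ)) 0 := by fun_prop
    have h2 : DifferentiableAt ℝ (fun d : ℝ => ((ψ + b * d : ℝ) : ℂ)) 0 := by fun_prop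
    fun_prop
  have hγ0 : γ 0 = quadPoint δ τ x ψ := by simp [hγ]
  have htend : Tendsto γ (𝓝 0) (𝓝 (quadPoint δ τ x ψ)) := hγ0 ▸ hγd.continuousAt
  obtain ⟨K, hK⟩ := hγd.isBigO_sub.bound
  set M := ‖g (quadPoint δ τ x ψ)‖ + 1 with hM
  have hgM := (hg.continuousAt.norm.eventually (gt_mem_nhds (lt_add_one _)))
  have hA : 0 < ‖f₀‖ * Real.exp (-D.k) := mul_pos (norm_pos_iff.2 hf₀) (Real.exp_pos _)
  refine ⟨|K| ^ n * M / (‖f₀‖ * Real.exp (-D.k)), ?_⟩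
  filter_upwards [htend.eventually hgF, htend.eventually hgM, hK] with d h1 h2 h3
  have h4 := gap_le_norm_zeroFun (D := D) (f₀ := f₀) hδ hτ (x + a * d) (ψ + b * d) hm hc
  change D.zeroFun j f₀ c (quadPoint δ τ (x + a * d) (ψ + b * d)) = _ at h1
  rw [h1, norm_smul, norm_pow] at h4
  rw [hγ0] at h3
  rw [div_mul_eq_mul_div, le_div_iff₀ hA, mul_comm _ (‖f₀‖ * _)]
  refine h4.trans ?_
  have h5 : ‖γ d - quadPoint δ τ x ψ‖ ≤ |K| * |d| := by
    refine h3.trans ?_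
    rw [sub_zero, Real.norm_eq_abs]
    exact mul_le_mul_of_nonneg_right (le_abs_self K) (abs_nonneg d)
  calc _ ≤ (|K| * |d|) ^ n * M := mul_le_mul (pow_le_pow_left₀ (norm_nonneg _) h5 n) h2.le
        (norm_nonneg _) (by positivity)
    _ = _ := by ring

lemma order_eq_one_of_interior {δ τ x : ℝ} (hδ : |δ| = 1) (hτ : τ = 1 ∨ τ = -1)
    (hm : D.m = 2 * j + 1) (hf₀ : f₀ ≠ 0) (hc : ‖c‖ = 1) (h0 : 0 < D.psi x)
    (hπ : D.psi x < Real.pi) (hz : D.zeroFun j f₀ c (quadPoint δ τ x (D.psi x)) = 0) :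
    analyticOrderAt (D.zeroFun j f₀ c) (quadPoint δ τ x (D.psi x)) = 1 := by
  have h1 : analyticOrderAt (D.zeroFun j f₀ c) (quadPoint δ τ x (D.psi x)) ≠ 0 :=
    (analyticAt_zeroFun _).analyticOrderAt_ne_zero.2 hz
  refine le_antisymm ?_ (Order.one_le_iff_pos.2 (pos_iff_ne_zero.2 h1))
  by_contra hcon
  have h2 : ((2 : ℕ) : ℕ∞) ≤ analyticOrderAt (D.zeroFun j f₀ c) (quadPoint δ τ x (D.psi x)) :=
    Order.add_one_le_of_lt (not_le.1 hcon)
  obtain ⟨C, hC⟩ := gap_pow_bound_of_le_order hδ hτ x (D.psi x) 0 1 hm hf₀ hc h2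
  simp only [zero_mul, add_zero, one_mul] at hC
  exact not_quadratic_bound_of_interior h0 hπ C hC

lemma order_le_two_of_boundary {δ τ x : ℝ} (hδ : |δ| = 1) (hτ : τ = 1 ∨ τ = -1)
    (hm : D.m = 2 * j + 1) (hf₀ : f₀ ≠ 0) (hc : ‖c‖ = 1) (ht : D.psi x = 0 ∨ D.psi x = Real.pi)
    (hg : D.gap x (D.psi x) = 0) :
    analyticOrderAt (D.zeroFun j f₀ c) (quadPoint δ τ x (D.psi x)) ≤ 2 := by
  by_contra hcon
  have h2 : ((3 : ℕ) : ℕ∞) ≤ analyticOrderAt (D.zeroFun j f₀ c) (quadPoint δ τ x (D.psi x)) :=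
    Order.add_one_le_of_lt (not_le.1 hcon)
  obtain ⟨C, hC⟩ := gap_pow_bound_of_le_order hδ hτ x (D.psi x) 1 0 hm hf₀ hc h2
  simp only [zero_mul, add_zero, one_mul] at hC
  exact not_cubic_bound_of_boundary ht rfl hg C hC

lemma order_le_one_of_boundary {δ τ x y : ℝ} (hδ : |δ| = 1) (hτ : τ = 1 ∨ τ = -1)
    (hm : D.m = 2 * j + 1) (hf₀ : f₀ ≠ 0) (hc : ‖c‖ = 1) (ht : D.psi x = 0 ∨ D.psi x = Real.pi)
    (hg : D.gap x (D.psi x) = 0) (hne : y ≠ x) (hy : D.alpha y = D.alpha x) :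
    analyticOrderAt (D.zeroFun j f₀ c) (quadPoint δ τ x (D.psi x)) ≤ 1 := by
  by_contra hcon
  have h2 : ((2 : ℕ) : ℕ∞) ≤ analyticOrderAt (D.zeroFun j f₀ c) (quadPoint δ τ x (D.psi x)) :=
    Order.add_one_le_of_lt (not_le.1 hcon)
  obtain ⟨C, hC⟩ := gap_pow_bound_of_le_order hδ hτ x (D.psi x) 1 0 hm hf₀ hc h2
  simp only [zero_mul, add_zero, one_mul] at hC
  exact not_quadratic_bound_of_boundary ht rfl hg hne hy C hC

/-- Along the axis the arguments are locally constant, so near the zero F is a constant times the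
real function `gap`. At an isolated contact `gap` does not change sign, hence has a local extremum,
and the complex derivative vanishes with the derivative along the axis. -/
lemma deriv_eq_zero_of_boundary {δ τ x : ℝ} (hδ : |δ| = 1) (hτ : τ = 1 ∨ τ = -1)
    (hm : D.m = 2 * j + 1) (hf₀ : f₀ ≠ 0) (hc : ‖c‖ = 1) (ht : D.psi x = 0 ∨ D.psi x = Real.pi)
    (hz : D.zeroFun j f₀ c (quadPoint δ τ x (D.psi x)) = 0)
    (hS : ∀ y, D.alpha y = D.alpha x → y = x) :
    deriv (D.zeroFun j f₀ c) (quadPoint δ τ x (D.psi x)) = 0 := by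
  set t := D.psi x with htdef
  obtain ⟨hg, hph⟩ := (zeroFun_quadPoint_eq_zero_iff hδ hτ (psi_mem x) hm hf₀ hc).1 hz
  set ξ : ℂ := f₀ * Real.exp (-D.k) * Complex.exp (τ * stripArg D.v x t * Complex.I) with hξ
  have hξ0 : ξ ≠ 0 :=
    mul_ne_zero (mul_ne_zero hf₀ (by exact_mod_cast (Real.exp_pos _).ne')) (Complex.exp_ne_zero _)
  have hlin : ∀ᶠ y in 𝓝 x, ((D.gap y t : ℝ) : ℂ) = ξ⁻¹ * D.zeroFun j f₀ c (quadPoint δ τ y t) := by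
    filter_upwards [eventually_boundary_args_eq ht (regular_psi x)] with y hy
    rw [zeroFun_quadPoint hδ hτ y t hm, hy.1, hy.2, hph, one_mul, ← hξ, inv_mul_cancel_left₀ hξ0,
      ← Complex.ofReal_sub]
    rfl
  have hpt : HasDerivAt (fun y : ℝ => quadPoint δ τ y t) (quadPoint δ τ x t * (1 / 2)) x := by
    unfold quadPoint
    have h1 : HasDerivAt (fun y : ℝ => ((y : ℂ) + τ * t * Complex.I) / 2) (1 / 2) x :=
      ((Complex.ofRealCLM.hasDerivAt (x := x)).add_const _).div_const 2
    exact (h1.cexp.const_mul (δ : ℂ)).congr_deriv (by ring)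
  have hF : HasDerivAt (fun y : ℝ => ξ⁻¹ * D.zeroFun j f₀ c (quadPoint δ τ y t))
      (ξ⁻¹ * (deriv (D.zeroFun j f₀ c) (quadPoint δ τ x t) * (quadPoint δ τ x t * (1 / 2)))) x :=
    (((differentiable_zeroFun D j f₀ c _).hasDerivAt).comp_of_eq x hpt rfl).const_mul _
  set L := ξ⁻¹ * (deriv (D.zeroFun j f₀ c) (quadPoint δ τ x t) * (quadPoint δ τ x t * (1 / 2)))
  have hG : HasDerivAt (fun y : ℝ => ((D.gap y t : ℝ) : ℂ)) L x := hF.congr_of_eventuallyEq hlin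
  have hre : HasDerivAt (fun y : ℝ => D.gap y t) L.re x := 
    Complex.reCLM.hasFDerivAt.comp_hasDerivAt x hG
  have him : HasDerivAt (fun _ : ℝ => (0 : ℝ)) L.im x := 
    Complex.imCLM.hasFDerivAt.comp_hasDerivAt x hG
  have him0 : L.im = 0 := him.unique (hasDerivAt_const x (0 : ℝ))
  have hre0 : L.re = 0 := by
    rcases gap_const_sign_of_boundary ht rfl hg hS with h | h
    · refine IsLocalMin.hasDerivAt_eq_zero (f := fun y => D.gap y t) ?_ hre
      filter_upwards [h] with y hy
      rw [hg]; exact hy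
    · refine IsLocalMax.hasDerivAt_eq_zero (f := fun y => D.gap y t) ?_ hre
      filter_upwards [h] with y hy
      rw [hg]; exact hy
  have hL : L = 0 := Complex.ext hre0 him0
  have hq : quadPoint δ τ x t ≠ 0 := by
    rw [← norm_pos_iff, norm_quadPoint hδ]; exact Real.exp_pos _
  rcases mul_eq_zero.1 hL with h | h
  · exact absurd h (inv_ne_zero hξ0)
  · exact (mul_eq_zero.1 h).resolve_right (mul_ne_zero hq (by norm_num))

open Classical in
/-- The multiplicity of a zero on the boundary line is the number of ends of the level set of
`alpha` at which it lies. -/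
lemma order_eq_of_boundary {δ τ x : ℝ} (hδ : |δ| = 1) (hτ : τ = 1 ∨ τ = -1)
    (hm : D.m = 2 * j + 1) (hf₀ : f₀ ≠ 0) (hc : ‖c‖ = 1) (ht : D.psi x = 0 ∨ D.psi x = Real.pi)
    (hz : D.zeroFun j f₀ c (quadPoint δ τ x (D.psi x)) = 0) :
    analyticOrderAt (D.zeroFun j f₀ c) (quadPoint δ τ x (D.psi x)) =
      (if IsLeast {y | D.alpha y = D.alpha x} x then 1 else 0) +
      (if IsGreatest {y | D.alpha y = D.alpha x} x then 1 else 0) := by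
  obtain ⟨hg, -⟩ := (zeroFun_quadPoint_eq_zero_iff hδ hτ (psi_mem x) hm hf₀ hc).1 hz
  have h1 : 1 ≤ analyticOrderAt (D.zeroFun j f₀ c) (quadPoint δ τ x (D.psi x)) :=
    Order.one_le_iff_pos.2 (pos_iff_ne_zero.2 ((analyticAt_zeroFun _).analyticOrderAt_ne_zero.2 hz))
  by_cases hS : ∀ y, D.alpha y = D.alpha x → y = x
  · rw [if_pos ⟨rfl, fun y hy => (hS y hy).ge⟩, if_pos ⟨rfl, fun y hy => (hS y hy).le⟩]
    refine le_antisymm (order_le_two_of_boundary hδ hτ hm hf₀ hc ht hg) ?_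
    by_contra hcon
    have heq : analyticOrderAt (D.zeroFun j f₀ c) (quadPoint δ τ x (D.psi x)) = 1 :=
      le_antisymm (Order.le_of_lt_add_one (not_le.1 hcon)) h1
    -- A simple zero would have a derivative of order 0 there, but the derivative vanishes at an
    -- isolated contact.
    have hd := (analyticAt_zeroFun (D := D) (j := j) (f₀ := f₀) (c := c)
      (quadPoint δ τ x (D.psi x))).analyticOrderAt_deriv_add_one
    simp only [hz, sub_zero] at hd
    rw [heq] at hd
    have hd0 : analyticOrderAt (deriv (D.zeroFun j f₀ c)) (quadPoint δ τ x (D.psi x)) = 0 := by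
      by_contra hne
      have h2 : (1 : ℕ∞) + 1 ≤ 1 := by
        conv_rhs => rw [← hd]
        gcongr
        exact Order.one_le_iff_pos.2 (pos_iff_ne_zero.2 hne)
      exact absurd h2 (by norm_num)
    rcases analyticOrderAt_eq_zero.1 hd0 with h | h
    · exact h (analyticAt_zeroFun _).deriv
    · exact h (deriv_eq_zero_of_boundary hδ hτ hm hf₀ hc ht hz hS)
  -- A second abscissa with the same value of `alpha` makes x an end of a plateau: the zero is
  -- simple and x is exactly one of the two ends.
  · push Not at hS
    obtain ⟨y, hy, hne⟩ := hS
    have hle := order_le_one_of_boundary hδ hτ hm hf₀ hc ht hg hne hy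
    rw [le_antisymm hle h1]
    rcases lt_or_gt_of_ne hne with hlt | hlt
    · have hL : ¬ IsLeast {y | D.alpha y = D.alpha x} x := fun h => absurd (h.2 hy) (not_le.2 hlt)
      have hG : IsGreatest {y | D.alpha y = D.alpha x} x := by
        refine ⟨rfl, fun z hz' => ?_⟩
        by_contra hcon
        exact gap_ne_zero_of_mem_Ioo hy hz' ⟨hlt, not_le.1 hcon⟩ hg
      rw [if_neg hL, if_pos hG, zero_add]
    · have hG : ¬ IsGreatest {y | D.alpha y = D.alpha x} x := fun h =>
        absurd (h.2 hy) (not_le.2 hlt)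
      have hL : IsLeast {y | D.alpha y = D.alpha x} x := by
        refine ⟨rfl, fun z hz' => ?_⟩
        by_contra hcon
        exact gap_ne_zero_of_mem_Ioo hz' hy ⟨not_le.1 hcon, hlt⟩ hg
      rw [if_pos hL, if_neg hG, add_zero]

end zeros

end StripData

namespace StripData

variable {D : StripData}

/-! ### First and last points at which `alpha` attains a level -/

-- When the level is attained on a half line or not at all, the infimum or supremum may be a default
-- value; it is used only together with `HitExists`.
open Classical in
noncomputable def hit (D : StripData) (first : Prop) (T : ℝ) : ℝ :=
  if first then sInf {x | D.alpha x ≤ T} else sSup {x | T ≤ D.alpha x}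

-- The inequality is strict for the last point: a level from which `alpha` never descends has a
-- plateau reaching to +∞, without a last point.
open Classical in
def HitExists (D : StripData) (first : Prop) (T : ℝ) : Prop :=
  if first then ∃ x, D.alpha x ≤ T else ∃ x, D.alpha x < T

lemma isLeast_hit (hm : 0 < D.m) {first : Prop} (hf : first) {T : ℝ} (hT : T < D.m / 2 * Real.pi)
    (h : D.HitExists first T) : IsLeast {y | D.alpha y = T} (D.hit first T) := by
  rw [HitExists, if_pos hf] at h
  rw [hit, if_pos hf]
  obtain ⟨x₀, hx₀⟩ := (eventually_psi_eq_pi hm).exists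
  have hbdd : BddBelow {x | D.alpha x ≤ T} := by
    refine ⟨x₀, fun y hy => ?_⟩
    by_contra hcon
    have h1 := alpha_antitone (D := D) (not_le.1 hcon).le
    have h2 : D.alpha y ≤ T := hy
    linarith [hx₀.2]
  have hcl : IsClosed {x | D.alpha x ≤ T} := isClosed_le continuous_alpha continuous_const
  have hs := hcl.isLeast_csInf h hbdd
  set s := sInf {x | D.alpha x ≤ T}
  refine ⟨le_antisymm hs.1 ?_, fun y hy => hs.2 (le_of_eq hy)⟩
  by_contra hcon
  have hev : ∀ᶠ y in 𝓝[<] s, D.alpha y < T :=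
    ((continuous_alpha (D := D)).continuousAt.eventually (gt_mem_nhds (not_le.1 hcon))).filter_mono
      nhdsWithin_le_nhds
  obtain ⟨y, hy, hys⟩ := (hev.and self_mem_nhdsWithin).exists
  exact absurd (hs.2 (show y ∈ {x | D.alpha x ≤ T} from hy.le)) (not_le.2 hys)

lemma isGreatest_hit (hm : 0 < D.m) {first : Prop} (hf : ¬ first) {T : ℝ}
    (hT : T ≤ D.m / 2 * Real.pi) (h : D.HitExists first T) :
    IsGreatest {y | D.alpha y = T} (D.hit first T) := by
  rw [HitExists, if_neg hf] at h
  rw [hit, if_neg hf]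
  obtain ⟨x₀, hx₀⟩ := (eventually_psi_eq_pi hm).exists
  obtain ⟨x₁, hx₁⟩ := h
  have hbdd : BddAbove {x | T ≤ D.alpha x} := by
    refine ⟨x₁, fun y hy => ?_⟩
    by_contra hcon
    have h1 := alpha_antitone (D := D) (not_le.1 hcon).le
    have h2 : T ≤ D.alpha y := hy
    linarith
  have hcl : IsClosed {x | T ≤ D.alpha x} := isClosed_le continuous_const continuous_alpha
  have hs := hcl.isGreatest_csSup ⟨x₀, show T ≤ D.alpha x₀ from hx₀.2 ▸ hT⟩ hbdd
  set s := sSup {x | T ≤ D.alpha x}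
  refine ⟨le_antisymm ?_ hs.1, fun y hy => hs.2 (le_of_eq (Eq.symm hy))⟩
  by_contra hcon
  have hev : ∀ᶠ y in 𝓝[>] s, T < D.alpha y :=
    ((continuous_alpha (D := D)).continuousAt.eventually (lt_mem_nhds (not_le.1 hcon))).filter_mono
      nhdsWithin_le_nhds
  obtain ⟨y, hy, hys⟩ := (hev.and self_mem_nhdsWithin).exists
  exact absurd (hs.2 (show y ∈ {x | T ≤ D.alpha x} from hy.le)) (not_le.2 hys)

/-- Off the level curve `alpha` is locally constant, so the level would be attained a little further
to the left. -/
lemma gap_eq_zero_of_isLeast {x T : ℝ} (h : IsLeast {y | D.alpha y = T} x) :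
    D.gap x (D.psi x) = 0 := by
  by_contra hg
  have hx : D.alpha x = T := h.1
  have hev := (eventually_alpha_eq hg).filter_mono (nhdsWithin_le_nhds (s := Set.Iio x))
  obtain ⟨y, hy, hys⟩ := (hev.and self_mem_nhdsWithin).exists
  exact absurd (h.2 (show D.alpha y = T from hy.trans hx)) (not_le.2 hys)

lemma gap_eq_zero_of_isGreatest {x T : ℝ} (h : IsGreatest {y | D.alpha y = T} x) :
    D.gap x (D.psi x) = 0 := by
  by_contra hg
  have hx : D.alpha x = T := h.1
  have hev := (eventually_alpha_eq hg).filter_mono (nhdsWithin_le_nhds (s := Set.Ioi x))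
  obtain ⟨y, hy, hys⟩ := (hev.and self_mem_nhdsWithin).exists
  exact absurd (h.2 (show D.alpha y = T from hy.trans hx)) (not_le.2 hys)

lemma hit_eq_iff_of_first (hm : 0 < D.m) {first : Prop} (hf : first) {x : ℝ}
    (hT : D.alpha x < D.m / 2 * Real.pi) :
    D.HitExists first (D.alpha x) ∧ D.hit first (D.alpha x) = x ↔
      IsLeast {y | D.alpha y = D.alpha x} x := by
  constructor
  · rintro ⟨h1, h2⟩
    have := isLeast_hit hm hf hT h1
    rwa [h2] at this
  · intro h
    have h1 : D.HitExists first (D.alpha x) := by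
      rw [HitExists, if_pos hf]; exact ⟨x, le_rfl⟩
    exact ⟨h1, (isLeast_hit hm hf hT h1).unique h⟩

lemma hit_eq_iff_of_not_first (hm : 0 < D.m) {first : Prop} (hf : ¬ first) {x : ℝ} :
    D.HitExists first (D.alpha x) ∧ D.hit first (D.alpha x) = x ↔
      IsGreatest {y | D.alpha y = D.alpha x} x := by
  constructor
  · rintro ⟨h1, h2⟩
    have := isGreatest_hit hm hf (alpha_le hm x) h1
    rwa [h2] at this
  · intro h
    have h1 : D.HitExists first (D.alpha x) := by
      rw [HitExists, if_neg hf]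
      refine ⟨x + 1, lt_of_le_of_ne (alpha_antitone (by linarith)) fun heq => ?_⟩
      linarith [h.2 (show x + 1 ∈ {y | D.alpha y = D.alpha x} from heq)]
    exact ⟨h1, (isGreatest_hit hm hf (alpha_le hm x) h1).unique h⟩

/-! ### The sequence of levels -/

/-- The `n`-th level (`n ≥ 1`) at which `alpha` has to be met by a zero. -/
noncomputable def level (j : ℕ) (γ : ℝ) (n : ℕ) : ℝ :=
  ((j : ℝ) - ((n - 1) / 2 : ℕ)) * Real.pi + if Odd n then γ else -γ

/-- The sign δ forced by c δ exp (iτ alpha) = 1 at the `n`-th level, for c = ε exp (iγ) and τ =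
`conjSign n`; see `phase_level`. -/
noncomputable def levelSign (j : ℕ) (ε : ℝ) (n : ℕ) : ℝ := ε * (-1) ^ (j + (n - 1) / 2)

noncomputable def conjSign (n : ℕ) : ℝ := if Odd n then -1 else 1

/-- Selects the end of the plateau that carries the `n`-th zero. For γ = 0 the levels 2k + 1 and 2k
+ 2 coincide and stand for left and right end. For γ = π/2 the coinciding levels are 2k and 2k + 1,
while the first level, whose plateau starts at -∞, has only a right end. -/
def IsFirst (γ : ℝ) (n : ℕ) : Prop := Odd n ↔ γ ≠ Real.pi / 2

lemma level_odd (j : ℕ) (γ : ℝ) (k : ℕ) : level j γ (2 * k + 1) = ((j : ℝ) - k) * Real.pi + γ := by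
  rw [level, if_pos ⟨k, rfl⟩]
  congr 4; omega

lemma level_even (j : ℕ) (γ : ℝ) (k : ℕ) : level j γ (2 * k + 2) = ((j : ℝ) - k) * Real.pi - γ := by
  rw [level, if_neg (by rw [Nat.not_odd_iff_even]; exact ⟨k + 1, by ring⟩),
    show (2 * k + 2 - 1) / 2 = k by omega]
  ring

lemma levelSign_odd (j : ℕ) (ε : ℝ) (k : ℕ) : levelSign j ε (2 * k + 1) = ε * (-1) ^ (j + k) := by
  rw [levelSign]; congr 2; omega

lemma levelSign_even (j : ℕ) (ε : ℝ) (k : ℕ) : levelSign j ε (2 * k + 2) = ε * (-1) ^ (j + k) := by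
  rw [levelSign]; congr 2; omega

lemma conjSign_odd (k : ℕ) : conjSign (2 * k + 1) = -1 := if_pos ⟨k, rfl⟩

lemma conjSign_even (k : ℕ) : conjSign (2 * k + 2) = 1 :=
  if_neg (by rw [Nat.not_odd_iff_even]; exact ⟨k + 1, by ring⟩)

lemma exists_eq_of_one_le {n : ℕ} (h : 1 ≤ n) : ∃ k, n = 2 * k + 1 ∨ n = 2 * k + 2 :=
  ⟨(n - 1) / 2, by omega⟩

lemma isFirst_odd {γ : ℝ} (k : ℕ) : IsFirst γ (2 * k + 1) ↔ γ ≠ Real.pi / 2 := by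
  have : Odd (2 * k + 1) := ⟨k, rfl⟩
  simp [IsFirst, this]

lemma isFirst_even {γ : ℝ} (k : ℕ) : IsFirst γ (2 * k + 2) ↔ γ = Real.pi / 2 := by
  have : ¬ Odd (2 * k + 2) := by rw [Nat.not_odd_iff_even]; exact ⟨k + 1, by ring⟩
  simp [IsFirst, this]

lemma conjSign_eq (n : ℕ) : conjSign n = 1 ∨ conjSign n = -1 := by
  unfold conjSign; split_ifs <;> simp

lemma levelSign_eq (j : ℕ) {ε : ℝ} (hε : ε = 1 ∨ ε = -1) (n : ℕ) :
    levelSign j ε n = 1 ∨ levelSign j ε n = -1 := by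
  unfold levelSign
  rcases hε with rfl | rfl <;> rcases neg_one_pow_eq_or ℝ (j + (n - 1) / 2) with h | h <;> simp [h]

lemma abs_eq_one_of_eq {ε : ℝ} (hε : ε = 1 ∨ ε = -1) : |ε| = 1 := by
  rcases hε with rfl | rfl <;> simp

/-! ### Every zero is counted once per multiplicity -/

section enumeration

variable {j : ℕ} {ε γ : ℝ}

lemma level_lt_of_isFirst (hm : D.m = 2 * j + 1) (hγ0 : 0 ≤ γ) (hγ : γ ≤ Real.pi / 2) {n : ℕ}
    (hn : 1 ≤ n) (h : IsFirst γ n) : level j γ n < D.m / 2 * Real.pi := by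
  have hπ := Real.pi_pos
  rw [hm]
  obtain ⟨k, rfl | rfl⟩ := exists_eq_of_one_le hn
  · have hlt := lt_of_le_of_ne hγ ((isFirst_odd k).1 h)
    rw [level_odd]
    have := mul_nonneg (Nat.cast_nonneg (α := ℝ) k) hπ.le
    linarith
  · have := (isFirst_even k).1 h
    rw [level_even]
    have := mul_nonneg (Nat.cast_nonneg (α := ℝ) k) hπ.le
    linarith

lemma level_le (hm : D.m = 2 * j + 1) (hγ0 : 0 ≤ γ) (hγ : γ ≤ Real.pi / 2) {n : ℕ}
    (hn : 1 ≤ n) : level j γ n ≤ D.m / 2 * Real.pi := by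
  have hπ := Real.pi_pos
  rw [hm]
  obtain ⟨k, rfl | rfl⟩ := exists_eq_of_one_le hn
  · rw [level_odd]
    have := mul_nonneg (Nat.cast_nonneg (α := ℝ) k) hπ.le
    linarith
  · rw [level_even]
    have := mul_nonneg (Nat.cast_nonneg (α := ℝ) k) hπ.le
    linarith

/-- Consecutive levels can coincide only when the earlier one refers to a left end. -/
lemma level_succ_lt_of_not_isFirst (hγ : γ ≤ Real.pi / 2) {n : ℕ}
    (hn : 1 ≤ n) (h : ¬ IsFirst γ n) : level j γ (n + 1) < level j γ n := by
  have hπ := Real.pi_pos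
  obtain ⟨k, rfl | rfl⟩ := exists_eq_of_one_le hn
  · rw [isFirst_odd, not_not] at h
    rw [level_odd, level_even, h]
    linarith
  · rw [isFirst_even] at h
    have hlt := lt_of_le_of_ne hγ h
    rw [level_even, show 2 * k + 2 + 1 = 2 * (k + 1) + 1 by ring, level_odd]
    push_cast; nlinarith

lemma level_succ_lt_of_ne (h0 : 0 < γ) (hγ : γ < Real.pi / 2) {n : ℕ}
    (hn : 1 ≤ n) : level j γ (n + 1) < level j γ n := by
  have hπ := Real.pi_pos
  obtain ⟨k, rfl | rfl⟩ := exists_eq_of_one_le hn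
  · rw [level_odd, level_even]
    linarith
  · rw [level_even, show 2 * k + 2 + 1 = 2 * (k + 1) + 1 by ring, level_odd]
    push_cast; nlinarith

lemma level_succ_le (h0 : 0 ≤ γ) (hγ : γ ≤ Real.pi / 2) {n : ℕ}
    (hn : 1 ≤ n) : level j γ (n + 1) ≤ level j γ n := by
  have hπ := Real.pi_pos
  obtain ⟨k, rfl | rfl⟩ := exists_eq_of_one_le hn
  · rw [level_odd, level_even]
    linarith
  · rw [level_even, show 2 * k + 2 + 1 = 2 * (k + 1) + 1 by ring, level_odd]
    push_cast; nlinarith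

lemma eq_of_level_eq_of_conjSign_eq {n l : ℕ} (hn : 1 ≤ n) (hl : 1 ≤ l)
    (h : level j γ n = level j γ l) (hc : conjSign n = conjSign l) : n = l := by
  have hπ := Real.pi_pos
  obtain ⟨k, rfl | rfl⟩ := exists_eq_of_one_le hn <;> obtain ⟨i, rfl | rfl⟩ := exists_eq_of_one_le hl
  · rw [level_odd, level_odd] at h
    have h1 : (j : ℝ) - k = j - i := mul_right_cancel₀ hπ.ne' (by linarith)
    have h2 : (k : ℝ) = i := by linarith
    rw [Nat.cast_injective h2]
  · rw [conjSign_odd, conjSign_even] at hc; norm_num at hc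
  · rw [conjSign_odd, conjSign_even] at hc; norm_num at hc
  · rw [level_even, level_even] at h
    have h1 : (j : ℝ) - k = j - i := mul_right_cancel₀ hπ.ne' (by linarith)
    have h2 : (k : ℝ) = i := by linarith
    rw [Nat.cast_injective h2]

/-- The unimodular number `± exp (iγ)`. -/
noncomputable def unitPhase (ε γ : ℝ) : ℂ := ε * Complex.exp (γ * Complex.I)

lemma norm_unitPhase (hε : ε = 1 ∨ ε = -1) : ‖unitPhase ε γ‖ = 1 := by
  rw [unitPhase, norm_mul, Complex.norm_exp_ofReal_mul_I, Complex.norm_real, Real.norm_eq_abs,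
    abs_eq_one_of_eq hε, one_mul]

lemma exp_sub_mul_pi (a b : ℕ) : Complex.exp (((a : ℝ) - b : ℝ) * Real.pi * Complex.I) =
    (-1) ^ (a + b) := by
  have h : ∀ n : ℕ, Complex.exp (n * (Real.pi * Complex.I)) = (-1) ^ n := fun n => by
    rw [Complex.exp_nat_mul, Complex.exp_pi_mul_I]
  rw [show (((a : ℝ) - b : ℝ) : ℂ) * Real.pi * Complex.I = a * (Real.pi * Complex.I) -
    b * (Real.pi * Complex.I) by push_cast; ring, Complex.exp_sub, h, h, pow_add]
  rcases neg_one_pow_eq_or ℂ b with h | h <;> simp [h, div_neg]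

lemma phase_level (hε : ε = 1 ∨ ε = -1) {n : ℕ} (hn : 1 ≤ n) :
    unitPhase ε γ * levelSign j ε n * Complex.exp (conjSign n * level j γ n * Complex.I) = 1 := by
  have hε2 : (ε : ℂ) * ε = 1 := by rcases hε with rfl | rfl <;> simp
  have hs : ∀ a : ℕ, ((-1 : ℂ) ^ a) * (-1) ^ a = 1 := fun a => by
    rw [← mul_pow]; simp
  have hexp := Complex.exp_ne_zero (γ * Complex.I)
  unfold unitPhase
  obtain ⟨k, rfl | rfl⟩ := exists_eq_of_one_le hn
  · rw [level_odd, levelSign_odd, conjSign_odd]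
    have e1 : Complex.exp (((-1 : ℝ) : ℂ) * ((((j : ℝ) - k) * Real.pi + γ : ℝ) : ℂ) * Complex.I) =
        (Complex.exp (((j : ℝ) - k : ℝ) * Real.pi * Complex.I))⁻¹ *
        (Complex.exp (γ * Complex.I))⁻¹ := by
      rw [← Complex.exp_neg, ← Complex.exp_neg, ← Complex.exp_add]
      congr 1; push_cast; ring
    rw [e1, exp_sub_mul_pi]
    push_cast
    have hne : ((-1 : ℂ) ^ (j + k)) ≠ 0 := left_ne_zero_of_mul (hs (j + k) ▸ one_ne_zero)
    field_simp
    linear_combination hε2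
  · rw [level_even, levelSign_even, conjSign_even]
    have e1 : Complex.exp (((1 : ℝ) : ℂ) * ((((j : ℝ) - k) * Real.pi - γ : ℝ) : ℂ) * Complex.I) =
        (Complex.exp (((j : ℝ) - k : ℝ) * Real.pi * Complex.I)) *
        (Complex.exp (γ * Complex.I))⁻¹ := by
      rw [← Complex.exp_neg, ← Complex.exp_add]
      congr 1; push_cast; ring
    rw [e1, exp_sub_mul_pi]
    push_cast
    field_simp
    linear_combination ((-1 : ℂ) ^ (j + k) * (-1) ^ (j + k)) * hε2 + hs (j + k)

lemma exp_real_mul_I_sq_eq_one {s : ℝ} (h : Complex.exp (s * Complex.I) ^ 2 = 1) :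
    ∃ n : ℤ, s = n * Real.pi := by
  rw [← Complex.exp_nat_mul, Complex.exp_eq_one_iff] at h
  obtain ⟨n, hn⟩ := h
  refine ⟨n, ?_⟩
  have h1 := congrArg Complex.im hn
  simp at h1
  linarith

lemma exists_int_of_phase {δ τ a : ℝ} (hε : ε = 1 ∨ ε = -1) (hδ : δ = 1 ∨ δ = -1)
    (hτ : τ = 1 ∨ τ = -1)
    (h : unitPhase ε γ * δ * Complex.exp (τ * a * Complex.I) = 1) :
    ∃ n : ℤ, a = τ * (n * Real.pi - γ) := by
  have hε2 : (ε : ℂ) ^ 2 = 1 := by rcases hε with rfl | rfl <;> simp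
  have hδ2 : (δ : ℂ) ^ 2 = 1 := by rcases hδ with rfl | rfl <;> simp
  have h1 : Complex.exp ((γ + τ * a : ℝ) * Complex.I) ^ 2 = 1 := by
    have e : Complex.exp ((γ + τ * a : ℝ) * Complex.I) =
        Complex.exp (γ * Complex.I) * Complex.exp (τ * a * Complex.I) := by
      rw [← Complex.exp_add]; congr 1; push_cast; ring
    have h2 := congrArg (· ^ 2) h
    simp only [unitPhase, one_pow] at h2
    rw [e]
    calc _ = ((ε : ℂ) ^ 2)⁻¹ * ((δ : ℂ) ^ 2)⁻¹ * (ε * Complex.exp (γ * Complex.I) * δ *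
          Complex.exp (τ * a * Complex.I)) ^ 2 := by
          rw [hε2, hδ2]; simp only [mul_pow, hε2, hδ2]; ring
      _ = 1 := by rw [h2, hε2, hδ2]; simp
  obtain ⟨n, hn⟩ := exp_real_mul_I_sq_eq_one h1
  refine ⟨n, ?_⟩
  rcases hτ with rfl | rfl <;> linarith

lemma sign_eq_of_phase {δ δ' τ a : ℝ} {c : ℂ} (h : c * δ * Complex.exp (τ * a * Complex.I) = 1)
    (h' : c * δ' * Complex.exp (τ * a * Complex.I) = 1) : δ = δ' := by
  have hc : c ≠ 0 := fun h0 => by simp [h0] at h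
  have h1 := mul_right_cancel₀ (Complex.exp_ne_zero _) (h.trans h'.symm)
  exact_mod_cast mul_left_cancel₀ hc h1

/-- The `n`-th zero. -/
noncomputable def zeroSeq (D : StripData) (j : ℕ) (ε γ : ℝ) (n : ℕ) : ℂ :=
  quadPoint (levelSign j ε n) (conjSign n) (D.hit (IsFirst γ n) (level j γ n))
    (D.psi (D.hit (IsFirst γ n) (level j γ n)))

def ZeroExists (D : StripData) (j : ℕ) (γ : ℝ) (n : ℕ) : Prop :=
  D.HitExists (IsFirst γ n) (level j γ n)

variable {f₀ : ℂ}

lemma alpha_hit (hm : D.m = 2 * j + 1) (hγ0 : 0 ≤ γ) (hγ : γ ≤ Real.pi / 2) {n : ℕ} (hn : 1 ≤ n)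
    (h : D.ZeroExists j γ n) : D.alpha (D.hit (IsFirst γ n) (level j γ n)) = level j γ n := by
  have hm0 : 0 < D.m := by rw [hm]; positivity
  by_cases hf : IsFirst γ n
  · exact (isLeast_hit hm0 hf (level_lt_of_isFirst hm hγ0 hγ hn hf) h).1
  · exact (isGreatest_hit hm0 hf (level_le hm hγ0 hγ hn) h).1

lemma gap_hit (hm : D.m = 2 * j + 1) (hγ0 : 0 ≤ γ) (hγ : γ ≤ Real.pi / 2) {n : ℕ} (hn : 1 ≤ n)
    (h : D.ZeroExists j γ n) : D.gap (D.hit (IsFirst γ n) (level j γ n))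
      (D.psi (D.hit (IsFirst γ n) (level j γ n))) = 0 := by
  have hm0 : 0 < D.m := by rw [hm]; positivity
  by_cases hf : IsFirst γ n
  · exact gap_eq_zero_of_isLeast (isLeast_hit hm0 hf (level_lt_of_isFirst hm hγ0 hγ hn hf) h)
  · exact gap_eq_zero_of_isGreatest (isGreatest_hit hm0 hf (level_le hm hγ0 hγ hn) h)

lemma zeroFun_zeroSeq (hm : D.m = 2 * j + 1) (hγ0 : 0 ≤ γ) (hγ : γ ≤ Real.pi / 2)
    (hε : ε = 1 ∨ ε = -1) (hf₀ : f₀ ≠ 0) {n : ℕ} (hn : 1 ≤ n) (h : D.ZeroExists j γ n) :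
    D.zeroFun j f₀ (unitPhase ε γ) (D.zeroSeq j ε γ n) = 0 := by
  rw [zeroSeq, zeroFun_quadPoint_eq_zero_iff (abs_eq_one_of_eq (levelSign_eq j hε n)) (conjSign_eq n)
    (psi_mem _) hm hf₀ (norm_unitPhase hε)]
  refine ⟨gap_hit hm hγ0 hγ hn h, ?_⟩
  have := alpha_hit hm hγ0 hγ hn h
  rw [alpha] at this
  rw [this]
  exact phase_level hε hn

lemma norm_zeroSeq (hε : ε = 1 ∨ ε = -1) (n : ℕ) :
    ‖D.zeroSeq j ε γ n‖ = Real.exp (D.hit (IsFirst γ n) (level j γ n) / 2) :=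
  norm_quadPoint (abs_eq_one_of_eq (levelSign_eq j hε n)) _ _ _

lemma not_isLeast_of_alpha_eq (hm : 0 < D.m) {x : ℝ} (h : D.alpha x = D.m / 2 * Real.pi) :
    ¬ IsLeast {y | D.alpha y = D.alpha x} x := by
  intro hL
  obtain ⟨y, hy, hyx⟩ := ((eventually_psi_eq_pi hm).and (eventually_lt_atBot x)).exists
  exact absurd (hL.2 (show D.alpha y = D.alpha x from hy.2.trans h.symm)) (not_le.2 hyx)

lemma quadPoint_injective {δ τ δ' τ' x ψ : ℝ} (hτ : τ = 1 ∨ τ = -1)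
    (hτ' : τ' = 1 ∨ τ' = -1) (hδ : δ = 1 ∨ δ = -1) (h0 : 0 < ψ) (hπ : ψ < Real.pi)
    (h : quadPoint δ τ x ψ = quadPoint δ' τ' x ψ) : τ = τ' := by
  have hre := congrArg Complex.re h
  have him := congrArg Complex.im h
  rw [quadPoint_re hτ, quadPoint_re hτ'] at hre
  rw [quadPoint_im hτ, quadPoint_im hτ'] at him
  have hc : 0 < Real.cos (ψ / 2) := Real.cos_pos_of_mem_Ioo ⟨by linarith [Real.pi_pos], by linarith⟩
  have hs : 0 < Real.sin (ψ / 2) := Real.sin_pos_of_pos_of_lt_pi (by linarith) (by linarith)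
  have h1 : δ = δ' := mul_right_cancel₀ (mul_pos (Real.exp_pos _) hc).ne' hre
  have h2 : δ * τ = δ' * τ' := mul_right_cancel₀ (mul_pos (Real.exp_pos _) hs).ne' him
  rw [← h1] at h2
  exact mul_left_cancel₀ (by rcases hδ with rfl | rfl <;> norm_num) h2

lemma hit_eq_of_zeroSeq_eq (hε : ε = 1 ∨ ε = -1) {n : ℕ} {δ τ x ψ : ℝ} (hδ : δ = 1 ∨ δ = -1)
    (h : D.zeroSeq j ε γ n = quadPoint δ τ x ψ) : D.hit (IsFirst γ n) (level j γ n) = x := by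
  have h1 := congrArg norm h
  rw [norm_zeroSeq hε, norm_quadPoint (abs_eq_one_of_eq hδ)] at h1
  linarith [Real.exp_injective h1]

/-- An interior point of the level set is a member of the sequence exactly once. -/
lemma existsUnique_index_of_interior (hm : D.m = 2 * j + 1) (hγ0 : 0 ≤ γ) (hγ : γ ≤ Real.pi / 2)
    (hε : ε = 1 ∨ ε = -1) {δ τ x : ℝ} (hδ : δ = 1 ∨ δ = -1) (hτ : τ = 1 ∨ τ = -1)
    (h0 : 0 < D.psi x) (hπ : D.psi x < Real.pi)
    (hph : unitPhase ε γ * δ * Complex.exp (τ * D.alpha x * Complex.I) = 1) :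
    ∃ n, {n : ℕ | 1 ≤ n ∧ D.ZeroExists j γ n ∧ D.zeroSeq j ε γ n = quadPoint δ τ x (D.psi x)} =
      {n} := by
  have hm0 : 0 < D.m := by rw [hm]; positivity
  have hπ0 := Real.pi_pos
  have huniq : ∀ y, D.alpha y = D.alpha x → y = x := by
    intro y hy
    by_contra hne
    rcases psi_of_alpha_eq hne hy with h | h
    · linarith [h.2]
    · linarith [h.2]
  have hlt : D.alpha x < D.m / 2 * Real.pi := by
    refine lt_of_le_of_ne (alpha_le hm0 x) fun heq => ?_
    exact not_isLeast_of_alpha_eq hm0 heq ⟨rfl, fun y hy => (huniq y hy).ge⟩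
  -- The phase condition gives `alpha x = τ (lπ - γ)` with an integer l, and `alpha x < (j + 1/2)π`
  -- makes k = j - l (for τ = 1) or k = j + l (for τ = -1) nonnegative.
  have hex : ∃ n, 1 ≤ n ∧ level j γ n = D.alpha x ∧ conjSign n = τ := by
    obtain ⟨l, hl⟩ := exists_int_of_phase hε hδ hτ hph
    rw [hm] at hlt
    rcases hτ with rfl | rfl
    · have h1 : (l : ℝ) < j + 1 := by
        by_contra hcon
        have := mul_le_mul_of_nonneg_right (not_lt.1 hcon) hπ0.le
        linarith
      have h2 : l < j + 1 := by exact_mod_cast h1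
      obtain ⟨k, hk⟩ := Int.eq_ofNat_of_zero_le (show 0 ≤ (j : ℤ) - l by omega)
      refine ⟨2 * k + 2, by omega, ?_, conjSign_even k⟩
      have h3 : (j : ℝ) - l = k := by exact_mod_cast hk
      rw [level_even, hl, ← h3]; ring
    · have h1 : (-1 : ℝ) < j + l := by
        by_contra hcon
        have := mul_le_mul_of_nonneg_right (not_lt.1 hcon) hπ0.le
        linarith
      have h2 : -1 < (j : ℤ) + l := by exact_mod_cast h1
      obtain ⟨k, hk⟩ := Int.eq_ofNat_of_zero_le (show 0 ≤ (j : ℤ) + l by omega)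
      refine ⟨2 * k + 1, by omega, ?_, conjSign_odd k⟩
      have h3 : (j : ℝ) + l = k := by exact_mod_cast hk
      rw [level_odd, hl, ← h3]; ring
  obtain ⟨n, hn, hlev, hcs⟩ := hex
  refine ⟨n, Set.Subset.antisymm ?_ ?_⟩
  · rintro l ⟨hl, hle, hlz⟩
    have hx := hit_eq_of_zeroSeq_eq hε hδ hlz
    have hα := alpha_hit hm hγ0 hγ hl hle
    rw [hx] at hα
    rw [zeroSeq, hx] at hlz
    have := quadPoint_injective (conjSign_eq l) hτ (levelSign_eq j hε l) h0 hπ hlz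
    exact eq_of_level_eq_of_conjSign_eq hl hn (hα.symm.trans hlev.symm) (this.trans hcs.symm)
  · rintro l rfl
    have hhit : D.HitExists (IsFirst γ l) (D.alpha x) ∧ D.hit (IsFirst γ l) (D.alpha x) = x := by
      by_cases hf : IsFirst γ l
      · exact (hit_eq_iff_of_first hm0 hf hlt).2 ⟨rfl, fun y hy => (huniq y hy).ge⟩
      · exact (hit_eq_iff_of_not_first hm0 hf).2 ⟨rfl, fun y hy => (huniq y hy).le⟩
    rw [← hlev] at hhit
    refine ⟨hn, hhit.1, ?_⟩
    have h1 := phase_level (j := j) (γ := γ) hε hn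
    rw [hlev, hcs] at h1
    rw [zeroSeq, hhit.2, hcs, sign_eq_of_phase h1 hph]

/-- On the axes the coordinates are redundant: at ψ = 0 only δ matters, at ψ = π only δτ. The
respective condition on exp (ia)² makes the phase equation determine precisely this sign. -/
lemma quadPoint_eq_of_boundary {c : ℂ} {δ τ δ' τ' a x ψ : ℝ} (hτ : τ = 1 ∨ τ = -1)
    (hτ' : τ' = 1 ∨ τ' = -1)
    (hψ : (ψ = 0 ∧ Complex.exp (a * Complex.I) ^ 2 = 1) ∨
      (ψ = Real.pi ∧ Complex.exp (a * Complex.I) ^ 2 = -1))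
    (h : c * δ * Complex.exp (τ * a * Complex.I) = 1)
    (h' : c * δ' * Complex.exp (τ' * a * Complex.I) = 1) :
    quadPoint δ τ x ψ = quadPoint δ' τ' x ψ := by
  have hE := Complex.exp_ne_zero (a * Complex.I)
  rcases hψ with ⟨rfl, hsq⟩ | ⟨rfl, hsq⟩
  · have key : ∀ {τ : ℝ}, τ = 1 ∨ τ = -1 →
        Complex.exp (τ * a * Complex.I) = Complex.exp ((1 : ℝ) * a * Complex.I) := by
      rintro τ (rfl | rfl)
      · rfl
      · simp only [Complex.ofReal_neg, Complex.ofReal_one, neg_mul, one_mul, Complex.exp_neg]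
        exact inv_eq_of_mul_eq_one_left (by rw [← sq]; exact hsq)
    rw [key hτ] at h
    rw [key hτ'] at h'
    rw [sign_eq_of_phase h h']
    simp [quadPoint]
  · have key : ∀ {δ τ : ℝ}, τ = 1 ∨ τ = -1 → c * δ * Complex.exp (τ * a * Complex.I) = 1 →
        c * (δ * τ : ℝ) * Complex.exp ((1 : ℝ) * a * Complex.I) = 1 := by
      rintro δ τ (rfl | rfl) h
      · simpa using h
      · rw [← h]
        simp only [Complex.ofReal_neg, Complex.ofReal_one, neg_mul, one_mul, Complex.exp_neg,
          Complex.ofReal_mul]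
        field_simp
        linear_combination (-c * δ) * hsq
    have h1 := sign_eq_of_phase (key hτ h) (key hτ' h')
    refine Complex.ext ?_ ?_
    · rw [quadPoint_re hτ, quadPoint_re hτ', Real.cos_pi_div_two]; ring
    · rw [quadPoint_im hτ, quadPoint_im hτ', h1]

lemma exp_alpha_sq_of_psi_eq_zero {x : ℝ} (h : D.psi x = 0) :
    Complex.exp (D.alpha x * Complex.I) ^ 2 = 1 := by
  obtain ⟨n, hn⟩ := exists_alpha_eq_of_psi_eq_zero h
  rw [← Complex.exp_nat_mul, Complex.exp_eq_one_iff]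
  exact ⟨n, by rw [hn]; push_cast; ring⟩

lemma exp_alpha_sq_of_psi_eq_pi (hm : D.m = 2 * j + 1) {x : ℝ} (h : D.psi x = Real.pi) :
    Complex.exp (D.alpha x * Complex.I) ^ 2 = -1 := by
  obtain ⟨n, hn⟩ := exists_alpha_eq_of_psi_eq_pi h
  have : Complex.exp (D.alpha x * Complex.I) ^ 2 = Complex.exp (Real.pi * Complex.I) *
      Complex.exp (((j + n : ℤ) : ℂ) * (2 * Real.pi * Complex.I)) := by
    rw [← Complex.exp_nat_mul, ← Complex.exp_add, hn, hm]
    congr 1; push_cast; ring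
  rw [this, Complex.exp_int_mul_two_pi_mul_I, Complex.exp_pi_mul_I, mul_one]

lemma unitPhase_sq_eq {δ τ a : ℝ} {c E : ℂ} (hδ : δ = 1 ∨ δ = -1) (hτ : τ = 1 ∨ τ = -1)
    (hE : Complex.exp (a * Complex.I) ^ 2 = E) (hE2 : E = 1 ∨ E = -1)
    (h : c * δ * Complex.exp (τ * a * Complex.I) = 1) : c ^ 2 = E := by
  have hδ2 : (δ : ℂ) ^ 2 = 1 := by rcases hδ with rfl | rfl <;> simp
  have h1 : Complex.exp (τ * a * Complex.I) ^ 2 = E := by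
    rcases hτ with rfl | rfl
    · simpa using hE
    · simp only [Complex.ofReal_neg, Complex.ofReal_one, neg_mul, one_mul, Complex.exp_neg, inv_pow,
        hE]
      rcases hE2 with rfl | rfl <;> norm_num
  have h2 := congrArg (· ^ 2) h
  simp only [mul_pow, hδ2, h1, mul_one, one_pow] at h2
  rcases hE2 with rfl | rfl
  · simpa using h2
  · linear_combination -h2

lemma unitPhase_sq_re (hε : ε = 1 ∨ ε = -1) : (unitPhase ε γ ^ 2).re = Real.cos (2 * γ) := by
  have hε2 : (ε : ℂ) ^ 2 = 1 := by rcases hε with rfl | rfl <;> simp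
  rw [unitPhase, mul_pow, hε2, one_mul, ← Complex.exp_nat_mul,
    show ((2 : ℕ) : ℂ) * (γ * Complex.I) = ((2 * γ : ℝ) : ℂ) * Complex.I by push_cast; ring,
    Complex.exp_ofReal_mul_I_re]

/-- On the real axis `alpha` is a multiple of π, so the phase condition gives c² = 1. On the
imaginary axis it is an odd multiple of π/2, and the next lemma has c² = -1. -/
lemma eq_zero_of_psi_eq_zero (hγ0 : 0 ≤ γ) (hγ : γ ≤ Real.pi / 2) (hε : ε = 1 ∨ ε = -1)
    {δ τ x : ℝ} (hδ : δ = 1 ∨ δ = -1) (hτ : τ = 1 ∨ τ = -1)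
    (hph : unitPhase ε γ * δ * Complex.exp (τ * D.alpha x * Complex.I) = 1) (h : D.psi x = 0) :
    γ = 0 := by
  have h1 := unitPhase_sq_eq hδ hτ (exp_alpha_sq_of_psi_eq_zero h) (Or.inl rfl) hph
  have h2 := unitPhase_sq_re (γ := γ) hε
  rw [h1, Complex.one_re, ← Real.cos_zero] at h2
  have := Real.injOn_cos (Set.left_mem_Icc.2 Real.pi_pos.le) ⟨by linarith, by linarith⟩ h2
  linarith

lemma eq_pi_div_two_of_psi_eq_pi (hm : D.m = 2 * j + 1) (hγ0 : 0 ≤ γ) (hγ : γ ≤ Real.pi / 2)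
    (hε : ε = 1 ∨ ε = -1) {δ τ x : ℝ} (hδ : δ = 1 ∨ δ = -1) (hτ : τ = 1 ∨ τ = -1)
    (hph : unitPhase ε γ * δ * Complex.exp (τ * D.alpha x * Complex.I) = 1)
    (h : D.psi x = Real.pi) : γ = Real.pi / 2 := by
  have h1 := unitPhase_sq_eq hδ hτ (exp_alpha_sq_of_psi_eq_pi hm h) (Or.inr rfl) hph
  have h2 := unitPhase_sq_re (γ := γ) hε
  rw [h1, Complex.neg_re, Complex.one_re, ← Real.cos_pi] at h2
  have := Real.injOn_cos (Set.right_mem_Icc.2 Real.pi_pos.le) ⟨by linarith, by linarith⟩ h2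
  linarith

-- n₁ belongs to the left end of the plateau through x and n₂ to the right end. The properties of n₁
-- are required only if a left end exists, since for the initial plateau n₁ is the unused index 0.
open Classical in
lemma encard_index_of_boundary_aux (hm : D.m = 2 * j + 1) (hγ0 : 0 ≤ γ) (hγ : γ ≤ Real.pi / 2)
    (hε : ε = 1 ∨ ε = -1) {δ τ x : ℝ} (hδ : δ = 1 ∨ δ = -1) (hτ : τ = 1 ∨ τ = -1)
    (ht : D.psi x = 0 ∨ D.psi x = Real.pi)
    (hph : unitPhase ε γ * δ * Complex.exp (τ * D.alpha x * Complex.I) = 1) {n₁ n₂ : ℕ}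
    (hne : n₁ ≠ n₂) (hn₂ : 1 ≤ n₂) (hl₂ : level j γ n₂ = D.alpha x) (hf₂ : ¬ IsFirst γ n₂)
    (h₁ : IsLeast {y | D.alpha y = D.alpha x} x →
      1 ≤ n₁ ∧ level j γ n₁ = D.alpha x ∧ IsFirst γ n₁)
    (h₃ : ∀ n, 1 ≤ n → level j γ n = D.alpha x → n = n₁ ∨ n = n₂) :
    {n : ℕ | 1 ≤ n ∧ D.ZeroExists j γ n ∧ D.zeroSeq j ε γ n = quadPoint δ τ x (D.psi x)}.encard =
      (if IsLeast {y | D.alpha y = D.alpha x} x then 1 else 0) +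
      (if IsGreatest {y | D.alpha y = D.alpha x} x then 1 else 0) := by
  have hm0 : 0 < D.m := by rw [hm]; positivity
  have hmem : ∀ n, (1 ≤ n ∧ D.ZeroExists j γ n ∧ D.zeroSeq j ε γ n = quadPoint δ τ x (D.psi x)) ↔
      1 ≤ n ∧ level j γ n = D.alpha x ∧ D.HitExists (IsFirst γ n) (D.alpha x) ∧
        D.hit (IsFirst γ n) (D.alpha x) = x := by
    intro n
    constructor
    · rintro ⟨hn, hex, hz⟩
      have hx := hit_eq_of_zeroSeq_eq hε hδ hz
      have hα := alpha_hit hm hγ0 hγ hn hex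
      rw [hx] at hα
      exact ⟨hn, hα.symm, hα ▸ hex, hα ▸ hx⟩
    · rintro ⟨hn, hlev, hex, hx⟩
      rw [← hlev] at hex hx
      refine ⟨hn, hex, ?_⟩
      rw [zeroSeq, hx]
      have h1 := phase_level (j := j) (γ := γ) hε hn
      rw [hlev] at h1
      refine quadPoint_eq_of_boundary (conjSign_eq n) hτ ?_ h1 hph
      exact ht.imp (fun h => ⟨h, exp_alpha_sq_of_psi_eq_zero h⟩)
        fun h => ⟨h, exp_alpha_sq_of_psi_eq_pi hm h⟩
  have hset : {n : ℕ | 1 ≤ n ∧ D.ZeroExists j γ n ∧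
      D.zeroSeq j ε γ n = quadPoint δ τ x (D.psi x)} =
      (if IsLeast {y | D.alpha y = D.alpha x} x then {n₁} else ∅) ∪
      (if IsGreatest {y | D.alpha y = D.alpha x} x then {n₂} else ∅) := by
    ext n
    rw [Set.mem_ofPred_eq, hmem, Set.mem_union]
    constructor
    · rintro ⟨hn, hlev, hhit⟩
      by_cases hf : IsFirst γ n
      · left
        have hL := (hit_eq_iff_of_first hm0 hf
          (hlev ▸ level_lt_of_isFirst hm hγ0 hγ hn hf)).1 hhit
        rw [if_pos hL]
        rcases h₃ n hn hlev with rfl | rfl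
        · rfl
        · exact absurd hf hf₂
      · right
        have hG := (hit_eq_iff_of_not_first hm0 hf).1 hhit
        rw [if_pos hG]
        rcases h₃ n hn hlev with rfl | rfl
        · have hL : ¬ IsLeast {y | D.alpha y = D.alpha x} x := fun hL => hf (h₁ hL).2.2
          exfalso
          have hF : ∀ l, 1 ≤ l → level j γ l = D.alpha x → l = n ∨ l = n₂ := h₃
          -- Two indices of right-end type have the same parity, and being at the same level they
          -- would coincide.
          have hcs : conjSign n = conjSign n₂ := by
            by_cases hγ' : γ = Real.pi / 2
            · have o : ∀ l, ¬ IsFirst γ l → Odd l := fun l hl => by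
                by_contra hodd
                exact hl ⟨fun h => absurd h hodd, fun h => absurd hγ' h⟩
              rw [conjSign, conjSign, if_pos (o n hf), if_pos (o n₂ hf₂)]
            · have o : ∀ l, ¬ IsFirst γ l → ¬ Odd l := fun l hl hodd =>
                hl ⟨fun _ => hγ', fun _ => hodd⟩
              rw [conjSign, conjSign, if_neg (o n hf), if_neg (o n₂ hf₂)]
          exact hne (eq_of_level_eq_of_conjSign_eq hn hn₂ (hlev.trans hl₂.symm) hcs)
        · rfl
    · rintro (h | h)
      · split_ifs at h with hL
        · obtain rfl : n = n₁ := h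
          obtain ⟨a1, a2, a3⟩ := h₁ hL
          exact ⟨a1, a2, (hit_eq_iff_of_first hm0 a3
            (a2 ▸ level_lt_of_isFirst hm hγ0 hγ a1 a3)).2 hL⟩
        · exact absurd h (Set.notMem_empty n)
      · split_ifs at h with hG
        · obtain rfl : n = n₂ := h
          exact ⟨hn₂, hl₂, (hit_eq_iff_of_not_first hm0 hf₂).2 hG⟩
        · exact absurd h (Set.notMem_empty n)
  rw [hset, Set.encard_union_eq]
  · congr 1 <;> split_ifs <;> simp
  · split_ifs <;> simp [hne]

open Classical in
lemma encard_index_of_boundary (hm : D.m = 2 * j + 1) (hγ0 : 0 ≤ γ) (hγ : γ ≤ Real.pi / 2)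
    (hε : ε = 1 ∨ ε = -1) {δ τ x : ℝ} (hδ : δ = 1 ∨ δ = -1) (hτ : τ = 1 ∨ τ = -1)
    (ht : D.psi x = 0 ∨ D.psi x = Real.pi)
    (hph : unitPhase ε γ * δ * Complex.exp (τ * D.alpha x * Complex.I) = 1) :
    {n : ℕ | 1 ≤ n ∧ D.ZeroExists j γ n ∧ D.zeroSeq j ε γ n = quadPoint δ τ x (D.psi x)}.encard =
      (if IsLeast {y | D.alpha y = D.alpha x} x then 1 else 0) +
      (if IsGreatest {y | D.alpha y = D.alpha x} x then 1 else 0) := by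
  have hm0 : 0 < D.m := by rw [hm]; positivity
  have hπ0 := Real.pi_pos
  have hle := alpha_le hm0 x
  rcases ht with h | h
  · have hγ' := eq_zero_of_psi_eq_zero hγ0 hγ hε hδ hτ hph h
    obtain ⟨l, hl⟩ := exists_alpha_eq_of_psi_eq_zero h
    rw [hl, hm] at hle
    have h1 : (l : ℝ) < j + 1 := by
      by_contra hcon
      have := mul_le_mul_of_nonneg_right (not_lt.1 hcon) hπ0.le
      linarith
    have h2 : l < j + 1 := by exact_mod_cast h1
    obtain ⟨k, hk⟩ := Int.eq_ofNat_of_zero_le (show 0 ≤ (j : ℤ) - l by omega)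
    have h3 : (j : ℝ) - k = l := by
      have : (j : ℝ) - l = k := by exact_mod_cast hk
      linarith
    have hodd : level j γ (2 * k + 1) = D.alpha x := by rw [level_odd, hl, h3, hγ']; ring
    have heven : level j γ (2 * k + 2) = D.alpha x := by rw [level_even, hl, h3, hγ']; ring
    have hγne : γ ≠ Real.pi / 2 := by linarith
    refine encard_index_of_boundary_aux hm hγ0 hγ hε hδ hτ (Or.inl h) hph (n₁ := 2 * k + 1)
      (n₂ := 2 * k + 2) (by omega) (by omega) heven (by rwa [isFirst_even])
      (fun _ => ⟨by omega, hodd, (isFirst_odd k).2 hγne⟩) fun n hn hn' => ?_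
    obtain ⟨i, rfl | rfl⟩ := exists_eq_of_one_le hn
    · left
      exact eq_of_level_eq_of_conjSign_eq hn (by omega) (hn'.trans hodd.symm)
        (by rw [conjSign_odd, conjSign_odd])
    · right
      exact eq_of_level_eq_of_conjSign_eq hn (by omega) (hn'.trans heven.symm)
        (by rw [conjSign_even, conjSign_even])
  · have hγ' := eq_pi_div_two_of_psi_eq_pi hm hγ0 hγ hε hδ hτ hph h
    obtain ⟨l, hl⟩ := exists_alpha_eq_of_psi_eq_pi h
    rw [hl, hm] at hle
    have h1 : (l : ℝ) < 1 := by
      by_contra hcon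
      have := mul_le_mul_of_nonneg_right (not_lt.1 hcon) hπ0.le
      linarith
    have h2 : l < 1 := by exact_mod_cast h1
    obtain ⟨k, hk⟩ := Int.eq_ofNat_of_zero_le (show 0 ≤ -l by omega)
    have h3 : (l : ℝ) = -k := by
      have : -(l : ℝ) = k := by exact_mod_cast hk
      linarith
    have hodd : level j γ (2 * k + 1) = D.alpha x := by
      rw [level_odd, hl, h3, hγ', hm]; ring
    have hlast : ¬ IsFirst γ (2 * k + 1) := by rw [isFirst_odd]; exact not_not.2 hγ'
    have hfirst : ∀ i, level j γ (2 * i + 2) = D.alpha x → i + 1 = k := by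
      intro i hi
      rw [level_even, hl, h3, hγ', hm] at hi
      have h4 : ((j : ℝ) - i) = j + 1 - k := mul_right_cancel₀ hπ0.ne' (by linarith)
      have h5 : (i : ℝ) + 1 = k := by linarith
      exact_mod_cast h5
    -- For γ = π/2 the indices 2k and 2k + 1 share the level. If k = 0 the level is the initial
    -- value of `alpha`, which is attained arbitrarily far to the left.
    refine encard_index_of_boundary_aux hm hγ0 hγ hε hδ hτ (Or.inr h) hph (n₁ := 2 * k)
      (n₂ := 2 * k + 1) (by omega) (by omega) hodd hlast (fun hL => ?_) fun n hn hn' => ?_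
    · obtain ⟨i, rfl⟩ : ∃ i, k = i + 1 := by
        refine Nat.exists_eq_succ_of_ne_zero fun hk0 => ?_
        refine not_isLeast_of_alpha_eq hm0 ?_ hL
        rw [hl, h3, hk0]; simp
      rw [show 2 * (i + 1) = 2 * i + 2 by ring]
      refine ⟨by omega, ?_, (isFirst_even i).2 hγ'⟩
      rw [level_even, hl, h3, hγ', hm]; push_cast; ring
    · obtain ⟨i, rfl | rfl⟩ := exists_eq_of_one_le hn
      · right
        exact eq_of_level_eq_of_conjSign_eq hn (by omega) (hn'.trans hodd.symm)
          (by rw [conjSign_odd, conjSign_odd])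
      · left
        have := hfirst i hn'
        omega

/-- Every zero occurs in the sequence as often as its multiplicity says. -/
lemma encard_index (hm : D.m = 2 * j + 1) (hγ0 : 0 ≤ γ) (hγ : γ ≤ Real.pi / 2)
    (hε : ε = 1 ∨ ε = -1) (hf₀ : f₀ ≠ 0) (w : ℂ) :
    {n : ℕ | 1 ≤ n ∧ D.ZeroExists j γ n ∧ D.zeroSeq j ε γ n = w}.encard =
      analyticOrderAt (D.zeroFun j f₀ (unitPhase ε γ)) w := by
  have hc := norm_unitPhase (γ := γ) hε
  by_cases hw : D.zeroFun j f₀ (unitPhase ε γ) w = 0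
  · obtain ⟨δ, τ, x, hδ, hτ, rfl, hg, hph⟩ := exists_quadPoint_of_zeroFun_eq_zero hm hf₀ hc hw
    by_cases ht : D.psi x = 0 ∨ D.psi x = Real.pi
    · rw [encard_index_of_boundary hm hγ0 hγ hε hδ hτ ht hph,
        order_eq_of_boundary (abs_eq_one_of_eq hδ) hτ hm hf₀ hc ht hw]
    · push Not at ht
      have h0 := lt_of_le_of_ne (psi_nonneg (D := D) x) (Ne.symm ht.1)
      have hπ := lt_of_le_of_ne (psi_le_pi (D := D) x) ht.2
      rw [order_eq_one_of_interior (abs_eq_one_of_eq hδ) hτ hm hf₀ hc h0 hπ hw]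
      obtain ⟨n, hn⟩ := existsUnique_index_of_interior hm hγ0 hγ hε hδ hτ h0 hπ hph
      rw [hn, Set.encard_singleton]
  · rw [(analyticAt_zeroFun w).analyticOrderAt_eq_zero.2 hw, Set.encard_eq_zero]
    refine Set.eq_empty_of_forall_notMem fun n hn => hw ?_
    rw [← hn.2.2]
    exact zeroFun_zeroSeq hm hγ0 hγ hε hf₀ hn.1 hn.2.1

/-- `alpha` descends to jπ, while the first level is jπ + γ; for γ = π/2 the required strict
inequality holds as well. -/
lemma zeroExists_one (hm : D.m = 2 * j + 1) (hγ0 : 0 ≤ γ) : D.ZeroExists j γ 1 := by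
  obtain ⟨x, hx⟩ := exists_alpha_le (D := D)
    (by rw [hm]; linarith [Nat.cast_nonneg (α := ℝ) j])
  have hlev : level j γ 1 = j * Real.pi + γ := by simpa using level_odd j γ 0
  rw [hm] at hx
  unfold ZeroExists HitExists
  rw [hlev]
  split_ifs with hf
  · exact ⟨x, by linarith⟩
  · have h1 : ¬ (γ ≠ Real.pi / 2) := fun h => hf ((isFirst_odd 0).2 h)
    rw [not_not] at h1
    exact ⟨x, by linarith [Real.pi_pos]⟩

lemma isFirst_succ {n : ℕ} : IsFirst γ (n + 1) ↔ ¬ IsFirst γ n := by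
  unfold IsFirst
  rw [Nat.odd_add_one]
  tauto

lemma zeroExists_of_succ (hγ0 : 0 ≤ γ) (hγ : γ ≤ Real.pi / 2) {n : ℕ} (hn : 1 ≤ n)
    (h : D.ZeroExists j γ (n + 1)) : D.ZeroExists j γ n := by
  unfold ZeroExists HitExists at h ⊢
  by_cases hf : IsFirst γ n
  · rw [if_neg (by rw [isFirst_succ]; exact not_not.2 hf)] at h
    rw [if_pos hf]
    obtain ⟨x, hx⟩ := h
    exact ⟨x, hx.le.trans (level_succ_le hγ0 hγ hn)⟩
  · rw [if_pos (isFirst_succ.2 hf)] at h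
    rw [if_neg hf]
    obtain ⟨x, hx⟩ := h
    exact ⟨x, hx.trans_lt (level_succ_lt_of_not_isFirst hγ hn hf)⟩

lemma exists_length {P : ℕ → Prop} (h1 : P 1) (h : ∀ n, 1 ≤ n → P (n + 1) → P n) :
    ∃ ω : ℕ∞, 1 ≤ ω ∧ ∀ n : ℕ, 1 ≤ n → ((n : ℕ∞) ≤ ω ↔ P n) := by
  have hdown : ∀ n d, 1 ≤ n → P (n + d) → P n := by
    intro n d hn
    induction d with
    | zero => exact id
    | succ d ih => exact fun hd => ih (h (n + d) (by omega) hd)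
  by_cases hall : ∀ n, 1 ≤ n → P n
  · exact ⟨⊤, le_top, fun n hn => ⟨fun _ => hall n hn, fun _ => le_top⟩⟩
  · push Not at hall
    classical
    set N := Nat.find hall with hN
    have hN1 : 1 ≤ N := (Nat.find_spec hall).1
    have hNP : ¬ P N := (Nat.find_spec hall).2
    have hN2 : N ≠ 1 := fun h' => hNP (h' ▸ h1)
    refine ⟨((N - 1 : ℕ) : ℕ∞), by exact_mod_cast (by omega : 1 ≤ N - 1), fun n hn => ?_⟩
    rw [Nat.cast_le]
    constructor
    · intro hle
      by_contra hP
      exact Nat.find_min hall (m := n) (by omega) ⟨hn, hP⟩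
    · intro hP
      by_contra hcon
      obtain ⟨d, rfl⟩ : ∃ d, n = N + d := ⟨n - N, by omega⟩
      exact hNP (hdown N d hN1 hP)

lemma hit_lt_hit_succ (hm : D.m = 2 * j + 1) (hγ0 : 0 ≤ γ) (hγ : γ ≤ Real.pi / 2) {n : ℕ}
    (hn : 1 ≤ n) (h : D.ZeroExists j γ (n + 1)) (hlt : level j γ (n + 1) < level j γ n) :
    D.hit (IsFirst γ n) (level j γ n) < D.hit (IsFirst γ (n + 1)) (level j γ (n + 1)) := by
  have h1 := alpha_hit hm hγ0 hγ hn (zeroExists_of_succ hγ0 hγ hn h)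
  have h2 := alpha_hit hm hγ0 hγ (Nat.le_add_left 1 n) h
  by_contra hcon
  have := alpha_antitone (D := D) (not_lt.1 hcon)
  linarith

lemma hit_le_hit_succ (hm : D.m = 2 * j + 1) (hγ0 : 0 ≤ γ) (hγ : γ ≤ Real.pi / 2) {n : ℕ}
    (hn : 1 ≤ n) (h : D.ZeroExists j γ (n + 1)) :
    D.hit (IsFirst γ n) (level j γ n) ≤ D.hit (IsFirst γ (n + 1)) (level j γ (n + 1)) := by
  have hm0 : 0 < D.m := by rw [hm]; positivity
  rcases (level_succ_le (j := j) hγ0 hγ hn).lt_or_eq with hlt | heq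
  · exact (hit_lt_hit_succ hm hγ0 hγ hn h hlt).le
  -- For equal levels the `n`-th point is the left end of the plateau on which the next point lies.
  · have hf : IsFirst γ n := by
      by_contra hf
      exact absurd heq (level_succ_lt_of_not_isFirst hγ hn hf).ne
    have h1 := isLeast_hit hm0 hf (level_lt_of_isFirst hm hγ0 hγ hn hf)
      (zeroExists_of_succ hγ0 hγ hn h)
    have h2 := alpha_hit hm hγ0 hγ (Nat.le_add_left 1 n) h
    exact h1.2 (h2.trans heq)

end enumeration

end StripData

namespace StripData

variable {D : StripData} {j : ℕ} {ε γ : ℝ} {f₀ : ℂ}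

/-! ### Position of the zeros in the sequence -/

lemma levelSign_sq (j : ℕ) (hε : ε = 1 ∨ ε = -1) (n : ℕ) :
    levelSign j ε n * levelSign j ε n = 1 := by
  rcases levelSign_eq j hε n with h | h <;> rw [h] <;> norm_num

lemma levelSign_odd_succ (k : ℕ) : levelSign j ε (2 * k + 3) = -levelSign j ε (2 * k + 2) := by
  rw [show 2 * k + 3 = 2 * (k + 1) + 1 by ring, levelSign_odd, levelSign_even, ← add_assoc, pow_succ]
  ring

lemma conjSign_odd_succ (k : ℕ) : conjSign (2 * k + 3) = -1 := by
  rw [show 2 * k + 3 = 2 * (k + 1) + 1 by ring, conjSign_odd]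

lemma levelSign_one : levelSign j ε 1 = ε * (-1) ^ j := by simpa using levelSign_odd j ε 0

lemma conjSign_one : conjSign 1 = -1 := by simpa using conjSign_odd 0

lemma unitPhase_re : (unitPhase ε γ).re = ε * Real.cos γ := by
  rw [unitPhase, Complex.re_ofReal_mul, Complex.exp_ofReal_mul_I_re]

lemma unitPhase_im : (unitPhase ε γ).im = ε * Real.sin γ := by
  rw [unitPhase, Complex.im_ofReal_mul, Complex.exp_ofReal_mul_I_im]

lemma phase_hit (hm : D.m = 2 * j + 1) (hγ0 : 0 ≤ γ) (hγ : γ ≤ Real.pi / 2)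
    (hε : ε = 1 ∨ ε = -1) {n : ℕ} (hn : 1 ≤ n) (h : D.ZeroExists j γ n) :
    unitPhase ε γ * levelSign j ε n * Complex.exp (conjSign n *
      D.alpha (D.hit (IsFirst γ n) (level j γ n)) * Complex.I) = 1 := by
  rw [alpha_hit hm hγ0 hγ hn h]
  exact phase_level hε hn

lemma psi_hit_pos (hm : D.m = 2 * j + 1) (hγ0 : 0 < γ) (hγ : γ ≤ Real.pi / 2)
    {n : ℕ} (hn : 1 ≤ n) (h : D.ZeroExists j γ n) :
    0 < D.psi (D.hit (IsFirst γ n) (level j γ n)) :=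
  lt_of_le_of_ne (psi_nonneg _) fun h0 => hγ0.ne' (eq_zero_of_psi_eq_zero hγ0.le hγ (Or.inl rfl)
    (levelSign_eq j (Or.inl rfl) n) (conjSign_eq n)
    (phase_hit hm hγ0.le hγ (Or.inl rfl) hn h) h0.symm)

lemma psi_hit_lt_pi (hm : D.m = 2 * j + 1) (hγ0 : 0 ≤ γ) (hγ : γ < Real.pi / 2)
    {n : ℕ} (hn : 1 ≤ n) (h : D.ZeroExists j γ n) :
    D.psi (D.hit (IsFirst γ n) (level j γ n)) < Real.pi :=
  lt_of_le_of_ne (psi_le_pi _) fun h0 => hγ.ne (eq_pi_div_two_of_psi_eq_pi hm hγ0 hγ.le (Or.inl rfl)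
    (levelSign_eq j (Or.inl rfl) n) (conjSign_eq n)
    (phase_hit hm hγ0 hγ.le (Or.inl rfl) hn h) h0)

lemma zeroSeq_re (n : ℕ) : (D.zeroSeq j ε γ n).re = levelSign j ε n *
    (Real.exp (D.hit (IsFirst γ n) (level j γ n) / 2) *
      Real.cos (D.psi (D.hit (IsFirst γ n) (level j γ n)) / 2)) :=
  quadPoint_re (conjSign_eq n)

lemma zeroSeq_im (n : ℕ) : (D.zeroSeq j ε γ n).im = levelSign j ε n * conjSign n *
    (Real.exp (D.hit (IsFirst γ n) (level j γ n) / 2) *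
      Real.sin (D.psi (D.hit (IsFirst γ n) (level j γ n)) / 2)) :=
  quadPoint_im (conjSign_eq n)

lemma cos_half_psi_pos {x : ℝ} (h : D.psi x < Real.pi) : 0 < Real.cos (D.psi x / 2) :=
  Real.cos_pos_of_mem_Ioo ⟨by linarith [psi_nonneg (D := D) x, Real.pi_pos], by linarith⟩

lemma sin_half_psi_pos {x : ℝ} (h : 0 < D.psi x) : 0 < Real.sin (D.psi x / 2) :=
  Real.sin_pos_of_pos_of_lt_pi (by linarith) (by linarith [psi_le_pi (D := D) x])

lemma levelSign_mul_re_pos (hm : D.m = 2 * j + 1) (hγ0 : 0 ≤ γ) (hγ : γ < Real.pi / 2)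
    (hε : ε = 1 ∨ ε = -1) {n : ℕ} (hn : 1 ≤ n) (h : D.ZeroExists j γ n) :
    0 < levelSign j ε n * (D.zeroSeq j ε γ n).re := by
  rw [zeroSeq_re, ← mul_assoc, levelSign_sq j hε, one_mul]
  exact mul_pos (Real.exp_pos _) (cos_half_psi_pos (psi_hit_lt_pi hm hγ0 hγ hn h))

lemma levelSign_mul_im (hε : ε = 1 ∨ ε = -1) (n : ℕ) :
    levelSign j ε n * (conjSign n * (D.zeroSeq j ε γ n).im) =
      Real.exp (D.hit (IsFirst γ n) (level j γ n) / 2) *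
      Real.sin (D.psi (D.hit (IsFirst γ n) (level j γ n)) / 2) := by
  have h1 : conjSign n * conjSign n = 1 := by
    rcases conjSign_eq n with h | h <;> rw [h] <;> norm_num
  have h2 := levelSign_sq j hε n
  rw [zeroSeq_im]
  linear_combination (Real.exp (D.hit (IsFirst γ n) (level j γ n) / 2) *
      Real.sin (D.psi (D.hit (IsFirst γ n) (level j γ n)) / 2)) * (levelSign j ε n * levelSign j ε n *
      h1 + h2)

lemma levelSign_mul_im_pos (hm : D.m = 2 * j + 1) (hγ0 : 0 < γ) (hγ : γ ≤ Real.pi / 2)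
    (hε : ε = 1 ∨ ε = -1) {n : ℕ} (hn : 1 ≤ n) (h : D.ZeroExists j γ n) :
    0 < levelSign j ε n * (conjSign n * (D.zeroSeq j ε γ n).im) := by
  rw [levelSign_mul_im hε]
  exact mul_pos (Real.exp_pos _) (sin_half_psi_pos (psi_hit_pos hm hγ0 hγ hn h))

lemma levelSign_mul_im_nonneg (hε : ε = 1 ∨ ε = -1) (n : ℕ) :
    0 ≤ levelSign j ε n * (conjSign n * (D.zeroSeq j ε γ n).im) := by
  rw [levelSign_mul_im hε]
  exact mul_nonneg (Real.exp_pos _).le (Real.sin_nonneg_of_nonneg_of_le_pi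
    (by linarith [psi_nonneg (D := D) (D.hit (IsFirst γ n) (level j γ n))])
    (by linarith [psi_le_pi (D := D) (D.hit (IsFirst γ n) (level j γ n)), Real.pi_pos]))

lemma norm_zeroSeq_pos (hε : ε = 1 ∨ ε = -1) (n : ℕ) : 0 < ‖D.zeroSeq j ε γ n‖ := by
  rw [norm_zeroSeq hε]; exact Real.exp_pos _

lemma norm_zeroSeq_le (hm : D.m = 2 * j + 1) (hγ0 : 0 ≤ γ) (hγ : γ ≤ Real.pi / 2)
    (hε : ε = 1 ∨ ε = -1) {n : ℕ} (hn : 1 ≤ n) (h : D.ZeroExists j γ (n + 1)) :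
    ‖D.zeroSeq j ε γ n‖ ≤ ‖D.zeroSeq j ε γ (n + 1)‖ := by
  rw [norm_zeroSeq hε, norm_zeroSeq hε, Real.exp_le_exp]
  linarith [hit_le_hit_succ hm hγ0 hγ hn h]

lemma norm_zeroSeq_lt (hm : D.m = 2 * j + 1) (hγ0 : 0 ≤ γ) (hγ : γ ≤ Real.pi / 2)
    (hε : ε = 1 ∨ ε = -1) {n : ℕ} (hn : 1 ≤ n) (h : D.ZeroExists j γ (n + 1))
    (hlt : level j γ (n + 1) < level j γ n) :
    ‖D.zeroSeq j ε γ n‖ < ‖D.zeroSeq j ε γ (n + 1)‖ := by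
  rw [norm_zeroSeq hε, norm_zeroSeq hε, Real.exp_lt_exp]
  linarith [hit_lt_hit_succ hm hγ0 hγ hn h hlt]

/-! ### Position and multiplicity of all zeros -/

lemma re_ne_zero_of_zero (hm : D.m = 2 * j + 1) (hγ0 : 0 ≤ γ) (hγ : γ < Real.pi / 2)
    (hε : ε = 1 ∨ ε = -1) (hf₀ : f₀ ≠ 0) {w : ℂ} (hw : D.zeroFun j f₀ (unitPhase ε γ) w = 0) :
    w.re ≠ 0 := by
  obtain ⟨δ, τ, x, hδ, hτ, rfl, hg, hph⟩ :=
    exists_quadPoint_of_zeroFun_eq_zero hm hf₀ (norm_unitPhase hε) hw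
  have h1 : D.psi x < Real.pi := lt_of_le_of_ne (psi_le_pi _) fun h =>
    hγ.ne (eq_pi_div_two_of_psi_eq_pi hm hγ0 hγ.le hε hδ hτ hph h)
  rw [quadPoint_re hτ]
  exact mul_ne_zero (by rcases hδ with rfl | rfl <;> norm_num)
    (mul_pos (Real.exp_pos _) (cos_half_psi_pos h1)).ne'

lemma im_ne_zero_of_zero (hm : D.m = 2 * j + 1) (hγ0 : 0 < γ) (hγ : γ ≤ Real.pi / 2)
    (hε : ε = 1 ∨ ε = -1) (hf₀ : f₀ ≠ 0) {w : ℂ} (hw : D.zeroFun j f₀ (unitPhase ε γ) w = 0) :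
    w.im ≠ 0 := by
  obtain ⟨δ, τ, x, hδ, hτ, rfl, hg, hph⟩ :=
    exists_quadPoint_of_zeroFun_eq_zero hm hf₀ (norm_unitPhase hε) hw
  have h1 : 0 < D.psi x := lt_of_le_of_ne (psi_nonneg _) fun h =>
    hγ0.ne' (eq_zero_of_psi_eq_zero hγ0.le hγ hε hδ hτ hph h.symm)
  rw [quadPoint_im hτ]
  exact mul_ne_zero (by rcases hδ with rfl | rfl <;> rcases hτ with rfl | rfl <;> norm_num)
    (mul_pos (Real.exp_pos _) (sin_half_psi_pos h1)).ne'

lemma order_eq_one_of_re_ne_zero_of_im_ne_zero (hm : D.m = 2 * j + 1)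
    (hε : ε = 1 ∨ ε = -1) (hf₀ : f₀ ≠ 0) {w : ℂ} (hw : D.zeroFun j f₀ (unitPhase ε γ) w = 0)
    (hre : w.re ≠ 0) (him : w.im ≠ 0) :
    analyticOrderAt (D.zeroFun j f₀ (unitPhase ε γ)) w = 1 := by
  obtain ⟨δ, τ, x, hδ, hτ, rfl, hg, hph⟩ :=
    exists_quadPoint_of_zeroFun_eq_zero hm hf₀ (norm_unitPhase hε) hw
  rw [quadPoint_re hτ] at hre
  rw [quadPoint_im hτ] at him
  refine order_eq_one_of_interior (abs_eq_one_of_eq hδ) hτ hm hf₀ (norm_unitPhase hε)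
    (lt_of_le_of_ne (psi_nonneg _) fun h => him ?_) (lt_of_le_of_ne (psi_le_pi _) fun h => hre ?_) hw
  · rw [← h]; simp
  · rw [h]; simp

lemma order_eq_one_or_two (hm : D.m = 2 * j + 1)
    (hε : ε = 1 ∨ ε = -1) (hf₀ : f₀ ≠ 0) {w : ℂ} (hw : D.zeroFun j f₀ (unitPhase ε γ) w = 0) :
    analyticOrderAt (D.zeroFun j f₀ (unitPhase ε γ)) w = 1 ∨
      analyticOrderAt (D.zeroFun j f₀ (unitPhase ε γ)) w = 2 := by
  obtain ⟨δ, τ, x, hδ, hτ, rfl, hg, hph⟩ :=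
    exists_quadPoint_of_zeroFun_eq_zero hm hf₀ (norm_unitPhase hε) hw
  have hne : analyticOrderAt (D.zeroFun j f₀ (unitPhase ε γ)) (quadPoint δ τ x (D.psi x)) ≠ 0 :=
    (analyticAt_zeroFun _).analyticOrderAt_ne_zero.2 hw
  by_cases ht : D.psi x = 0 ∨ D.psi x = Real.pi
  · have h2 := order_le_two_of_boundary (abs_eq_one_of_eq hδ) hτ hm hf₀
      (norm_unitPhase (γ := γ) hε) ht hg
    generalize analyticOrderAt (D.zeroFun j f₀ (unitPhase ε γ)) (quadPoint δ τ x (D.psi x)) = a at *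
    lift a to ℕ using ne_top_of_le_ne_top (by decide) h2
    norm_cast at *
    omega
  · push Not at ht
    exact Or.inl (order_eq_one_of_interior (abs_eq_one_of_eq hδ) hτ hm hf₀ (norm_unitPhase hε)
      (lt_of_le_of_ne (psi_nonneg _) ht.1.symm) (lt_of_le_of_ne (psi_le_pi _) ht.2) hw)

/-- The signs of Re and Im of the `n`-th zero are δ and δτ. From odd to even index only τ changes,
so Im changes sign; from even to odd both δ and τ change, so Re changes sign. Odd indices lie in the
second or fourth quadrant, even ones in the first or third, which gives counterclockwise rotation.
-/
lemma quadrant_step (hm : D.m = 2 * j + 1) (hγ0 : 0 < γ) (hγ : γ < Real.pi / 2)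
    (hε : ε = 1 ∨ ε = -1) {n : ℕ} (hn : 1 ≤ n) (h : D.ZeroExists j γ (n + 1)) :
    (D.zeroSeq j ε γ n ∈ Q₁ → D.zeroSeq j ε γ (n + 1) ∈ Q₂) ∧
    (D.zeroSeq j ε γ n ∈ Q₂ → D.zeroSeq j ε γ (n + 1) ∈ Q₃) ∧
    (D.zeroSeq j ε γ n ∈ Q₃ → D.zeroSeq j ε γ (n + 1) ∈ Q₄) ∧
    (D.zeroSeq j ε γ n ∈ Q₄ → D.zeroSeq j ε γ (n + 1) ∈ Q₁) := by
  have h' := zeroExists_of_succ hγ0.le hγ.le hn h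
  have r1 := levelSign_mul_re_pos hm hγ0.le hγ hε hn h'
  have r2 := levelSign_mul_re_pos hm hγ0.le hγ hε (Nat.le_add_left 1 n) h
  have i1 := levelSign_mul_im_pos hm hγ0 hγ.le hε hn h'
  have i2 := levelSign_mul_im_pos hm hγ0 hγ.le hε (Nat.le_add_left 1 n) h
  simp only [Q₁, Q₂, Q₃, Q₄, Set.mem_ofPred_eq]
  generalize D.zeroSeq j ε γ n = z at *
  generalize D.zeroSeq j ε γ (n + 1) = z' at *
  obtain ⟨k, rfl | rfl⟩ := exists_eq_of_one_le hn
  · rw [conjSign_odd] at i1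
    rw [conjSign_even] at i2
    rw [levelSign_even, ← levelSign_odd] at i2 r2
    rcases levelSign_eq j hε (2 * k + 1) with hs | hs <;> rw [hs] at r1 r2 i1 i2 <;>
      refine ⟨?_, ?_, ?_, ?_⟩ <;> rintro ⟨a, b⟩ <;> constructor <;> linarith
  · rw [conjSign_even] at i1
    rw [conjSign_odd_succ] at i2
    rw [levelSign_odd_succ] at i2 r2
    rcases levelSign_eq j hε (2 * k + 2) with hs | hs <;> rw [hs] at r1 r2 i1 i2 <;>
      refine ⟨?_, ?_, ?_, ?_⟩ <;> rintro ⟨a, b⟩ <;> constructor <;> linarith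

lemma re_first_zero (hm : D.m = 2 * j + 1) (hγ0 : 0 ≤ γ) (hγ : γ < Real.pi / 2)
    (hε : ε = 1 ∨ ε = -1) :
    0 < (-1) ^ j * (unitPhase ε γ).re * (D.zeroSeq j ε γ 1).re := by
  have h1 := levelSign_mul_re_pos hm hγ0 hγ hε le_rfl (zeroExists_one hm hγ0)
  have h2 : 0 < Real.cos γ := Real.cos_pos_of_mem_Ioo ⟨by linarith [Real.pi_pos], hγ⟩
  rw [levelSign_one] at h1
  rw [unitPhase_re]
  have := mul_pos h2 h1
  linarith

lemma im_first_zero (hm : D.m = 2 * j + 1) (hγ0 : 0 < γ) (hγ : γ ≤ Real.pi / 2)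
    (hε : ε = 1 ∨ ε = -1) :
    (-1) ^ j * (unitPhase ε γ).im * (D.zeroSeq j ε γ 1).im < 0 := by
  have h1 := levelSign_mul_im_pos hm hγ0 hγ hε le_rfl (zeroExists_one hm hγ0.le)
  have h2 : 0 < Real.sin γ := Real.sin_pos_of_pos_of_lt_pi hγ0 (by linarith [Real.pi_pos])
  rw [levelSign_one, conjSign_one] at h1
  rw [unitPhase_im]
  have := mul_pos h2 h1
  linarith

lemma re_mul_im_first_zero_nonpos (hm : D.m = 2 * j + 1) (hγ0 : 0 ≤ γ) (hγ : γ < Real.pi / 2)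
    (hε : ε = 1 ∨ ε = -1) : (D.zeroSeq j ε γ 1).re * (D.zeroSeq j ε γ 1).im ≤ 0 := by
  have h1 := levelSign_mul_re_pos hm hγ0 hγ hε le_rfl (zeroExists_one hm hγ0)
  have h2 := levelSign_mul_im_nonneg (D := D) (j := j) (γ := γ) hε 1
  rw [conjSign_one] at h2
  have h3 := levelSign_sq j hε 1
  nlinarith [mul_nonneg h1.le h2]

lemma re_mul_im_first_zero_neg (hm : D.m = 2 * j + 1) (hγ0 : 0 < γ) (hγ : γ < Real.pi / 2)
    (hε : ε = 1 ∨ ε = -1) : (D.zeroSeq j ε γ 1).re * (D.zeroSeq j ε γ 1).im < 0 := by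
  have h1 := levelSign_mul_re_pos hm hγ0.le hγ hε le_rfl (zeroExists_one hm hγ0.le)
  have h2 := levelSign_mul_im_pos hm hγ0 hγ.le hε le_rfl (zeroExists_one hm hγ0.le)
  rw [conjSign_one] at h2
  rcases levelSign_eq j hε 1 with hs | hs <;> rw [hs] at h1 h2 <;> nlinarith [mul_pos h1 h2]

lemma hit_eq_of_norm_eq (hε : ε = 1 ∨ ε = -1) {n l : ℕ}
    (h : ‖D.zeroSeq j ε γ n‖ = ‖D.zeroSeq j ε γ l‖) :
    D.hit (IsFirst γ n) (level j γ n) = D.hit (IsFirst γ l) (level j γ l) := by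
  rw [norm_zeroSeq hε, norm_zeroSeq hε] at h
  linarith [Real.exp_injective h]

lemma hit_ne_of_norm_lt {n l : ℕ} (hε : ε = 1 ∨ ε = -1)
    (h : ‖D.zeroSeq j ε γ n‖ < ‖D.zeroSeq j ε γ l‖) :
    D.hit (IsFirst γ n) (level j γ n) ≠ D.hit (IsFirst γ l) (level j γ l) := by
  rw [norm_zeroSeq hε, norm_zeroSeq hε, Real.exp_lt_exp] at h
  intro h'
  linarith

lemma sign_eq_neg_sign {s a b : ℝ} (hs : s = 1 ∨ s = -1) (ha : 0 < s * a) (hb : 0 < -s * b) :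
    Real.sign a = -Real.sign b := by
  rcases hs with rfl | rfl
  · rw [Real.sign_of_pos (by linarith), Real.sign_of_neg (by linarith), neg_neg]
  · rw [Real.sign_of_neg (by linarith), Real.sign_of_pos (by linarith)]

lemma conj_eq_of_norm_eq (hε : ε = 1 ∨ ε = -1) {k : ℕ}
    (h : ‖D.zeroSeq j ε 0 (2 * k + 1)‖ = ‖D.zeroSeq j ε 0 (2 * k + 2)‖) :
    D.zeroSeq j ε 0 (2 * k + 1) = (starRingEnd ℂ) (D.zeroSeq j ε 0 (2 * k + 2)) := by
  have := hit_eq_of_norm_eq hε h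
  rw [zeroSeq, zeroSeq, this, levelSign_odd, levelSign_even, conjSign_odd, conjSign_even,
    conj_quadPoint]

/-- Different moduli at the same level of `alpha` mean a plateau, hence an axis; γ = 0 excludes the
imaginary one, and the common `levelSign` places both zeros on the same half-axis. -/
lemma arg_eq_of_norm_lt (hm : D.m = 2 * j + 1) (hε : ε = 1 ∨ ε = -1) {k : ℕ}
    (hex : D.ZeroExists j 0 (2 * k + 2))
    (h : ‖D.zeroSeq j ε 0 (2 * k + 1)‖ < ‖D.zeroSeq j ε 0 (2 * k + 2)‖) :
    (D.zeroSeq j ε 0 (2 * k + 1)).arg = (D.zeroSeq j ε 0 (2 * k + 2)).arg ∧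
      ((D.zeroSeq j ε 0 (2 * k + 2)).arg = 0 ∨
        (D.zeroSeq j ε 0 (2 * k + 2)).arg = Real.pi) := by
  have hπ : 0 < Real.pi / 2 := by linarith [Real.pi_pos]
  have hex' : D.ZeroExists j 0 (2 * k + 1) := zeroExists_of_succ le_rfl hπ.le (by omega) hex
  have hα : D.alpha (D.hit (IsFirst 0 (2 * k + 1)) (level j 0 (2 * k + 1))) =
      D.alpha (D.hit (IsFirst 0 (2 * k + 2)) (level j 0 (2 * k + 2))) := by
    rw [alpha_hit hm le_rfl hπ.le (by omega) hex', alpha_hit hm le_rfl hπ.le (by omega) hex,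
      level_odd, level_even, add_zero, sub_zero]
  have r1 := levelSign_mul_re_pos hm le_rfl hπ hε (by omega) hex'
  have r2 := levelSign_mul_re_pos hm le_rfl hπ hε (by omega) hex
  have hlt := psi_hit_lt_pi hm le_rfl hπ (by omega) hex
  rcases psi_of_alpha_eq (hit_ne_of_norm_lt hε h) hα with h0 | h0
  · have i1 : (D.zeroSeq j ε 0 (2 * k + 1)).im = 0 := by rw [zeroSeq_im, h0.1]; simp
    have i2 : (D.zeroSeq j ε 0 (2 * k + 2)).im = 0 := by rw [zeroSeq_im, h0.2]; simp
    rw [levelSign_even, ← levelSign_odd] at r2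
    rcases levelSign_eq j hε (2 * k + 1) with hs | hs <;> rw [hs] at r1 r2
    · have a1 := Complex.arg_eq_zero_iff.2 ⟨show 0 ≤ _ by linarith, i1⟩
      have a2 := Complex.arg_eq_zero_iff.2 ⟨show 0 ≤ _ by linarith, i2⟩
      exact ⟨a1.trans a2.symm, Or.inl a2⟩
    · have a1 := Complex.arg_eq_pi_iff.2 ⟨show _ < 0 by linarith, i1⟩
      have a2 := Complex.arg_eq_pi_iff.2 ⟨show _ < 0 by linarith, i2⟩
      exact ⟨a1.trans a2.symm, Or.inr a2⟩
  · linarith [h0.2]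

lemma sign_re_eq (hm : D.m = 2 * j + 1) (hε : ε = 1 ∨ ε = -1) {k : ℕ}
    (hex : D.ZeroExists j 0 (2 * k + 3)) :
    Real.sign (D.zeroSeq j ε 0 (2 * k + 2)).re = -Real.sign (D.zeroSeq j ε 0 (2 * k + 3)).re := by
  have hπ : 0 < Real.pi / 2 := by linarith [Real.pi_pos]
  have r1 := levelSign_mul_re_pos hm le_rfl hπ hε (by omega)
    (zeroExists_of_succ le_rfl hπ.le (show 1 ≤ 2 * k + 2 by omega) hex)
  have r2 := levelSign_mul_re_pos hm le_rfl hπ hε (by omega) hex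
  rw [levelSign_odd_succ] at r2
  exact sign_eq_neg_sign (levelSign_eq j hε _) r1 r2

lemma neg_conj_eq_of_norm_eq (hε : ε = 1 ∨ ε = -1) {k : ℕ}
    (h : ‖D.zeroSeq j ε (Real.pi / 2) (2 * k + 2)‖ =
      ‖D.zeroSeq j ε (Real.pi / 2) (2 * k + 3)‖) :
    D.zeroSeq j ε (Real.pi / 2) (2 * k + 2) =
      -(starRingEnd ℂ) (D.zeroSeq j ε (Real.pi / 2) (2 * k + 3)) := by
  have := hit_eq_of_norm_eq hε h
  rw [zeroSeq, zeroSeq, this, levelSign_odd_succ, conjSign_odd_succ, conjSign_even,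
    conj_quadPoint, Complex.conj_conj]
  simp [quadPoint]

lemma imaginary_arg_eq_of_norm_lt (hm : D.m = 2 * j + 1) (hε : ε = 1 ∨ ε = -1) {k : ℕ}
    (hex : D.ZeroExists j (Real.pi / 2) (2 * k + 3))
    (h : ‖D.zeroSeq j ε (Real.pi / 2) (2 * k + 2)‖ < ‖D.zeroSeq j ε (Real.pi / 2) (2 * k + 3)‖) :
    (D.zeroSeq j ε (Real.pi / 2) (2 * k + 2)).arg = (D.zeroSeq j ε (Real.pi / 2) (2 * k + 3)).arg ∧
      ((D.zeroSeq j ε (Real.pi / 2) (2 * k + 3)).arg = -(Real.pi / 2) ∨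
        (D.zeroSeq j ε (Real.pi / 2) (2 * k + 3)).arg = Real.pi / 2) := by
  have hπ : 0 < Real.pi / 2 := by linarith [Real.pi_pos]
  have hex' : D.ZeroExists j (Real.pi / 2) (2 * k + 2) :=
    zeroExists_of_succ hπ.le le_rfl (by omega) hex
  have hα : D.alpha (D.hit (IsFirst (Real.pi / 2) (2 * k + 2)) (level j (Real.pi / 2) (2 * k + 2))) =
      D.alpha (D.hit (IsFirst (Real.pi / 2) (2 * k + 3)) (level j (Real.pi / 2) (2 * k + 3))) := by
    rw [alpha_hit hm hπ.le le_rfl (by omega) hex', alpha_hit hm hπ.le le_rfl (by omega) hex,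
      level_even, show 2 * k + 3 = 2 * (k + 1) + 1 by ring, level_odd]
    push_cast; ring
  have i1 := levelSign_mul_im_pos hm hπ le_rfl hε (by omega) hex'
  have i2 := levelSign_mul_im_pos hm hπ le_rfl hε (by omega) hex
  have hlt := psi_hit_pos hm hπ le_rfl (by omega) hex
  rcases psi_of_alpha_eq (hit_ne_of_norm_lt hε h) hα with h0 | h0
  · linarith [h0.2]
  · have r1 : (D.zeroSeq j ε (Real.pi / 2) (2 * k + 2)).re = 0 := by rw [zeroSeq_re, h0.1]; simp
    have r2 : (D.zeroSeq j ε (Real.pi / 2) (2 * k + 3)).re = 0 := by rw [zeroSeq_re, h0.2]; simp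
    rw [levelSign_odd_succ, conjSign_odd_succ] at i2
    rw [conjSign_even] at i1
    rcases levelSign_eq j hε (2 * k + 2) with hs | hs <;> rw [hs] at i1 i2
    · have a1 := Complex.arg_eq_pi_div_two_iff.2 ⟨r1, show 0 < _ by linarith⟩
      have a2 := Complex.arg_eq_pi_div_two_iff.2 ⟨r2, show 0 < _ by linarith⟩
      exact ⟨a1.trans a2.symm, Or.inr a2⟩
    · have a1 := Complex.arg_eq_neg_pi_div_two_iff.2 ⟨r1, show _ < 0 by linarith⟩
      have a2 := Complex.arg_eq_neg_pi_div_two_iff.2 ⟨r2, show _ < 0 by linarith⟩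
      exact ⟨a1.trans a2.symm, Or.inl a2⟩

lemma sign_im_eq (hm : D.m = 2 * j + 1) (hε : ε = 1 ∨ ε = -1) {k : ℕ}
    (hex : D.ZeroExists j (Real.pi / 2) (2 * k + 2)) :
    Real.sign (D.zeroSeq j ε (Real.pi / 2) (2 * k + 1)).im =
      -Real.sign (D.zeroSeq j ε (Real.pi / 2) (2 * k + 2)).im := by
  have hπ : 0 < Real.pi / 2 := by linarith [Real.pi_pos]
  have i1 := levelSign_mul_im_pos hm hπ le_rfl hε (by omega)
    (zeroExists_of_succ hπ.le le_rfl (show 1 ≤ 2 * k + 1 by omega) hex)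
  have i2 := levelSign_mul_im_pos hm hπ le_rfl hε (by omega) hex
  rw [conjSign_odd] at i1
  rw [levelSign_even, ← levelSign_odd, conjSign_even] at i2
  refine neg_eq_iff_eq_neg.1 (sign_eq_neg_sign (levelSign_eq j hε (2 * k + 1)) ?_ ?_).symm <;>
    linarith

/-- The first level is the initial value of `alpha`, so the first zero is the right end of the
plateau coming from -∞, on which `psi` is π. -/
lemma re_first_zero_eq_zero (hm : D.m = 2 * j + 1) : (D.zeroSeq j ε (Real.pi / 2) 1).re = 0 := by
  have hπ : 0 < Real.pi / 2 := by linarith [Real.pi_pos]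
  have hm0 : 0 < D.m := by rw [hm]; positivity
  have hα := alpha_hit hm hπ.le le_rfl le_rfl (zeroExists_one (D := D) hm hπ.le)
  set x := D.hit (IsFirst (Real.pi / 2) 1) (level j (Real.pi / 2) 1) with hx
  have hlev : level j (Real.pi / 2) 1 = D.m / 2 * Real.pi := by
    
    refine (level_odd j (Real.pi / 2) 0).trans ?_
    rw [hm]; push_cast; ring
  obtain ⟨y, hy, hyx⟩ := ((eventually_psi_eq_pi hm0).and (eventually_lt_atBot x)).exists
  rw [zeroSeq_re, ← hx]
  rcases psi_of_alpha_eq hyx.ne (hy.2.trans (hlev.symm.trans hα.symm)) with h | h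
  · linarith [h.1, hy.1]
  · rw [h.2]; simp

end StripData

/-- The description of the zeros of `F`, for the four positions of the unimodular number `c`. -/
def HasZeroPattern (F : ℂ → ℂ) (j : ℕ) (c : ℂ) : Prop :=
  ∃ (ω : ℕ∞) (z : ℕ → ℂ), 1 ≤ ω ∧ IsZeroEnumeration F ω z ∧
    (0 < (c ^ 2).im →
      (∀ w, F w = 0 → analyticOrderAt F w = 1) ∧
      0 < ‖z 1‖ ∧
      (∀ k : ℕ, 1 ≤ k → ((k + 1 : ℕ) : ℕ∞) ≤ ω → ‖z k‖ < ‖z (k + 1)‖) ∧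
      (∀ k : ℕ, 1 ≤ k → (k : ℕ∞) ≤ ω → (z k ^ 2).im ≠ 0) ∧
      (∀ k : ℕ, 1 ≤ k → ((k + 1 : ℕ) : ℕ∞) ≤ ω →
        (z k ∈ Q₁ → z (k + 1) ∈ Q₂) ∧ (z k ∈ Q₂ → z (k + 1) ∈ Q₃) ∧
        (z k ∈ Q₃ → z (k + 1) ∈ Q₄) ∧ (z k ∈ Q₄ → z (k + 1) ∈ Q₁)) ∧
      0 < (-1) ^ j * c.re * (z 1).re ∧ (z 1).re * (z 1).im < 0) ∧
    ((c ^ 2).im < 0 →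
      (∀ w, F w = 0 → analyticOrderAt F w = 1) ∧
      0 < ‖z 1‖ ∧
      (∀ k : ℕ, 1 ≤ k → ((k + 1 : ℕ) : ℕ∞) ≤ ω → ‖z k‖ < ‖z (k + 1)‖) ∧
      (∀ k : ℕ, 1 ≤ k → (k : ℕ∞) ≤ ω → (z k ^ 2).im ≠ 0) ∧
      (∀ k : ℕ, 1 ≤ k → ((k + 1 : ℕ) : ℕ∞) ≤ ω →
        (z k ∈ Q₂ → z (k + 1) ∈ Q₁) ∧ (z k ∈ Q₃ → z (k + 1) ∈ Q₂) ∧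
        (z k ∈ Q₄ → z (k + 1) ∈ Q₃) ∧ (z k ∈ Q₁ → z (k + 1) ∈ Q₄)) ∧
      (-1) ^ j * c.im * (z 1).im < 0 ∧ 0 < (z 1).re * (z 1).im) ∧
    (c.im = 0 →
      0 < ‖z 1‖ ∧
      (∀ k : ℕ, 1 ≤ k → ((2 * k : ℕ) : ℕ∞) ≤ ω → ‖z (2 * k - 1)‖ ≤ ‖z (2 * k)‖) ∧
      (∀ k : ℕ, 1 ≤ k → ((2 * k + 1 : ℕ) : ℕ∞) ≤ ω → ‖z (2 * k)‖ < ‖z (2 * k + 1)‖) ∧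
      (∀ w, F w = 0 → w.re ≠ 0) ∧
      (∀ w, F w = 0 → w.im = 0 → analyticOrderAt F w = 1 ∨ analyticOrderAt F w = 2) ∧
      (∀ w, F w = 0 → w.im ≠ 0 → analyticOrderAt F w = 1) ∧
      (∀ k : ℕ, 1 ≤ k → ((2 * k : ℕ) : ℕ∞) ≤ ω →
        (‖z (2 * k - 1)‖ = ‖z (2 * k)‖ →
          z (2 * k - 1) = (starRingEnd ℂ) (z (2 * k))) ∧
        (‖z (2 * k - 1)‖ < ‖z (2 * k)‖ →
          (z (2 * k - 1)).arg = (z (2 * k)).arg ∧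
            ((z (2 * k)).arg = 0 ∨ (z (2 * k)).arg = Real.pi))) ∧
      (∀ k : ℕ, 1 ≤ k → ((2 * k + 1 : ℕ) : ℕ∞) ≤ ω →
        Real.sign (z (2 * k)).re = -Real.sign (z (2 * k + 1)).re) ∧
      0 < (-1) ^ j * c.re * (z 1).re ∧ (z 1).re * (z 1).im ≤ 0) ∧
    (c.re = 0 →
      0 < ‖z 1‖ ∧
      (∀ k : ℕ, 1 ≤ k → ((2 * k : ℕ) : ℕ∞) ≤ ω → ‖z (2 * k - 1)‖ < ‖z (2 * k)‖) ∧
      (∀ k : ℕ, 1 ≤ k → ((2 * k + 1 : ℕ) : ℕ∞) ≤ ω → ‖z (2 * k)‖ ≤ ‖z (2 * k + 1)‖) ∧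
      (∀ w, F w = 0 → w.im ≠ 0) ∧
      (∀ w, F w = 0 → w.re = 0 → analyticOrderAt F w = 1 ∨ analyticOrderAt F w = 2) ∧
      (∀ w, F w = 0 → w.re ≠ 0 → analyticOrderAt F w = 1) ∧
      (∀ k : ℕ, 1 ≤ k → ((2 * k + 1 : ℕ) : ℕ∞) ≤ ω →
        (‖z (2 * k)‖ = ‖z (2 * k + 1)‖ →
          z (2 * k) = -(starRingEnd ℂ) (z (2 * k + 1))) ∧
        (‖z (2 * k)‖ < ‖z (2 * k + 1)‖ →
          (z (2 * k)).arg = (z (2 * k + 1)).arg ∧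
            ((z (2 * k + 1)).arg = -(Real.pi / 2) ∨ (z (2 * k + 1)).arg = Real.pi / 2))) ∧
      (∀ k : ℕ, 1 ≤ k → ((2 * k : ℕ) : ℕ∞) ≤ ω →
        Real.sign (z (2 * k - 1)).im = -Real.sign (z (2 * k)).im) ∧
      (-1) ^ j * c.im * (z 1).im < 0 ∧ (z 1).re = 0)

/-! ### Conjugation and the four positions of c -/

lemma natCast_le_analyticOrderAt_of_conj {F G : ℂ → ℂ} (hF : Differentiable ℂ F)
    (hG : Differentiable ℂ G) (h : ∀ z, G z = (starRingEnd ℂ) (F ((starRingEnd ℂ) z))) {w : ℂ} {n : ℕ}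
    (hn : (n : ℕ∞) ≤ analyticOrderAt F w) :
    (n : ℕ∞) ≤ analyticOrderAt G ((starRingEnd ℂ) w) := by
  obtain ⟨g, hg, hgF⟩ := (natCast_le_analyticOrderAt (hF.analyticAt w)).1 hn
  have hcont : Tendsto (starRingEnd ℂ) (𝓝 ((starRingEnd ℂ) w)) (𝓝 w) := by
    simpa using Complex.continuous_conj.tendsto ((starRingEnd ℂ) w)
  refine (natCast_le_analyticOrderAt (hG.analyticAt _)).2
    ⟨fun z => (starRingEnd ℂ) (g ((starRingEnd ℂ) z)), ?_, ?_⟩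
  · rw [Complex.analyticAt_iff_eventually_differentiableAt] at hg ⊢
    filter_upwards [hcont.eventually hg] with z hz
    have := hz.star_star
    simpa [Function.comp_def] using this
  · filter_upwards [hcont.eventually hgF] with z hz
    rw [h, hz]
    simp

lemma analyticOrderAt_of_conj {F G : ℂ → ℂ} (hF : Differentiable ℂ F)
    (hG : Differentiable ℂ G) (h : ∀ z, G z = (starRingEnd ℂ) (F ((starRingEnd ℂ) z))) (w : ℂ) :
    analyticOrderAt G ((starRingEnd ℂ) w) = analyticOrderAt F w := by
  refine ENat.eq_of_forall_natCast_le_iff fun n => ⟨fun hn => ?_,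
    natCast_le_analyticOrderAt_of_conj hF hG h⟩
  have h' : ∀ z, F z = (starRingEnd ℂ) (G ((starRingEnd ℂ) z)) := fun z => by rw [h]; simp
  simpa using natCast_le_analyticOrderAt_of_conj hG hF h' hn

namespace StripData

variable {D : StripData} {j : ℕ} {ε γ : ℝ} {f₀ c : ℂ}

lemma zeroFun_conj (D : StripData) (j : ℕ) (f₀ c w : ℂ) :
    D.zeroFun j f₀ c w =
      (starRingEnd ℂ) (D.zeroFun j ((starRingEnd ℂ) f₀) ((starRingEnd ℂ) c) ((starRingEnd ℂ) w)) := by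
  simp only [zeroFun, map_mul, map_sub, map_pow, Complex.conj_conj, Complex.conj_ofReal,
    ← genusProd_conj, map_neg]

lemma exists_unitPhase (hc : ‖c‖ = 1) (h : 0 ≤ c.re * c.im) :
    ∃ ε γ : ℝ, (ε = 1 ∨ ε = -1) ∧ 0 ≤ γ ∧ γ ≤ Real.pi / 2 ∧ c = unitPhase ε γ := by
  have key : ∀ c : ℂ, ‖c‖ = 1 → 0 ≤ c.re → 0 ≤ c.im →
      0 ≤ c.arg ∧ c.arg ≤ Real.pi / 2 ∧ c = Complex.exp (c.arg * Complex.I) := by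
    intro c hc h1 h2
    refine ⟨Complex.arg_nonneg_iff.2 h2, Complex.arg_le_pi_div_two_iff.2 (Or.inl h1), ?_⟩
    have := Complex.norm_mul_exp_arg_mul_I c
    rw [hc, Complex.ofReal_one, one_mul] at this
    exact this.symm
  by_cases hpos : 0 ≤ c.re ∧ 0 ≤ c.im
  · obtain ⟨h1, h2, h3⟩ := key c hc hpos.1 hpos.2
    exact ⟨1, c.arg, Or.inl rfl, h1, h2, by rw [unitPhase]; simpa using h3⟩
  · have hneg : 0 ≤ (-c).re ∧ 0 ≤ (-c).im := by
      rw [Complex.neg_re, Complex.neg_im]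
      rw [not_and_or, not_le, not_le] at hpos
      rcases hpos with h1 | h1
      · exact ⟨by linarith, by
          by_contra hcon
          nlinarith⟩
      · exact ⟨by
          by_contra hcon
          nlinarith, by linarith⟩
    obtain ⟨h1, h2, h3⟩ := key (-c) (by rwa [norm_neg]) hneg.1 hneg.2
    refine ⟨-1, (-c).arg, Or.inr rfl, h1, h2, ?_⟩
    rw [unitPhase, ← h3]; simp

lemma hasZeroPattern_of_unitPhase (hm : D.m = 2 * j + 1) (hγ0 : 0 ≤ γ) (hγ : γ ≤ Real.pi / 2)
    (hε : ε = 1 ∨ ε = -1) (hf₀ : f₀ ≠ 0) :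
    HasZeroPattern (D.zeroFun j f₀ (unitPhase ε γ)) j (unitPhase ε γ) := by
  have hπ : 0 < Real.pi / 2 := by linarith [Real.pi_pos]
  have hε2 : ε * ε = 1 := by rcases hε with rfl | rfl <;> norm_num
  obtain ⟨ω, hω1, hω⟩ := exists_length (P := D.ZeroExists j γ) (zeroExists_one hm hγ0)
    fun n hn h => zeroExists_of_succ hγ0 hγ hn h
  have him2 : (unitPhase ε γ ^ 2).im = 2 * (Real.sin γ * Real.cos γ) := by
    rw [pow_two, Complex.mul_im, unitPhase_re, unitPhase_im]
    linear_combination (2 * (Real.sin γ * Real.cos γ)) * hε2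
  have hsc : 0 ≤ Real.sin γ * Real.cos γ :=
    mul_nonneg (Real.sin_nonneg_of_nonneg_of_le_pi hγ0 (by linarith))
      (Real.cos_nonneg_of_mem_Icc ⟨by linarith, hγ⟩)
  have hz : ∀ n : ℕ, 1 ≤ n → (n : ℕ∞) ≤ ω →
      D.zeroFun j f₀ (unitPhase ε γ) (D.zeroSeq j ε γ n) = 0 := fun n hn h =>
    zeroFun_zeroSeq hm hγ0 hγ hε hf₀ hn ((hω n hn).1 h)
  refine ⟨ω, D.zeroSeq j ε γ, hω1, fun w => ?_, fun h => ?_, fun h => ?_, fun h => ?_, fun h => ?_⟩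
  · rw [← encard_index hm hγ0 hγ hε hf₀ w]
    congr 1
    ext n
    simp only [Set.mem_ofPred_eq]
    exact ⟨fun ⟨a, b, d⟩ => ⟨a, (hω n a).1 b, d⟩, fun ⟨a, b, d⟩ => ⟨a, (hω n a).2 b, d⟩⟩
  · rw [him2] at h
    have h0 : 0 < γ := lt_of_le_of_ne hγ0 fun h' => by rw [← h'] at h; simp at h
    have h1 : γ < Real.pi / 2 := lt_of_le_of_ne hγ fun h' => by rw [h'] at h; simp at h
    have hre : ∀ w, D.zeroFun j f₀ (unitPhase ε γ) w = 0 → w.re ≠ 0 := fun w hw =>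
      re_ne_zero_of_zero hm hγ0 h1 hε hf₀ hw
    have him : ∀ w, D.zeroFun j f₀ (unitPhase ε γ) w = 0 → w.im ≠ 0 := fun w hw =>
      im_ne_zero_of_zero hm h0 hγ hε hf₀ hw
    refine ⟨fun w hw => order_eq_one_of_re_ne_zero_of_im_ne_zero hm hε hf₀ hw (hre w hw) (him w hw),
      norm_zeroSeq_pos hε 1, fun k hk hle => ?_, fun k hk hle => ?_, fun k hk hle => ?_,
      re_first_zero hm hγ0 h1 hε, re_mul_im_first_zero_neg hm h0 h1 hε⟩
    · exact norm_zeroSeq_lt hm hγ0 hγ hε hk ((hω _ (by omega)).1 hle)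
        (level_succ_lt_of_ne h0 h1 hk)
    · rw [pow_two, Complex.mul_im]
      have := mul_ne_zero (hre _ (hz k hk hle)) (him _ (hz k hk hle))
      intro h'
      exact this (by linarith)
    · exact quadrant_step hm h0 h1 hε hk ((hω _ (by omega)).1 hle)
  · rw [him2] at h
    linarith
  · have h0 : γ = 0 := by
      rw [unitPhase_im] at h
      by_contra hne
      have := Real.sin_pos_of_pos_of_lt_pi (lt_of_le_of_ne hγ0 (Ne.symm hne)) (by linarith)
      rcases hε with rfl | rfl <;> linarith
    subst h0
    have hex : ∀ n : ℕ, 1 ≤ n → (n : ℕ∞) ≤ ω → D.ZeroExists j 0 n := fun n hn => (hω n hn).1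
    refine ⟨norm_zeroSeq_pos hε 1, fun k hk hle => ?_, fun k hk hle => ?_,
      fun w hw => re_ne_zero_of_zero hm le_rfl hπ hε hf₀ hw,
      fun w hw _ => order_eq_one_or_two hm hε hf₀ hw,
      fun w hw him => order_eq_one_of_re_ne_zero_of_im_ne_zero hm hε hf₀ hw
        (re_ne_zero_of_zero hm le_rfl hπ hε hf₀ hw) him,
      fun k hk hle => ?_, fun k hk hle => ?_, re_first_zero hm le_rfl hπ hε,
      re_mul_im_first_zero_nonpos hm le_rfl hπ hε⟩
    · obtain ⟨i, rfl⟩ := Nat.exists_eq_add_of_le' hk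
      exact norm_zeroSeq_le hm le_rfl hπ.le hε (by omega) (hex _ (by omega) hle)
    · obtain ⟨i, rfl⟩ := Nat.exists_eq_add_of_le' hk
      exact norm_zeroSeq_lt hm le_rfl hπ.le hε (by omega) (hex _ (by omega) hle)
        (level_succ_lt_of_not_isFirst hπ.le (by omega) (by
          rw [show 2 * (i + 1) = 2 * i + 2 by ring, isFirst_even]; exact hπ.ne))
    · obtain ⟨i, rfl⟩ := Nat.exists_eq_add_of_le' hk
      exact ⟨conj_eq_of_norm_eq hε (k := i), arg_eq_of_norm_lt hm hε (hex _ (by omega) hle)⟩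
    · obtain ⟨i, rfl⟩ := Nat.exists_eq_add_of_le' hk
      exact sign_re_eq hm hε (hex _ (by omega) hle)
  · have h0 : γ = Real.pi / 2 := by
      rw [unitPhase_re] at h
      by_contra hne
      have := Real.cos_pos_of_mem_Ioo ⟨by linarith, lt_of_le_of_ne hγ hne⟩
      rcases hε with rfl | rfl <;> linarith
    subst h0
    have hex : ∀ n : ℕ, 1 ≤ n → (n : ℕ∞) ≤ ω → D.ZeroExists j (Real.pi / 2) n := fun n hn => (hω n hn).1
    refine ⟨norm_zeroSeq_pos hε 1, fun k hk hle => ?_, fun k hk hle => ?_,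
      fun w hw => im_ne_zero_of_zero hm hπ le_rfl hε hf₀ hw,
      fun w hw _ => order_eq_one_or_two hm hε hf₀ hw,
      fun w hw hre => order_eq_one_of_re_ne_zero_of_im_ne_zero hm hε hf₀ hw hre
        (im_ne_zero_of_zero hm hπ le_rfl hε hf₀ hw),
      fun k hk hle => ?_, fun k hk hle => ?_, im_first_zero hm hπ le_rfl hε,
      re_first_zero_eq_zero hm⟩
    · obtain ⟨i, rfl⟩ := Nat.exists_eq_add_of_le' hk
      exact norm_zeroSeq_lt hm hπ.le le_rfl hε (n := 2 * i + 1) (by omega) (hex _ (by omega) hle)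
        (level_succ_lt_of_not_isFirst le_rfl (by omega) (by rw [isFirst_odd]; simp))
    · obtain ⟨i, rfl⟩ := Nat.exists_eq_add_of_le' hk
      exact norm_zeroSeq_le hm hπ.le le_rfl hε (by omega) (hex _ (by omega) hle)
    · obtain ⟨i, rfl⟩ := Nat.exists_eq_add_of_le' hk
      exact ⟨neg_conj_eq_of_norm_eq hε (k := i),
        imaginary_arg_eq_of_norm_lt hm hε (hex _ (by omega) hle)⟩
    · obtain ⟨i, rfl⟩ := Nat.exists_eq_add_of_le' hk
      exact sign_im_eq hm hε (hex _ (by omega) hle)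

/-- Reflection in the real axis reduces the case `Im c² < 0` to `Im c² > 0`. -/
lemma hasZeroPattern_of_im_sq_neg (hm : D.m = 2 * j + 1) (hc : ‖c‖ = 1) (hf₀ : f₀ ≠ 0)
    (h : c.re * c.im < 0) : HasZeroPattern (D.zeroFun j f₀ c) j c := by
  set G := D.zeroFun j ((starRingEnd ℂ) f₀) ((starRingEnd ℂ) c) with hG
  have hconj : ∀ z, D.zeroFun j f₀ c z = (starRingEnd ℂ) (G ((starRingEnd ℂ) z)) :=
    zeroFun_conj D j f₀ c
  have hzero : ∀ {w}, D.zeroFun j f₀ c w = 0 → G ((starRingEnd ℂ) w) = 0 := fun {w} hw => by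
    rw [hconj] at hw
    exact (map_eq_zero _).1 hw
  have hord : ∀ w, analyticOrderAt (D.zeroFun j f₀ c) ((starRingEnd ℂ) w) = analyticOrderAt G w :=
    analyticOrderAt_of_conj (differentiable_zeroFun _ _ _ _) (differentiable_zeroFun _ _ _ _) hconj
  have hpat : HasZeroPattern G j ((starRingEnd ℂ) c) := by
    obtain ⟨ε, γ, hε, hγ0, hγ, hcγ⟩ := exists_unitPhase (c := (starRingEnd ℂ) c) (by simpa using hc)
      (by simp only [Complex.conj_re, Complex.conj_im]; linarith)
    rw [hG, hcγ]
    exact hasZeroPattern_of_unitPhase hm hγ0 hγ hε ((map_ne_zero _).2 hf₀)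
  obtain ⟨ω, z, hω, henum, h1, -⟩ := hpat
  have him : ∀ w : ℂ, (w ^ 2).im = 2 * (w.re * w.im) := fun w => by
    rw [pow_two, Complex.mul_im]; ring
  obtain ⟨hsimple, hpos, hlt, hsq, hquad, hfirst, hprod⟩ := h1 (by
    rw [him, Complex.conj_re, Complex.conj_im]; linarith)
  rw [Complex.conj_re] at hfirst
  refine ⟨ω, fun n => (starRingEnd ℂ) (z n), hω, fun w => ?_, fun h' => ?_, fun _ => ?_,
    fun h' => ?_, fun h' => ?_⟩
  · have := henum ((starRingEnd ℂ) w)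
    rw [← hord, Complex.conj_conj] at this
    rw [← this]
    congr 1
    ext n
    simp only [Set.mem_ofPred_eq]
    rw [← (starRingEnd ℂ).injective.eq_iff (b := (starRingEnd ℂ) w), Complex.conj_conj]
  · rw [him] at h'; linarith
  · refine ⟨fun w hw => ?_, by simpa using hpos, fun k hk hle => by simpa using hlt k hk hle,
      fun k hk hle => ?_, fun k hk hle => ?_, ?_, ?_⟩
    · rw [← hsimple _ (hzero hw), ← hord, Complex.conj_conj]
    · have := hsq k hk hle
      rw [him] at this ⊢
      rw [Complex.conj_re, Complex.conj_im]
      intro h'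
      exact this (by linarith)
    · obtain ⟨a1, a2, a3, a4⟩ := hquad k hk hle
      simp only [Q₁, Q₂, Q₃, Q₄, Set.mem_ofPred_eq, Complex.conj_re, Complex.conj_im, neg_pos,
        neg_lt_zero] at a1 a2 a3 a4 ⊢
      -- Conjugation exchanges the first with the fourth quadrant and the second with the third,
      -- which reverses the rotation.
      exact ⟨a3, a2, a1, a4⟩
    · rw [Complex.conj_im]
      -- For the conjugated problem Re c Re z₁ has the sign (-1)^j and Re z₁ Im z₁ < 0; with Re c Im
      -- c < 0 this fixes the sign of Im c Im z₁.
      by_contra hcon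
      have h2 : 0 ≤ (-1) ^ j * c.im * -(z 1).im := not_lt.1 hcon
      have h3 := mul_nonneg h2 hfirst.le
      rcases neg_one_pow_eq_or ℝ j with e | e <;> rw [e] at h3 <;>
        nlinarith [mul_pos_of_neg_of_neg h hprod]
    · simpa using hprod
  · rw [h', mul_zero] at h; exact absurd h (lt_irrefl _)
  · rw [h', zero_mul] at h; exact absurd h (lt_irrefl _)

theorem hasZeroPattern_zeroFun (hm : D.m = 2 * j + 1) (hc : ‖c‖ = 1) (hf₀ : f₀ ≠ 0) :
    HasZeroPattern (D.zeroFun j f₀ c) j c := by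
  rcases le_or_gt 0 (c.re * c.im) with h | h
  · obtain ⟨ε, γ, hε, hγ0, hγ, rfl⟩ := exists_unitPhase hc h
    exact hasZeroPattern_of_unitPhase hm hγ0 hγ hε hf₀
  · exact hasZeroPattern_of_im_sq_neg hm hc hf₀ h

end StripData

/-! ### Normal forms of f and g, and the case of a linear F -/

lemma genusProd_zero {ι : Type} (u : ι → ℝ) : genusProd u 0 = 1 := by simp [genusProd]

lemma genusProd_of_isEmpty {ι : Type} [IsEmpty ι] (u : ι → ℝ) (w : ℂ) : genusProd u w = 1 := by
  simp [genusProd]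

lemma IsGenusZero.exists_genusProd_of_neg {f : ℂ → ℂ} (hf : IsGenusZero f)
    (h : ∀ z, f z = 0 → z.im = 0 ∧ z.re < 0) : f 0 ≠ 0 ∧ ∃ (κ : Type) (v : κ → ℝ),
      (Summable fun i => Real.exp (-v i)) ∧ ∀ z, f z = f 0 * genusProd v z := by
  have h0 : f 0 ≠ 0 := fun h0 => by simpa using (h 0 h0).2
  refine ⟨h0, ?_⟩
  obtain ⟨κ, C, m, w, hC, hw, hs, hfw⟩ := hf
  have hm : m = 0 := by
    by_contra hm
    exact h0 (by rw [hfw, zero_pow hm]; simp)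
  subst hm
  have hC0 : f 0 = C := by rw [hfw]; simp
  have hzero : ∀ i, f (w i) = 0 := fun i => by
    rw [hfw, tprod_of_exists_eq_zero ⟨i, by rw [div_self (hw i), sub_self]⟩, mul_zero]
  have hexp : ∀ i, Real.exp (Real.log (-(w i).re)) = -(w i).re := fun i =>
    Real.exp_log (by linarith [(h _ (hzero i)).2])
  have hwi : ∀ i, w i = -(Real.exp (Real.log (-(w i).re)) : ℂ) := fun i => by
    rw [hexp]
    apply Complex.ext <;> simp [(h _ (hzero i)).1]
  refine ⟨κ, fun i => Real.log (-(w i).re), hs.congr fun i => ?_, fun z => ?_⟩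
  · conv_lhs => rw [hwi i]
    rw [norm_neg, Complex.norm_real, Real.norm_of_nonneg (Real.exp_pos _).le,
      Real.exp_neg]
  · rw [hC0, hfw, pow_zero, mul_one, genusProd]
    congr 2
    funext i
    conv_lhs => rw [hwi i]
    rw [Complex.exp_neg, div_neg, sub_neg_eq_add, div_eq_mul_inv, Complex.ofReal_exp]

lemma IsGenusZero.exists_genusProd_of_nonneg {g : ℂ → ℂ} {g₀ : ℂ} {j : ℕ} (hg : IsGenusZero g)
    (h : ∀ z, g z = 0 → z.im = 0 ∧ 0 ≤ z.re) (hg₀ : g₀ ≠ 0)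
    (hgj : Tendsto (fun z => g z / z ^ j) (𝓝[≠] 0) (𝓝 g₀)) : ∃ (ι : Type) (u : ι → ℝ),
      (Summable fun i => Real.exp (-u i)) ∧ ∀ z, g z = g₀ * z ^ j * genusProd u (-z) := by
  obtain ⟨ι, C, m, w, hC, hw, hs, hgw⟩ := hg
  have hzero : ∀ i, g (w i) = 0 := fun i => by
    rw [hgw, tprod_of_exists_eq_zero ⟨i, by rw [div_self (hw i), sub_self]⟩, mul_zero]
  have hpos : ∀ i, 0 < (w i).re := fun i => by
    obtain ⟨h1, h2⟩ := h _ (hzero i)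
    exact lt_of_le_of_ne h2 fun h3 => hw i (Complex.ext h3.symm h1)
  have hwi : ∀ i, w i = (Real.exp (Real.log (w i).re) : ℂ) := fun i => by
    rw [Real.exp_log (hpos i)]
    apply Complex.ext <;> simp [(h _ (hzero i)).1]
  have hsum : Summable fun i => Real.exp (-Real.log (w i).re) := hs.congr fun i => by
    conv_lhs => rw [hwi i]
    rw [Complex.norm_real, Real.norm_of_nonneg (Real.exp_pos _).le,
      Real.exp_neg]
  refine ⟨ι, fun i => Real.log (w i).re, hsum, ?_⟩
  set P : ℂ → ℂ := fun z => genusProd (fun i => Real.log (w i).re) (-z) with hP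
  have hgP : ∀ z, g z = C * z ^ m * P z := fun z => by
    rw [hgw, hP]
    simp only [genusProd]
    congr 2
    funext i
    conv_lhs => rw [hwi i]
    rw [Complex.exp_neg, div_eq_mul_inv, neg_mul, sub_eq_add_neg, Complex.ofReal_exp]
  have hPc : Tendsto P (𝓝[≠] 0) (𝓝 1) := by
    have h1 : Continuous P := (differentiable_genusProd hsum).continuous.comp continuous_neg
    have h2 : P 0 = 1 := by rw [hP]; simp only [neg_zero, genusProd_zero]
    exact h2 ▸ h1.continuousAt.tendsto.mono_left nhdsWithin_le_nhds
  have hpow : ∀ n : ℕ, Tendsto (fun z : ℂ => z ^ n) (𝓝[≠] 0) (𝓝 (0 ^ n)) := fun n =>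
    ((continuous_pow n).tendsto 0).mono_left nhdsWithin_le_nhds
  -- The power and the constant in the product are identified by comparing limits at 0, where the
  -- infinite product tends to 1.
  have hmj : m = j ∧ C = g₀ := by
    rcases le_total m j with hle | hle
    · obtain ⟨d, rfl⟩ := Nat.exists_eq_add_of_le hle
      have hev : (fun z => g z / z ^ (m + d) * z ^ d) =ᶠ[𝓝[≠] 0] fun z => C * P z := by
        filter_upwards [self_mem_nhdsWithin] with z hz
        have hz' : z ≠ 0 := hz
        rw [hgP, pow_add]; field_simp
      have hlim := tendsto_nhds_unique ((hgj.mul (hpow d)).congr' hev) (hPc.const_mul C)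
      rw [mul_one] at hlim
      have hd : d = 0 := by
        by_contra hd
        rw [zero_pow hd, mul_zero] at hlim
        exact hC hlim.symm
      subst hd
      exact ⟨rfl, by simpa using hlim.symm⟩
    · obtain ⟨d, rfl⟩ := Nat.exists_eq_add_of_le hle
      have hev : (fun z => C * z ^ d * P z) =ᶠ[𝓝[≠] 0] fun z => g z / z ^ j := by
        filter_upwards [self_mem_nhdsWithin] with z hz
        have hz' : z ≠ 0 := hz
        rw [hgP, pow_add]; field_simp
      have hlim := tendsto_nhds_unique ((((hpow d).const_mul C).mul hPc).congr' hev) hgj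
      rw [mul_one] at hlim
      have hd : d = 0 := by
        by_contra hd
        rw [zero_pow hd, mul_zero] at hlim
        exact hg₀ hlim.symm
      subst hd
      exact ⟨rfl, by simpa using hlim⟩
  intro z
  rw [hgP, hmj.1, hmj.2]

lemma isZeroEnumeration_linear {f₀ g₀ : ℂ} (hg₀ : g₀ ≠ 0) :
    IsZeroEnumeration (fun z => f₀ + z * g₀) 1 fun _ => -f₀ / g₀ := by
  intro w
  have hfac : ∀ z, f₀ + z * g₀ = (z - -f₀ / g₀) * g₀ := fun z => by field_simp; ring
  have han : AnalyticAt ℂ (fun z => f₀ + z * g₀) w :=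
    ((differentiable_id.mul_const g₀).const_add f₀).analyticAt w
  by_cases hw : -f₀ / g₀ = w
  · have h1 : analyticOrderAt (fun z => f₀ + z * g₀) w = (1 : ℕ) := by
      refine han.analyticOrderAt_eq_natCast.2 ⟨fun _ => g₀, analyticAt_const, hg₀, .of_forall fun z => ?_⟩
      rw [hfac, hw, pow_one, smul_eq_mul]
    rw [h1]
    have h2 : {k : ℕ | 1 ≤ k ∧ (k : ℕ∞) ≤ 1 ∧ -f₀ / g₀ = w} = {1} := by
      ext k
      simp only [hw, Set.mem_ofPred_eq, Nat.cast_le_one, and_true, Set.mem_singleton_iff]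
      omega
    rw [h2, Set.encard_singleton, Nat.cast_one]
  · rw [han.analyticOrderAt_eq_zero.2 ?_, Set.encard_eq_zero]
    · exact Set.eq_empty_of_forall_notMem fun k hk => hw hk.2.2
    · rw [hfac]
      exact mul_ne_zero (sub_ne_zero.2 (Ne.symm hw)) hg₀

/-- With both families of zeros empty and j = 0 the phase argument has no strict monotonicity to
offer, but F has a single zero, a positive multiple of conj c; all assertions on consecutive zeros
are void. -/
lemma hasZeroPattern_linear {f₀ g₀ c : ℂ} {κ : ℝ} (hg₀ : g₀ ≠ 0) (hκ : 0 < κ) (hc : c ≠ 0)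
    (h : -f₀ / g₀ = κ * (starRingEnd ℂ) c) : HasZeroPattern (fun z => f₀ + z * g₀) 0 c := by
  have henum := isZeroEnumeration_linear (f₀ := f₀) hg₀
  rw [h] at henum
  have hzero : ∀ w, f₀ + w * g₀ = 0 → w = κ * (starRingEnd ℂ) c := fun w hw => by
    rw [← h, eq_div_iff hg₀]
    linear_combination hw
  have hord : ∀ w, f₀ + w * g₀ = 0 → analyticOrderAt (fun z => f₀ + z * g₀) w = 1 := fun w hw => by
    rw [← henum w, hzero w hw]
    have h2 : {k : ℕ | 1 ≤ k ∧ (k : ℕ∞) ≤ 1 ∧ κ * (starRingEnd ℂ) c = κ * (starRingEnd ℂ) c} = {1} := by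
      ext k
      simp only [Set.mem_ofPred_eq, Nat.cast_le_one, and_true, Set.mem_singleton_iff]
      omega
    rw [h2, Set.encard_singleton]
  have hre : ((κ : ℂ) * (starRingEnd ℂ) c).re = κ * c.re := by simp
  have him : ((κ : ℂ) * (starRingEnd ℂ) c).im = -(κ * c.im) := by simp
  have hnorm : 0 < ‖(κ : ℂ) * (starRingEnd ℂ) c‖ :=
    norm_pos_iff.2 (mul_ne_zero (by exact_mod_cast hκ.ne') ((map_ne_zero _).2 hc))
  have hsq : (c ^ 2).im = 2 * (c.re * c.im) := by rw [pow_two, Complex.mul_im]; ring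
  have hsq' : (((κ : ℂ) * (starRingEnd ℂ) c) ^ 2).im = -(κ ^ 2 * (c ^ 2).im) := by
    rw [hsq, pow_two, Complex.mul_im, hre, him]; ring
  have hκ2 : 0 < κ ^ 2 := by positivity
  have hle : ∀ {n : ℕ}, 2 ≤ n → ¬ ((n : ℕ) : ℕ∞) ≤ 1 := fun {n} hn hn' => by
    rw [Nat.cast_le_one] at hn'
    omega
  refine ⟨1, _, le_rfl, henum, fun hi => ?_, fun hi => ?_, fun hi => ?_, fun hi => ?_⟩
  · refine ⟨hord, hnorm, fun k hk hn => absurd hn (hle (by omega)), fun k _ _ => ?_,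
      fun k hk hn => absurd hn (hle (by omega)), ?_, ?_⟩
    · rw [hsq']
      exact neg_ne_zero.2 (mul_pos hκ2 hi).ne'
    · have : c.re ≠ 0 := fun h' => by rw [hsq, h'] at hi; simp at hi
      rw [hre, pow_zero, one_mul, show c.re * (κ * c.re) = κ * c.re ^ 2 by ring]
      positivity
    · rw [hre, him]
      nlinarith [mul_pos hκ2 hi]
  · refine ⟨hord, hnorm, fun k hk hn => absurd hn (hle (by omega)), fun k _ _ => ?_,
      fun k hk hn => absurd hn (hle (by omega)), ?_, ?_⟩
    · rw [hsq']
      exact neg_ne_zero.2 (mul_neg_of_pos_of_neg hκ2 hi).ne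
    · have : c.im ≠ 0 := fun h' => by rw [hsq, h'] at hi; simp at hi
      have h2 : 0 < κ * c.im ^ 2 := by positivity
      rw [him]
      linarith
    · rw [hre, him]
      nlinarith [mul_neg_of_pos_of_neg hκ2 hi]
  · have hr : c.re ≠ 0 := fun h' => hc (Complex.ext h' hi)
    have h2 : 0 < κ * c.re ^ 2 := by positivity
    refine ⟨hnorm, fun k hk hn => absurd hn (hle (by omega)), fun k hk hn => absurd hn (hle (by omega)),
      fun w hw => ?_, fun w hw _ => Or.inl (hord w hw), fun w hw _ => hord w hw,
      fun k hk hn => absurd hn (hle (by omega)), fun k hk hn => absurd hn (hle (by omega)), ?_, ?_⟩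
    · rw [hzero w hw, hre]
      exact mul_ne_zero hκ.ne' hr
    · rw [hre]
      linarith
    · rw [him, hi]; simp
  · have hr : c.im ≠ 0 := fun h' => hc (Complex.ext hi h')
    have h2 : 0 < κ * c.im ^ 2 := by positivity
    refine ⟨hnorm, fun k hk hn => absurd hn (hle (by omega)), fun k hk hn => absurd hn (hle (by omega)),
      fun w hw => ?_, fun w hw _ => Or.inl (hord w hw), fun w hw _ => hord w hw,
      fun k hk hn => absurd hn (hle (by omega)), fun k hk hn => absurd hn (hle (by omega)), ?_, ?_⟩
    · rw [hzero w hw, him]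
      exact neg_ne_zero.2 (mul_ne_zero hκ.ne' hr)
    · rw [him]
      linarith
    · rw [hre, hi, mul_zero]

theorem theorem1 (f g F : ℂ → ℂ) (j : ℕ) (f₀ g₀ c : ℂ)
    (hf : IsGenusZero f) (hg : IsGenusZero g)
    (hf_zeros : ∀ z, f z = 0 → z.im = 0 ∧ z.re < 0)
    (hg_zeros : ∀ z, g z = 0 → z.im = 0 ∧ 0 ≤ z.re)
    (hf₀ : f₀ = f 0)
    (hg₀ : g₀ ≠ 0) (hgj : Tendsto (fun z => g z / z ^ j) (𝓝[≠] 0) (𝓝 g₀))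
    (hnonconst : ¬ (j ≠ 0 ∧ (∀ z, f z = f₀) ∧ (∀ z, g z = g₀ * z ^ j)))
    (hF : ∀ z, F z = f (z ^ 2) + z * g (z ^ 2))
    (hc : c = -((g₀ * (‖f₀‖ : ℂ)) / (f₀ * (‖g₀‖ : ℂ)))) :
    ∃ (ω : ℕ∞) (z : ℕ → ℂ), 1 ≤ ω ∧ IsZeroEnumeration F ω z ∧
      (0 < (c ^ 2).im →
        (∀ w, F w = 0 → analyticOrderAt F w = 1) ∧
        0 < ‖z 1‖ ∧
        (∀ k : ℕ, 1 ≤ k → ((k + 1 : ℕ) : ℕ∞) ≤ ω → ‖z k‖ < ‖z (k + 1)‖) ∧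
        (∀ k : ℕ, 1 ≤ k → (k : ℕ∞) ≤ ω → (z k ^ 2).im ≠ 0) ∧
        (∀ k : ℕ, 1 ≤ k → ((k + 1 : ℕ) : ℕ∞) ≤ ω →
          (z k ∈ Q₁ → z (k + 1) ∈ Q₂) ∧ (z k ∈ Q₂ → z (k + 1) ∈ Q₃) ∧
          (z k ∈ Q₃ → z (k + 1) ∈ Q₄) ∧ (z k ∈ Q₄ → z (k + 1) ∈ Q₁)) ∧
        0 < (-1) ^ j * c.re * (z 1).re ∧ (z 1).re * (z 1).im < 0) ∧
      ((c ^ 2).im < 0 →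
        (∀ w, F w = 0 → analyticOrderAt F w = 1) ∧
        0 < ‖z 1‖ ∧
        (∀ k : ℕ, 1 ≤ k → ((k + 1 : ℕ) : ℕ∞) ≤ ω → ‖z k‖ < ‖z (k + 1)‖) ∧
        (∀ k : ℕ, 1 ≤ k → (k : ℕ∞) ≤ ω → (z k ^ 2).im ≠ 0) ∧
        (∀ k : ℕ, 1 ≤ k → ((k + 1 : ℕ) : ℕ∞) ≤ ω →
          (z k ∈ Q₂ → z (k + 1) ∈ Q₁) ∧ (z k ∈ Q₃ → z (k + 1) ∈ Q₂) ∧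
          (z k ∈ Q₄ → z (k + 1) ∈ Q₃) ∧ (z k ∈ Q₁ → z (k + 1) ∈ Q₄)) ∧
        (-1) ^ j * c.im * (z 1).im < 0 ∧ 0 < (z 1).re * (z 1).im) ∧
      (c.im = 0 →
        0 < ‖z 1‖ ∧
        (∀ k : ℕ, 1 ≤ k → ((2 * k : ℕ) : ℕ∞) ≤ ω → ‖z (2 * k - 1)‖ ≤ ‖z (2 * k)‖) ∧
        (∀ k : ℕ, 1 ≤ k → ((2 * k + 1 : ℕ) : ℕ∞) ≤ ω → ‖z (2 * k)‖ < ‖z (2 * k + 1)‖) ∧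
        (∀ w, F w = 0 → w.re ≠ 0) ∧
        (∀ w, F w = 0 → w.im = 0 → analyticOrderAt F w = 1 ∨ analyticOrderAt F w = 2) ∧
        (∀ w, F w = 0 → w.im ≠ 0 → analyticOrderAt F w = 1) ∧
        (∀ k : ℕ, 1 ≤ k → ((2 * k : ℕ) : ℕ∞) ≤ ω →
          (‖z (2 * k - 1)‖ = ‖z (2 * k)‖ →
            z (2 * k - 1) = (starRingEnd ℂ) (z (2 * k))) ∧
          (‖z (2 * k - 1)‖ < ‖z (2 * k)‖ →
            (z (2 * k - 1)).arg = (z (2 * k)).arg ∧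
              ((z (2 * k)).arg = 0 ∨ (z (2 * k)).arg = Real.pi))) ∧
        (∀ k : ℕ, 1 ≤ k → ((2 * k + 1 : ℕ) : ℕ∞) ≤ ω →
          Real.sign (z (2 * k)).re = -Real.sign (z (2 * k + 1)).re) ∧
        0 < (-1) ^ j * c.re * (z 1).re ∧ (z 1).re * (z 1).im ≤ 0) ∧
      (c.re = 0 →
        0 < ‖z 1‖ ∧
        (∀ k : ℕ, 1 ≤ k → ((2 * k : ℕ) : ℕ∞) ≤ ω → ‖z (2 * k - 1)‖ < ‖z (2 * k)‖) ∧
        (∀ k : ℕ, 1 ≤ k → ((2 * k + 1 : ℕ) : ℕ∞) ≤ ω → ‖z (2 * k)‖ ≤ ‖z (2 * k + 1)‖) ∧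
        (∀ w, F w = 0 → w.im ≠ 0) ∧
        (∀ w, F w = 0 → w.re = 0 → analyticOrderAt F w = 1 ∨ analyticOrderAt F w = 2) ∧
        (∀ w, F w = 0 → w.re ≠ 0 → analyticOrderAt F w = 1) ∧
        (∀ k : ℕ, 1 ≤ k → ((2 * k + 1 : ℕ) : ℕ∞) ≤ ω →
          (‖z (2 * k)‖ = ‖z (2 * k + 1)‖ →
            z (2 * k) = -(starRingEnd ℂ) (z (2 * k + 1))) ∧
          (‖z (2 * k)‖ < ‖z (2 * k + 1)‖ →
            (z (2 * k)).arg = (z (2 * k + 1)).arg ∧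
              ((z (2 * k + 1)).arg = -(Real.pi / 2) ∨ (z (2 * k + 1)).arg = Real.pi / 2))) ∧
        (∀ k : ℕ, 1 ≤ k → ((2 * k : ℕ) : ℕ∞) ≤ ω →
          Real.sign (z (2 * k - 1)).im = -Real.sign (z (2 * k)).im) ∧
        (-1) ^ j * c.im * (z 1).im < 0 ∧ (z 1).re = 0) := by
  obtain ⟨hf0, κ, v, hv, hfv⟩ := hf.exists_genusProd_of_neg hf_zeros
  obtain ⟨ι, u, hu, hgu⟩ := hg.exists_genusProd_of_nonneg hg_zeros hg₀ hgj
  rw [← hf₀] at hf0 hfv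
  have hnf : (‖f₀‖ : ℂ) ≠ 0 := by exact_mod_cast norm_ne_zero_iff.2 hf0
  have hng : (‖g₀‖ : ℂ) ≠ 0 := by exact_mod_cast norm_ne_zero_iff.2 hg₀
  have hcn : ‖c‖ = 1 := by
    have h1 : ‖f₀‖ ≠ 0 := norm_ne_zero_iff.2 hf0
    have h2 : ‖g₀‖ ≠ 0 := norm_ne_zero_iff.2 hg₀
    rw [hc, norm_neg, norm_div, norm_mul, norm_mul, Complex.norm_real, Complex.norm_real, norm_norm,
      norm_norm]
    field_simp
  have hpos : 0 < ‖f₀‖ / ‖g₀‖ := div_pos (norm_pos_iff.2 hf0) (norm_pos_iff.2 hg₀)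
  change HasZeroPattern F j c
  by_cases hne : Nonempty ι ∨ Nonempty κ
  -- exp k = |f₀|/|g₀| moves the moduli of the constants into the level, so that c is unimodular and
  -- -f₀ c exp (-k) = g₀.
  · let D : StripData := ⟨ι, κ, u, v, 2 * j + 1, Real.log (‖f₀‖ / ‖g₀‖), hu, hv, hne⟩
    have hFD : F = D.zeroFun j f₀ c := by
      funext z
      have hexp : ((Real.exp (-D.k) : ℝ) : ℂ) = ‖g₀‖ / ‖f₀‖ := by
        rw [Real.exp_neg, Real.exp_log hpos, inv_div]; push_cast; rfl
      rw [hF, hfv, hgu, StripData.zeroFun, hexp, hc]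
      field_simp
      ring
    rw [hFD]
    exact StripData.hasZeroPattern_zeroFun rfl hcn hf0
  · rw [not_or, not_nonempty_iff, not_nonempty_iff] at hne
    obtain ⟨hι, hκ⟩ := hne
    simp only [genusProd_of_isEmpty, mul_one] at hfv hgu
    have hj : j = 0 := by
      by_contra hj
      exact hnonconst ⟨hj, hfv, hgu⟩
    subst hj
    have hFlin : F = fun z => f₀ + z * g₀ := by
      funext z
      rw [hF, hfv, hgu, pow_zero, mul_one]
    rw [hFlin]
    refine hasZeroPattern_linear hg₀ hpos (norm_ne_zero_iff.1 (hcn ▸ one_ne_zero)) ?_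
    have h1 : c * (starRingEnd ℂ) c = 1 := by
      rw [Complex.mul_conj, Complex.normSq_eq_norm_sq, hcn]; simp
    have hc0 : c ≠ 0 := norm_ne_zero_iff.1 (hcn ▸ one_ne_zero)
    rw [eq_inv_of_mul_eq_one_right h1, hc]
    push_cast
    field_simp
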